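/- Let $d\ge 3$. A vector field $b:[0,\infty[\times\mathbb R^d\to\mathbb R^d$ with $|b|\in L^2_{\rm loc}([0,\infty[\times\mathbb R^d)$ belongs to $\mathbf F_\delta$ ($\delta>0$) with function $g=g_\delta$, $0\le g\in L^1_{\rm loc}([0,\infty[)$, if $$\int_0^\infty\|b(t,\cdot)\varphi(t,\cdot)\|_{L^2}^2\,dt\le\delta\int_0^\infty\|\nabla\varphi(t,\cdot)\|_{L^2}^2\,dt+\int_0^\infty g(t)\|\varphi(t,\cdot)\|_{L^2}^2\,dt\quad\text{for all }\varphi\in C_c^\infty([0,\infty[\times\mathbb R^d).$$ Fix $\theta>\frac d2$, and for $\kappa>0$ put $\rho(x)=(1+\kappa|x|^2)^{-\theta}$ and $L^p_\rho=L^p(\mathbb R^d,\rho\,dx)$. Let $0<\delta<d^{-2}$, $\beta>0$, $q\in\,]d,\delta^{-1/2}[$ and $T>0$, and let $g_\delta,g_\beta$ be given. Then there are constants $\kappa>0$ and $C$, depending only on $d,q,\delta,g_\delta,\beta,g_\beta,T,\theta$, such that the following holds. Let $b\in\mathbf F_\delta$ (with function $g_\delta$) and $\mathsf f\in\mathbf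 F_\beta$ (with function $g_\beta$) be bounded and $C^\infty$ smooth on $[0,\infty[\times\mathbb R^d$, let $h\in C([0,T],\mathcal S(\mathbb R^d))$ and $f\in C_c^\infty(\mathbb R^d)$ be real-valued, let $0\le s\le r\le T$, and let $v$ be the (bounded classical) solution of the Cauchy problem $$(\partial_t-\Delta+b\cdot\nabla)v=|\mathsf f|h\quad\text{on }[s,T]\times\mathbb R^d,\qquad v(s,\cdot)=f.$$ Then $$\|v\|^q_{L^\infty([s,r],L^q_\rho)}+\|\nabla v\|^q_{L^\infty([s,r],L^q_\rho)}+\big\|\nabla|\nabla v|^{\frac q2}\big\|^2_{L^2([s,r],L^2_\rho)}\le C\Big(\big\|\mathsf f|h|^{\frac q2}\big\|^2_{L^2([s,r],L^2_\rho)}+\|\nabla f\|^q_{L^q_\rho}+\|f\|^q_{L^q_\rho}\Big).$$ In particular, $C$ and $\kappa$ do not depend on $h$, $f$, $s$, $r$, nor on $b$, $\mathsf f$ other than through $\delta,g_\delta,\beta,g_\beta$. -/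

import Mathlib

open MeasureTheory Set
open scoped ENNReal NNReal ContDiff SchwartzMap

noncomputable section

/-- Form-boundedness, `b ∈ F_δ`, witnessed by the function `g = g_δ`, of a time-dependent vector
field `b : [0,∞[ × ℝ^d → ℝ^d` (only the values at times `t ≥ 0` matter). A test function in
`C_c^∞([0,∞[ × ℝ^d)` is the restriction to `t ≥ 0` of a smooth compactly supported function on
`ℝ × ℝ^d`; it need not vanish at `t = 0`. -/
structure IsFormBounded {d : ℕ}
    (b : ℝ → EuclideanSpace ℝ (Fin d) → EuclideanSpace ℝ (Fin d)) (δ : ℝ) (g : ℝ → ℝ) : Prop where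
  bound_pos : 0 < δ
  measurable : AEStronglyMeasurable (fun p : ℝ × EuclideanSpace ℝ (Fin d) => b p.1 p.2)
    (volume.restrict (Ici 0 ×ˢ univ))
  sq_locallyIntegrable : LocallyIntegrableOn
    (fun p : ℝ × EuclideanSpace ℝ (Fin d) => ‖b p.1 p.2‖ ^ 2) (Ici 0 ×ˢ univ) volume
  g_nonneg : ∀ t, 0 ≤ t → 0 ≤ g t
  g_locallyIntegrable : LocallyIntegrableOn g (Ici 0) volume
  form_bound : ∀ φ : ℝ → EuclideanSpace ℝ (Fin d) → ℝ,
    ContDiff ℝ ∞ (fun p : ℝ × EuclideanSpace ℝ (Fin d) => φ p.1 p.2) →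
    HasCompactSupport (fun p : ℝ × EuclideanSpace ℝ (Fin d) => φ p.1 p.2) →
    ∫ t in Ici (0 : ℝ), ∫ x, ‖φ t x • b t x‖ ^ 2 ≤
      δ * (∫ t in Ici (0 : ℝ), ∫ x, ‖gradient (φ t) x‖ ^ 2)
        + ∫ t in Ici (0 : ℝ), g t * ∫ x, (φ t x) ^ 2

/-- A time-dependent vector field that is bounded and `C^∞` smooth on `[0,∞[ × ℝ^d`. -/
structure IsBoundedSmooth {d : ℕ}
    (b : ℝ → EuclideanSpace ℝ (Fin d) → EuclideanSpace ℝ (Fin d)) : Prop where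
  smooth : ContDiffOn ℝ ∞ (fun p : ℝ × EuclideanSpace ℝ (Fin d) => b p.1 p.2) (Ici 0 ×ˢ univ)
  bounded : ∃ M : ℝ, ∀ t, 0 ≤ t → ∀ x, ‖b t x‖ ≤ M

/-- `v` is the (bounded, classical) solution on `[s,T] × ℝ^d` of the Cauchy problem
`(∂_t - Δ + b · ∇) v = F`, `v(s, ·) = f`: it is bounded, `v`, `∇v`, `D²v` exist and are continuous
on `[s,T] × ℝ^d`, and the equation holds at every point of `[s,T] × ℝ^d`, the time derivative
being one-sided at the end points. -/
structure IsSolution {d : ℕ}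
    (b : ℝ → EuclideanSpace ℝ (Fin d) → EuclideanSpace ℝ (Fin d))
    (F : ℝ → EuclideanSpace ℝ (Fin d) → ℝ) (f : EuclideanSpace ℝ (Fin d) → ℝ) (s T : ℝ)
    (v : ℝ → EuclideanSpace ℝ (Fin d) → ℝ) : Prop where
  bounded : ∃ M : ℝ, ∀ t ∈ Icc s T, ∀ x, |v t x| ≤ M
  contDiff : ∀ t ∈ Icc s T, ContDiff ℝ 2 (v t)
  continuousOn : ContinuousOn
    (fun p : ℝ × EuclideanSpace ℝ (Fin d) => v p.1 p.2) (Icc s T ×ˢ univ)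
  continuousOn_fderiv : ContinuousOn
    (fun p : ℝ × EuclideanSpace ℝ (Fin d) => fderiv ℝ (v p.1) p.2) (Icc s T ×ˢ univ)
  continuousOn_fderiv_fderiv : ContinuousOn
    (fun p : ℝ × EuclideanSpace ℝ (Fin d) => fderiv ℝ (fderiv ℝ (v p.1)) p.2) (Icc s T ×ˢ univ)
  equation : ∀ t ∈ Icc s T, ∀ x, HasDerivWithinAt (fun τ => v τ x)
    (Laplacian.laplacian (v t) x - inner ℝ (b t x) (gradient (v t) x) + F t x) (Icc s T) t
  initial : ∀ x, v s x = f x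

/-- The weight `ρ(x) = (1 + κ |x|²)^{-θ}`. -/
def weight {d : ℕ} (κ θ : ℝ) (x : EuclideanSpace ℝ (Fin d)) : ℝ :=
  (1 + κ * ‖x‖ ^ 2) ^ (-θ)

/-- The measure `ρ dx` on `ℝ^d`, so that `L^q_ρ = L^q(ℝ^d, ρ dx)`. -/
def weightMeasure (d : ℕ) (κ θ : ℝ) : Measure (EuclideanSpace ℝ (Fin d)) :=
  volume.withDensity (fun x => ENNReal.ofReal (weight κ θ x))

/-- The norm of `L^∞([s,r], L^q(μ))`, with values in `[0,∞]`. -/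
def supLpNorm {d : ℕ} {E : Type*} [NormedAddCommGroup E] (q s r : ℝ)
    (μ : Measure (EuclideanSpace ℝ (Fin d))) (u : ℝ → EuclideanSpace ℝ (Fin d) → E) : ℝ≥0∞ :=
  essSup (fun t => eLpNorm (u t) (ENNReal.ofReal q) μ) (volume.restrict (Icc s r))

/-- The square of the norm of `L²([s,r], L²(μ))`, with values in `[0,∞]`. -/
def sqLTwoNorm {d : ℕ} {E : Type*} [NormedAddCommGroup E] (s r : ℝ)
    (μ : Measure (EuclideanSpace ℝ (Fin d))) (u : ℝ → EuclideanSpace ℝ (Fin d) → E) : ℝ≥0∞ :=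
  ∫⁻ t in Icc s r, (eLpNorm (u t) 2 μ) ^ 2

end

/-!
The estimate is an energy estimate for `∫ (|∇v|^q + |v|^q) ρ`, with `κ = 1`; any `κ` would do, since
`|∇ρ| ≤ θ κ^{1/2} ρ` and the error made by the weight is of lower order.

At a fixed time, let `w = ∇v` and let `Φ = ζ² |w|^{q-2} w` (`powerField`). Testing the equation with
`-div Φ` and integrating by parts produces the coercive terms `∫ |w|^{q-2} |Dw|² ζ²` and
`∫ |∇|w|^{q/2}|² ζ²`. The drift contributes `∫ |b|² |w|^q ζ²`, which the form bound, tested with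
`|w|^{q/2} ζ`, controls by `q^{-2} ∫ |∇|w|^{q/2}|² ζ²` and terms of lower order because
`δ q² < 1`; this is absorbed because `q > d` (`exists_gradient_slice_bound`). The source is treated
by the form bound of `F` and Young's inequality, and the equation tested with `ζ² |v|^{q-2} v` gives
the terms without derivatives (`exists_value_slice_bound`). Form bounds are given in space-time;
they hold on almost every time slice by Lebesgue differentiation (`IsFormBounded.ae_slice`).

Three points need care, since a bounded classical solution is only of class `C²` in space and no
decay or growth of `∇v` is known.

* Third derivatives of `v` do not appear: `∫ div w div Φ = ∫ Dw : DΦ` holds for `C¹` fields by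
  mollification (`integral_divergence_mul_divergence`).
* The energy is differentiated in time without using `∂_t ∇v`. It is convex, its subgradient at
  `v(t)` is `energySubgradient`, which is continuous in time, and the subgradient inequality at two
  times squeezes the difference quotient (`hasDerivAt_of_subgradient`).
* The weight is cut off, `ζ² = ρ ψ^{q+2}`, and the error `∫ |w|^q |∇ψ|² ρ ψ^q` is interpolated
  between the second derivatives and `sup |v|` (`exists_interpolation_bound`). It is therefore of
  order `ℓ² sup |v|^q` with `ℓ = sup |∇ψ|`, and vanishes as the cut-off is removed by Fatou's lemma.

Gronwall's lemma with the integrable kernel `C (1 + g_δ + g_β)` concludes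
(`exists_localEnergy_bound`).
-/

/-! ### Young's inequality and Gronwall's lemma -/

/-- Young's inequality with a small constant in front of one of the terms. -/
lemma exists_rpow_mul_rpow_le {α q ε : ℝ} (hα : 0 < α) (hq : α < q) (hε : 0 < ε) :
    ∃ C : ℝ, 0 ≤ C ∧ ∀ x y : ℝ, 0 ≤ x → 0 ≤ y → x ^ α * y ^ (q - α) ≤ ε * y ^ q + C * x ^ q := by
  refine ⟨(ε⁻¹ ^ α⁻¹) ^ (q - α), by positivity, fun x y hx hy => ?_⟩
  have hqα : 0 < q - α := sub_pos.2 hq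
  rcases le_total (x ^ α) (ε * y ^ α) with h | h
  · calc x ^ α * y ^ (q - α) ≤ ε * y ^ α * y ^ (q - α) := by gcongr
      _ = ε * y ^ q := by
        rw [mul_assoc, ← Real.rpow_add_of_nonneg hy hα.le hqα.le]; congr 2; ring
      _ ≤ _ := le_add_of_nonneg_right (by positivity)
  · have h1 : y ≤ ε⁻¹ ^ α⁻¹ * x := by
      have h2 : y ^ α ≤ ε⁻¹ * x ^ α := by
        rw [inv_mul_eq_div, le_div_iff₀ hε]; linarith
      have h3 := Real.rpow_le_rpow (by positivity) h2 (inv_nonneg.2 hα.le)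
      rwa [Real.mul_rpow (by positivity) (by positivity), Real.rpow_rpow_inv hy hα.ne',
        Real.rpow_rpow_inv hx hα.ne'] at h3
    calc x ^ α * y ^ (q - α) ≤ x ^ α * (ε⁻¹ ^ α⁻¹ * x) ^ (q - α) := by gcongr
      _ = (ε⁻¹ ^ α⁻¹) ^ (q - α) * x ^ q := by
        rw [Real.mul_rpow (by positivity) hx, mul_left_comm,
          ← Real.rpow_add_of_nonneg hx hα.le hqα.le]; congr 2; ring
      _ ≤ _ := le_add_of_nonneg_left (by positivity)

/-- Gronwall's lemma in integral form with a continuous kernel. -/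
lemma gronwall_of_continuous {E a : ℝ → ℝ} {s r N : ℝ}
    (hE : ContinuousOn E (Icc s r)) (ha : Continuous a) (ha0 : ∀ t, 0 ≤ a t)
    (h : ∀ t ∈ Icc s r, E t ≤ N + ∫ τ in s..t, a τ * E τ) :
    ∀ t ∈ Icc s r, E t ≤ N * Real.exp (∫ τ in s..t, a τ) := by
  intro t ht
  have hsr : s ≤ r := ht.1.trans ht.2
  set E' : ℝ → ℝ := fun τ => E (projIcc s r hsr τ) with hE'
  have hE'c : Continuous E' :=
    (continuousOn_iff_continuous_domRestrict.1 hE).comp continuous_projIcc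
  have hEE : ∀ τ ∈ Icc s r, E' τ = E τ := fun τ hτ => by simp [hE', projIcc_of_mem hsr hτ]
  have hint : ∀ t ∈ Icc s r, ∫ τ in s..t, a τ * E τ = ∫ τ in s..t, a τ * E' τ := fun t ht => by
    refine intervalIntegral.integral_congr fun τ hτ => ?_
    rw [uIcc_of_le ht.1] at hτ
    simp only [hEE τ ⟨hτ.1, hτ.2.trans ht.2⟩]
  set y : ℝ → ℝ := fun t => N + ∫ τ in s..t, a τ * E' τ
  set g : ℝ → ℝ := fun t => y t * Real.exp (-∫ τ in s..t, a τ)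
  have hy : ∀ t, HasDerivAt y (a t * E' t) t := fun t =>
    ((ha.mul hE'c).integral_hasStrictDerivAt s t).hasDerivAt.const_add N
  have hA : ∀ t, HasDerivAt (fun t => ∫ τ in s..t, a τ) (a t) t := fun t =>
    (ha.integral_hasStrictDerivAt s t).hasDerivAt
  have hg : ∀ t, HasDerivAt g (a t * E' t * Real.exp (-∫ τ in s..t, a τ)
      + y t * (Real.exp (-∫ τ in s..t, a τ) * (-a t))) t := fun t =>
    (hy t).mul (hA t).neg.exp
  have hanti : AntitoneOn g (Icc s r) := by
    refine antitoneOn_of_hasDerivWithinAt_nonpos (convex_Icc s r)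
      (fun t _ => (hg t).continuousAt.continuousWithinAt) (fun t _ => (hg t).hasDerivWithinAt)
      fun t ht => ?_
    rw [interior_Icc] at ht
    have ht' := Ioo_subset_Icc_self ht
    have h1 : E' t ≤ y t := by
      rw [hEE t ht']; simpa only [y, ← hint t ht'] using h t ht'
    have := mul_le_mul_of_nonneg_left h1 (mul_nonneg (ha0 t) (Real.exp_pos (-∫ τ in s..t, a τ)).le)
    nlinarith
  have h2 : g t ≤ N := by
    have := hanti (left_mem_Icc.2 hsr) ht ht.1
    simpa [g, y] using this
  have h3 : y t ≤ N * Real.exp (∫ τ in s..t, a τ) := by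
    simp only [g, Real.exp_neg] at h2
    rwa [← div_eq_mul_inv, div_le_iff₀ (Real.exp_pos _)] at h2
  refine le_trans ?_ h3
  simpa only [y, ← hint t ht] using h t ht

/-- Gronwall's lemma in integral form with an integrable kernel. -/
lemma gronwall_of_integrable {E a : ℝ → ℝ} {s r N : ℝ} (hN : 0 ≤ N)
    (hE : ContinuousOn E (Icc s r)) (hE0 : ∀ t ∈ Icc s r, 0 ≤ E t)
    (ha : IntegrableOn a (Icc s r)) (ha0 : ∀ t ∈ Icc s r, 0 ≤ a t)
    (h : ∀ t ∈ Icc s r, E t ≤ N + ∫ τ in s..t, a τ * E τ) :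
    ∀ t ∈ Icc s r, E t ≤ N * Real.exp (∫ τ in Icc s r, a τ) := by
  intro t ht
  have hsr : s ≤ r := ht.1.trans ht.2
  obtain ⟨M, hM⟩ := isCompact_Icc.exists_bound_of_continuousOn hE
  have hM0 : 0 ≤ M := (norm_nonneg _).trans (hM t ht)
  have key : ∀ ε > 0, E t ≤ (N + M * ε) * Real.exp ((∫ τ in Icc s r, a τ) + ε) := by
    intro ε hε
    -- replace the kernel by the absolute value of a continuous `L¹` approximation
    obtain ⟨c, -, hc, hcc, hci⟩ := ha.exists_hasCompactSupport_integral_sub_le hε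
    set c' : ℝ → ℝ := fun τ => |c τ|
    have hc' : Continuous c' := hcc.abs
    have hac : IntegrableOn (fun τ => a τ - c τ) (Icc s r) := ha.sub hci
    have hsub : ∀ t ∈ Icc s r, Ioc s t ⊆ Icc s r := fun t ht τ hτ => ⟨hτ.1.le, hτ.2.trans ht.2⟩
    have hcE : ContinuousOn (fun τ => c' τ * E τ) (Icc s r) := hc'.continuousOn.mul hE
    have haE : IntegrableOn (fun τ => a τ * E τ) (Icc s r) :=
      ha.mul_continuousOn hE isCompact_Icc
    have h1 : ∀ t ∈ Icc s r, E t ≤ (N + M * ε) + ∫ τ in s..t, c' τ * E τ := by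
      intro t ht
      have h2 : ∫ τ in s..t, a τ * E τ ≤ M * ε + ∫ τ in s..t, c' τ * E τ := by
        rw [← sub_le_iff_le_add]
        have hi1 : IntervalIntegrable (fun τ => a τ * E τ) volume s t :=
          (intervalIntegrable_iff_integrableOn_Ioc_of_le ht.1).2 (haE.mono_set (hsub t ht))
        have hi2 : IntervalIntegrable (fun τ => c' τ * E τ) volume s t :=
          (intervalIntegrable_iff_integrableOn_Ioc_of_le ht.1).2
            ((hcE.integrableOn_Icc).mono_set (hsub t ht))
        rw [← intervalIntegral.integral_sub hi1 hi2, intervalIntegral.integral_of_le ht.1]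
        calc ∫ τ in Ioc s t, a τ * E τ - c' τ * E τ
            ≤ ∫ τ in Ioc s t, M * ‖a τ - c τ‖ := by
              refine setIntegral_mono_on (hi1.1.sub hi2.1)
                (IntegrableOn.mono_set (hac.norm.const_mul M) (hsub t ht)) measurableSet_Ioc
                fun τ hτ => ?_
              have hτ' := hsub t ht hτ
              have e1 : a τ - c' τ ≤ ‖a τ - c τ‖ := by
                have : c τ ≤ c' τ := le_abs_self _
                exact (sub_le_sub_left this _).trans (le_abs_self _)
              have e2 : E τ ≤ M := (le_abs_self _).trans (hM τ hτ')
              calc a τ * E τ - c' τ * E τ = E τ * (a τ - c' τ) := by ring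
                _ ≤ E τ * ‖a τ - c τ‖ := mul_le_mul_of_nonneg_left e1 (hE0 τ hτ')
                _ ≤ M * ‖a τ - c τ‖ := mul_le_mul_of_nonneg_right e2 (norm_nonneg _)
          _ ≤ ∫ τ in Icc s r, M * ‖a τ - c τ‖ :=
              setIntegral_mono_set (hac.norm.const_mul M)
                (Filter.Eventually.of_forall fun τ => by positivity) (hsub t ht).eventuallyLE
          _ ≤ M * ε := by
              rw [integral_const_mul]; exact mul_le_mul_of_nonneg_left hc hM0
      linarith [h t ht]
    have h3 := gronwall_of_continuous hE hc' (fun _ => abs_nonneg _) h1 t ht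
    refine h3.trans (mul_le_mul_of_nonneg_left (Real.exp_le_exp.2 ?_) (by positivity))
    rw [intervalIntegral.integral_of_le ht.1]
    have hci' : IntegrableOn c' (Icc s r) := hc'.continuousOn.integrableOn_Icc
    calc ∫ τ in Ioc s t, c' τ ≤ ∫ τ in Icc s r, c' τ :=
          setIntegral_mono_set hci' (Filter.Eventually.of_forall fun τ => abs_nonneg _)
            (hsub t ht).eventuallyLE
      _ ≤ ∫ τ in Icc s r, (a τ + ‖a τ - c τ‖) := by
          refine setIntegral_mono_on hci' (ha.add hac.norm) measurableSet_Icc fun τ hτ => ?_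
          have := ha0 τ hτ
          calc |c τ| = |a τ - (a τ - c τ)| := by ring_nf
            _ ≤ |a τ| + |a τ - c τ| := abs_sub _ _
            _ = a τ + ‖a τ - c τ‖ := by rw [abs_of_nonneg this]; rfl
      _ ≤ _ := by rw [integral_add ha hac.norm]; gcongr
  have hlim : Filter.Tendsto (fun ε : ℝ => (N + M * ε) * Real.exp ((∫ τ in Icc s r, a τ) + ε))
      (nhdsWithin 0 (Ioi 0)) (nhds (N * Real.exp (∫ τ in Icc s r, a τ))) := by
    have : Continuous fun ε : ℝ => (N + M * ε) * Real.exp ((∫ τ in Icc s r, a τ) + ε) := by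
      fun_prop
    simpa using (this.tendsto 0).mono_left nhdsWithin_le_nhds
  exact ge_of_tendsto hlim (Filter.eventually_of_mem self_mem_nhdsWithin key)

/-! ### Approximation of compactly supported `C¹` functions, and integration by parts -/

section Calculus
variable {V : Type*} [NormedAddCommGroup V] [InnerProductSpace ℝ V] [FiniteDimensional ℝ V]
  [MeasurableSpace V] [BorelSpace V]

lemma exists_norm_normed_convolution_le {E : Type*} [NormedAddCommGroup E] [NormedSpace ℝ E]
    [CompleteSpace E] (φ : ℕ → ContDiffBump (0 : V)) {k : V → E} (hk : Continuous k)
    (hkc : HasCompactSupport k) : ∃ C : ℝ, ∀ n x,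
      ‖convolution ((φ n).normed volume) k (ContinuousLinearMap.lsmul ℝ ℝ (E := E)) volume x‖
        ≤ C := by
  obtain ⟨C, hC⟩ := hkc.exists_bound_of_continuous hk
  refine ⟨C + (C + C), fun n x => ?_⟩
  have h1 := (φ n).dist_normed_convolution_le (g := k) (μ := volume) (x₀ := x) (ε := C + C)
    hk.aestronglyMeasurable
    (fun y _ => (dist_le_norm_add_norm _ _).trans (add_le_add (hC y) (hC x)))
  rw [dist_eq_norm] at h1
  exact (norm_le_norm_add_norm_sub' _ (k x)).trans (add_le_add (hC x) h1)

/-- A compactly supported `C¹` function is the limit of test functions, with supports in a fixed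
compact set, in the sense of bounded pointwise convergence of the functions and their
derivatives. -/
lemma exists_smooth_approx {g : V → ℝ} (hg : ContDiff ℝ 1 g) (hgc : HasCompactSupport g) :
    ∃ (G : ℕ → V → ℝ) (K : Set V) (C : ℝ), IsCompact K ∧
      (∀ n, ContDiff ℝ ∞ (G n)) ∧ (∀ n, HasCompactSupport (G n)) ∧
      (∀ n x, x ∉ K → G n x = 0 ∧ fderiv ℝ (G n) x = 0) ∧
      (∀ n x, |G n x| ≤ C ∧ ‖fderiv ℝ (G n) x‖ ≤ C) ∧
      (∀ x, Filter.Tendsto (fun n => G n x) Filter.atTop (nhds (g x))) ∧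
      (∀ x, Filter.Tendsto (fun n => fderiv ℝ (G n) x) Filter.atTop (nhds (fderiv ℝ g x))) := by
  let φ : ℕ → ContDiffBump (0 : V) := fun n =>
    ⟨1 / (2 * ((n : ℝ) + 1)), 1 / ((n : ℝ) + 1), by positivity, by
      apply one_div_lt_one_div_of_lt <;> linarith [n.cast_nonneg (α := ℝ)]⟩
  have hφ1 : ∀ n, (φ n).rOut ≤ 1 := fun n => by
    change 1 / ((n : ℝ) + 1) ≤ 1
    rw [div_le_one (by positivity)]; linarith [n.cast_nonneg (α := ℝ)]
  have hφ0 : Filter.Tendsto (fun n => (φ n).rOut) Filter.atTop (nhds 0) :=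
    tendsto_one_div_add_atTop_nhds_zero_nat
  let L := ContinuousLinearMap.lsmul ℝ ℝ (E := ℝ)
  let G : ℕ → V → ℝ := fun n => convolution ((φ n).normed volume) g L volume
  let G' : ℕ → V → V →L[ℝ] ℝ := fun n => convolution ((φ n).normed volume) (fderiv ℝ g)
    (ContinuousLinearMap.lsmul ℝ ℝ (E := V →L[ℝ] ℝ)) volume
  have hdg : Continuous (fderiv ℝ g) := hg.continuous_fderiv (by norm_num)
  have hloc : ∀ n, LocallyIntegrable ((φ n).normed volume) (volume : Measure V) := fun n =>
    (φ n).continuous_normed.locallyIntegrable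
  have hG : ∀ n x, HasFDerivAt (G n) (G' n x) x := fun n x => by
    have := hgc.hasFDerivAt_convolution_right L (hloc n) hg x
    exact this
  have hGf : ∀ n x, fderiv ℝ (G n) x = G' n x := fun n x => (hG n x).fderiv
  obtain ⟨C1, hC1⟩ := exists_norm_normed_convolution_le φ hg.continuous hgc
  obtain ⟨C2, hC2⟩ := exists_norm_normed_convolution_le φ hdg (hgc.fderiv ℝ)
  obtain ⟨R, hR⟩ := hgc.isCompact.isBounded.subset_closedBall (0 : V)
  have hsupp : ∀ n x, x ∉ Metric.closedBall (0 : V) (R + 1) → G n x = 0 ∧ G' n x = 0 := by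
    intro n x hx
    simp only [Metric.mem_closedBall, dist_zero_right, not_le] at hx
    have hout : ∀ y ∈ Metric.ball x (φ n).rOut, y ∉ tsupport g := fun y hy hy' => by
      have h1 := hR hy'
      simp only [Metric.mem_closedBall, dist_zero_right] at h1
      have h2 := Metric.mem_ball.1 hy
      rw [dist_comm, dist_eq_norm] at h2
      have h3 := norm_le_norm_add_norm_sub y x
      rw [norm_sub_rev] at h3
      have h4 : ‖x‖ ≤ ‖y‖ + ‖x - y‖ := by simpa [norm_sub_rev] using norm_le_norm_add_norm_sub y x
      linarith [hφ1 n]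
    have hx' := hout x (Metric.mem_ball_self (φ n).rOut_pos)
    have z1 : ∀ y, y ∉ tsupport g → g y = 0 := fun y hy => image_eq_zero_of_notMem_tsupport hy
    have z2 : ∀ y, y ∉ tsupport g → fderiv ℝ g y = 0 := fun y hy => by
      by_contra h
      exact hy (support_fderiv_subset ℝ h)
    constructor
    · have := (φ n).normed_convolution_eq_right (g := g) (μ := volume) (x₀ := x)
        (fun y hy => by rw [z1 y (hout y hy), z1 x hx'])
      rw [z1 x hx'] at this; exact this
    · have := (φ n).normed_convolution_eq_right (g := fderiv ℝ g) (μ := volume) (x₀ := x)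
        (fun y hy => by rw [z2 y (hout y hy), z2 x hx'])
      rw [z2 x hx'] at this; exact this
  refine ⟨G, Metric.closedBall 0 (R + 1), max C1 C2, isCompact_closedBall _ _, fun n => ?_,
    fun n => ?_, fun n x hx => ?_, fun n x => ?_, fun x => ?_, fun x => ?_⟩
  · exact (φ n).hasCompactSupport_normed.contDiff_convolution_left L (φ n).contDiff_normed
      hg.continuous.locallyIntegrable
  · exact HasCompactSupport.intro (isCompact_closedBall (0 : V) (R + 1))
      fun x hx => (hsupp n x hx).1
  · rw [hGf]; exact hsupp n x hx
  · rw [hGf]; exact ⟨(hC1 n x).trans (le_max_left _ _), (hC2 n x).trans (le_max_right _ _)⟩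
  · exact ContDiffBump.convolution_tendsto_right_of_continuous hφ0 hg.continuous x
  · simp only [hGf]
    exact ContDiffBump.convolution_tendsto_right_of_continuous hφ0 hdg x

lemma integral_mul_fderiv_of_hasCompactSupport {f g : V → ℝ} (hf : ContDiff ℝ 1 f)
    (hg : ContDiff ℝ 1 g) (hgc : HasCompactSupport g) (a : V) :
    ∫ x, f x * fderiv ℝ g x a = -∫ x, fderiv ℝ f x a * g x := by
  have hdf : Continuous fun x => fderiv ℝ f x a :=
    (hf.continuous_fderiv (by norm_num)).clm_apply continuous_const
  have hdg : Continuous fun x => fderiv ℝ g x a :=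
    (hg.continuous_fderiv (by norm_num)).clm_apply continuous_const
  exact integral_mul_fderiv_eq_neg_fderiv_mul_of_integrable
    ((hdf.mul hg.continuous).integrable_of_hasCompactSupport hgc.mul_left)
    ((hf.continuous.mul hdg).integrable_of_hasCompactSupport (hgc.fderiv_apply ℝ a).mul_left)
    ((hf.continuous.mul hg.continuous).integrable_of_hasCompactSupport hgc.mul_left)
    (fun x _ => hf.differentiable (by norm_num) x) (fun x _ => hg.differentiable (by norm_num) x)

/-- Two directional derivatives may be exchanged under the integral sign, although neither function
need be twice differentiable. -/
lemma integral_fderiv_mul_fderiv_comm {f g : V → ℝ} (hf : ContDiff ℝ 1 f)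
    (hg : ContDiff ℝ 1 g) (hgc : HasCompactSupport g) (a b : V) :
    ∫ x, fderiv ℝ f x a * fderiv ℝ g x b = ∫ x, fderiv ℝ f x b * fderiv ℝ g x a := by
  obtain ⟨G, K, C, hK, hGs, hGc, hG0, hGb, -, hGt⟩ := exists_smooth_approx hg hgc
  have hderiv : ∀ n, ContDiff ℝ 1 (fderiv ℝ (G n)) := fun n =>
    (hGs n).fderiv_right (m := 1) (by rw [one_add_one_eq_two]; exact ENat.LEInfty.out)
  have hsm : ∀ n, ∫ x, fderiv ℝ f x a * fderiv ℝ (G n) x b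
      = ∫ x, fderiv ℝ f x b * fderiv ℝ (G n) x a := by
    intro n
    have hd : ∀ a, ContDiff ℝ 1 fun x => fderiv ℝ (G n) x a := fun a =>
      (hderiv n).clm_apply contDiff_const
    have e1 := integral_mul_fderiv_of_hasCompactSupport hf (hd b) ((hGc n).fderiv_apply ℝ b) a
    have e2 := integral_mul_fderiv_of_hasCompactSupport hf (hd a) ((hGc n).fderiv_apply ℝ a) b
    have e3 : ∀ x, fderiv ℝ (fun x => fderiv ℝ (G n) x b) x a
        = fderiv ℝ (fun x => fderiv ℝ (G n) x a) x b := by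
      intro x
      have hdd : DifferentiableAt ℝ (fderiv ℝ (G n)) x :=
        (hderiv n).differentiable (by norm_num) x
      rw [fderiv_clm_apply hdd (differentiableAt_const _),
        fderiv_clm_apply hdd (differentiableAt_const _)]
      have := ((hGs n).contDiffAt (x := x)).isSymmSndFDerivAt (by
        simp only [minSmoothness_of_isRCLikeNormedField]; exact ENat.LEInfty.out)
      simpa using this a b
    simp only [e3] at e1
    linarith
  have hlim : ∀ a b, Filter.Tendsto (fun n => ∫ x, fderiv ℝ f x a * fderiv ℝ (G n) x b)
      Filter.atTop (nhds (∫ x, fderiv ℝ f x a * fderiv ℝ g x b)) := by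
    intro a b
    have hdf : Continuous fun x => fderiv ℝ f x a :=
      (hf.continuous_fderiv (by norm_num)).clm_apply continuous_const
    refine tendsto_integral_of_dominated_convergence
      (K.indicator fun x => ‖fderiv ℝ f x a‖ * (C * ‖b‖)) (fun n => ?_) ?_ (fun n => ?_) ?_
    · exact (hdf.mul (((hGs n).continuous_fderiv (by simp)).clm_apply
        continuous_const)).aestronglyMeasurable
    · rw [integrable_indicator_iff hK.measurableSet]
      exact (hdf.norm.mul continuous_const).continuousOn.integrableOn_compact hK
    · refine Filter.Eventually.of_forall fun x => ?_
      by_cases hx : x ∈ K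
      · rw [indicator_of_mem hx, norm_mul]
        gcongr
        exact (ContinuousLinearMap.le_opNorm _ _).trans (by gcongr; exact (hGb n x).2)
      · simp [hx, (hG0 n x hx).2]
    · refine Filter.Eventually.of_forall fun x => ?_
      exact Filter.Tendsto.const_mul _
        (((ContinuousLinearMap.apply ℝ ℝ b).continuous.tendsto _).comp (hGt x))
  exact tendsto_nhds_unique (hlim a b) (by simpa only [hsm] using hlim b a)

end Calculus

/-! ### Form bounds on time slices -/

lemma norm_gradient {V : Type*} [NormedAddCommGroup V] [InnerProductSpace ℝ V] [CompleteSpace V]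
    (f : V → ℝ) (x : V) : ‖gradient f x‖ = ‖fderiv ℝ f x‖ :=
  (InnerProductSpace.toDual ℝ V).symm.norm_map _

/-- The form bound at a fixed time, for a scalar `B` such as `|b(t, ·)|`, tested with compactly
supported `C¹` functions. -/
def SliceFormBound {V : Type*} [NormedAddCommGroup V] [InnerProductSpace ℝ V]
    [FiniteDimensional ℝ V] [MeasurableSpace V] [BorelSpace V] (B : V → ℝ) (δ g : ℝ) : Prop :=
  ∀ ψ : V → ℝ, ContDiff ℝ 1 ψ → HasCompactSupport ψ →
    ∫ x, B x ^ 2 * ψ x ^ 2 ≤ δ * (∫ x, ‖fderiv ℝ ψ x‖ ^ 2) + g * ∫ x, ψ x ^ 2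

/-- By mollification, a form bound on test functions extends to compactly supported `C¹`
functions. -/
lemma sliceFormBound_of_smooth {V : Type*} [NormedAddCommGroup V] [InnerProductSpace ℝ V]
    [FiniteDimensional ℝ V] [MeasurableSpace V] [BorelSpace V] {B : V → ℝ} {δ g : ℝ}
    (hB : Continuous B) (h : ∀ ψ : V → ℝ, ContDiff ℝ ∞ ψ → HasCompactSupport ψ →
    ∫ x, B x ^ 2 * ψ x ^ 2 ≤ δ * (∫ x, ‖fderiv ℝ ψ x‖ ^ 2) + g * ∫ x, ψ x ^ 2) :
    SliceFormBound B δ g := by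
  intro ψ hψ hψc
  obtain ⟨G, K, C, hK, hGs, hGc, hG0, hGb, hGt, hGt'⟩ := exists_smooth_approx hψ hψc
  have hL2 : ∀ k : V → ℝ, Continuous k →
      Filter.Tendsto (fun n => ∫ x, k x * G n x ^ 2) Filter.atTop
        (nhds (∫ x, k x * ψ x ^ 2)) := by
    intro k hk
    refine tendsto_integral_of_dominated_convergence
      (K.indicator fun x => ‖k x‖ * C ^ 2) (fun n => ?_) ?_ (fun n => ?_) ?_
    · exact (hk.mul ((hGs n).continuous.pow 2)).aestronglyMeasurable
    · rw [integrable_indicator_iff hK.measurableSet]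
      exact (hk.norm.mul continuous_const).continuousOn.integrableOn_compact hK
    · refine Filter.Eventually.of_forall fun x => ?_
      by_cases hx : x ∈ K
      · rw [indicator_of_mem hx, norm_mul, norm_pow]
        gcongr
        exact (hGb n x).1
      · simp [hx, (hG0 n x hx).1]
    · exact Filter.Eventually.of_forall fun x => ((hGt x).pow 2).const_mul _
  have hD : Filter.Tendsto (fun n => ∫ x, ‖fderiv ℝ (G n) x‖ ^ 2) Filter.atTop
        (nhds (∫ x, ‖fderiv ℝ ψ x‖ ^ 2)) := by
    refine tendsto_integral_of_dominated_convergence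
      (K.indicator fun x => C ^ 2) (fun n => ?_) ?_ (fun n => ?_) ?_
    · exact (((hGs n).continuous_fderiv (by simp)).norm.pow 2).aestronglyMeasurable
    · rw [integrable_indicator_iff hK.measurableSet]
      exact continuous_const.continuousOn.integrableOn_compact hK
    · refine Filter.Eventually.of_forall fun x => ?_
      by_cases hx : x ∈ K
      · rw [indicator_of_mem hx, norm_pow, norm_norm]
        gcongr
        exact (hGb n x).2
      · simp [hx, (hG0 n x hx).2]
    · exact Filter.Eventually.of_forall fun x => (hGt' x).norm.pow 2
  refine le_of_tendsto_of_tendsto (hL2 (fun x => B x ^ 2) (hB.pow 2)) ((hD.const_mul δ).add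
    (Filter.Tendsto.const_mul g (by simpa using hL2 (fun _ => 1) continuous_const)))
    (Filter.Eventually.of_forall fun n => h _ (hGs n) (hGc n))

/-- Smooth cut-offs in time decreasing to the indicator function of `[a, b]`. -/
lemma exists_smooth_tendsto_indicator {a b : ℝ} (ha : 0 ≤ a) (hab : a < b) :
    ∃ χ : ℕ → ℝ → ℝ, (∀ n, ContDiff ℝ ∞ (χ n)) ∧ (∀ n, HasCompactSupport (χ n)) ∧
      ∀ k : ℝ → ℝ, LocallyIntegrableOn k (Ici 0) → Filter.Tendsto
        (fun n => ∫ t in Ici (0 : ℝ), χ n t ^ 2 * k t) Filter.atTop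
        (nhds (∫ t in Icc a b, k t)) := by
  let c := (a + b) / 2
  let χ : ℕ → ContDiffBump c := fun n =>
    ⟨(b - a) / 2, (b - a) / 2 + 1 / ((n : ℝ) + 1), by linarith, by
      have : 0 < 1 / ((n : ℝ) + 1) := by positivity
      linarith⟩
  have hin : ∀ n t, t ∈ Icc a b → χ n t = 1 := fun n t ht => by
    refine (χ n).one_of_mem_closedBall ?_
    rw [Metric.mem_closedBall, Real.dist_eq, abs_le]
    change -((b - a) / 2) ≤ t - (a + b) / 2 ∧ t - (a + b) / 2 ≤ (b - a) / 2
    constructor <;> linarith [ht.1, ht.2]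
  have hout : ∀ (n : ℕ) t, (b - a) / 2 + 1 / ((n : ℝ) + 1) ≤ |t - c| → χ n t = 0 := fun n t ht =>
    (χ n).zero_of_le_dist (by rw [Real.dist_eq]; exact ht)
  refine ⟨fun n => χ n, fun n => (χ n).contDiff, fun n => (χ n).hasCompactSupport, fun k hk => ?_⟩
  rw [← integral_indicator measurableSet_Icc, ← setIntegral_eq_integral_of_forall_compl_eq_zero
    (s := Ici (0 : ℝ)) (f := (Icc a b).indicator k) (fun x hx => indicator_of_notMem
      (fun h => hx (ha.trans h.1)) _)]
  have hkm : AEStronglyMeasurable k (volume.restrict (Ici 0)) := hk.aestronglyMeasurable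
  refine tendsto_integral_of_dominated_convergence
      ((Icc 0 (b + 1)).indicator fun t => ‖k t‖) (fun n => ?_) ?_ (fun n => ?_) ?_
  · exact ((χ n).continuous.pow 2).aestronglyMeasurable.mul hkm
  · rw [integrable_indicator_iff measurableSet_Icc]
    refine IntegrableOn.mono_measure ?_ Measure.restrict_le_self
    exact (hk.integrableOn_compact_subset Icc_subset_Ici_self isCompact_Icc).norm
  · refine (ae_restrict_mem measurableSet_Ici).mono fun t ht => ?_
    by_cases hx : t ∈ Icc 0 (b + 1)
    · rw [indicator_of_mem hx, norm_mul, norm_pow]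
      have : ‖χ n t‖ ≤ 1 := by
        rw [Real.norm_of_nonneg (χ n).nonneg]; exact (χ n).le_one
      calc ‖χ n t‖ ^ 2 * ‖k t‖ ≤ 1 ^ 2 * ‖k t‖ := by gcongr
        _ = _ := by ring
    · have hb : b + 1 < t := not_le.1 fun h => hx ⟨ht, h⟩
      have : χ n t = 0 := hout n t (by
        have : 1 / ((n : ℝ) + 1) ≤ 1 := by
          rw [div_le_one (by positivity)]; linarith [n.cast_nonneg (α := ℝ)]
        refine le_trans ?_ (le_abs_self _)
        change _ ≤ t - (a + b) / 2
        linarith)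
      simp [hx, this]
  · refine (ae_restrict_mem measurableSet_Ici).mono fun t ht => ?_
    by_cases hx : t ∈ Icc a b
    · simp [hin _ t hx, hx]
    · have hpos : (b - a) / 2 < |t - c| := by
        by_contra! h
        rw [abs_le] at h
        change -((b - a) / 2) ≤ t - (a + b) / 2 ∧ t - (a + b) / 2 ≤ (b - a) / 2 at h
        exact hx ⟨by linarith [h.1], by linarith [h.2]⟩
      have hev : ∀ᶠ n : ℕ in Filter.atTop, 1 / ((n : ℝ) + 1) < |t - c| - (b - a) / 2 :=
        (tendsto_order.1 (tendsto_one_div_add_atTop_nhds_zero_nat (𝕜 := ℝ))).2 _ (by linarith)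
      rw [indicator_of_notMem hx]
      refine tendsto_const_nhds.congr' (hev.mono fun n hn => ?_)
      simp [hout n t (by linarith)]

/-- A form bound in space-time with a continuous field holds on almost every time slice. The
exceptional set depends only on the Lebesgue points of `g`, not on the test function. -/
lemma IsFormBounded.ae_slice {d : ℕ}
    {b : ℝ → EuclideanSpace ℝ (Fin d) → EuclideanSpace ℝ (Fin d)} {δ : ℝ} {g : ℝ → ℝ}
    (hb : IsFormBounded b δ g)
    (hbc : ContinuousOn (fun p : ℝ × EuclideanSpace ℝ (Fin d) => b p.1 p.2) (Ici 0 ×ˢ univ)) :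
    ∀ᵐ t ∂volume.restrict (Ici (0 : ℝ)), SliceFormBound (fun x => ‖b t x‖) δ (g t) := by
  have hg' : LocallyIntegrable ((Ici (0 : ℝ)).indicator g) := by
    refine locallyIntegrable_iff.2 fun k hk => ?_
    rw [IntegrableOn, integrable_indicator_iff measurableSet_Ici, IntegrableOn,
      Measure.restrict_restrict measurableSet_Ici, ← IntegrableOn]
    exact hb.g_locallyIntegrable.integrableOn_compact_subset inter_subset_left
      (hk.inter_left isClosed_Ici)
  have hae := LocallyIntegrable.ae_hasDerivAt_integral hg'
  have hne : ∀ᵐ t : ℝ, t ≠ 0 := by simp [ae_iff]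
  rw [ae_restrict_iff' measurableSet_Ici]
  filter_upwards [hae, hne] with t ht ht0 htm
  have htpos : 0 < t := lt_of_le_of_ne htm (Ne.symm ht0)
  have hbt : ∀ t ≥ 0, Continuous (b t) := fun t ht => by
    exact hbc.comp_continuous (by fun_prop : Continuous fun x => (t, x)) fun x => ⟨ht, mem_univ _⟩
  refine sliceFormBound_of_smooth (hbt t htm).norm fun ψ hψ hψc => ?_
  set D := ∫ x, ‖fderiv ℝ ψ x‖ ^ 2
  set m := ∫ x, ψ x ^ 2
  set B : ℝ → ℝ := fun t => ∫ x, ‖b t x‖ ^ 2 * ψ x ^ 2 with hB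
  have hBc : ContinuousOn B (Ici 0) := by
    refine continuousOn_integral_of_compact_support hψc.isCompact ?_ fun t x _ hx => ?_
    · exact (hbc.norm.pow 2).mul ((hψ.continuous.comp continuous_snd).pow 2).continuousOn
    · rw [image_eq_zero_of_notMem_tsupport hx]; simp
  have hgl := hb.g_locallyIntegrable
  have hBl : LocallyIntegrableOn B (Ici 0) := hBc.locallyIntegrableOn measurableSet_Ici
  have hDl : LocallyIntegrableOn (fun _ : ℝ => D) (Ici 0) :=
    continuousOn_const.locallyIntegrableOn measurableSet_Ici
  -- the form bound integrated over `[y, z]`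
  have key : ∀ y z : ℝ, 0 ≤ y → y < z →
      ∫ t in Icc y z, B t ≤ δ * (∫ t in Icc y z, D) + (∫ t in Icc y z, g t) * m := by
    intro y z hy hyz
    obtain ⟨χ, hχ, hχc, hχt⟩ := exists_smooth_tendsto_indicator hy hyz
    refine le_of_tendsto_of_tendsto (hχt B hBl) (((hχt _ hDl).const_mul δ).add
      ((hχt g hgl).mul_const m)) (Filter.Eventually.of_forall fun n => ?_)
    have := hb.form_bound (fun t x => χ n t * ψ x)
      (((hχ n).comp contDiff_fst).mul (hψ.comp contDiff_snd)) (by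
        refine HasCompactSupport.intro ((hχc n).isCompact.prod hψc.isCompact) fun p hp => ?_
        rw [mem_prod, not_and_or] at hp
        rcases hp with hp | hp
        · simp [image_eq_zero_of_notMem_tsupport hp]
        · simp [image_eq_zero_of_notMem_tsupport hp])
    have e1 : ∀ t, ∫ x, ‖(χ n t * ψ x) • b t x‖ ^ 2 = χ n t ^ 2 * B t := fun t => by
      rw [hB, ← integral_const_mul]
      congr 1; ext x
      rw [norm_smul, mul_pow, norm_mul, mul_pow, Real.norm_eq_abs, Real.norm_eq_abs, sq_abs, sq_abs]
      ring
    have e2 : ∀ t, ∫ x, ‖gradient (fun x => χ n t * ψ x) x‖ ^ 2 = χ n t ^ 2 * D := fun t => by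
      rw [← integral_const_mul]
      congr 1; ext x
      rw [norm_gradient, fderiv_const_mul (hψ.differentiable (by simp) x), norm_smul, mul_pow,
        Real.norm_eq_abs, sq_abs]
    have e3 : ∀ t, g t * ∫ x, (χ n t * ψ x) ^ 2 = χ n t ^ 2 * g t * m := fun t => by
      simp only [mul_pow]
      rw [integral_const_mul]; ring
    simp only [e1, e2, e3] at this
    rw [integral_mul_const, integral_mul_const] at this
    simpa only [integral_mul_const] using this
  -- the difference of the two sides over `[0, y]` is monotone in `y`, so its derivative at `t`,
  -- which exists when `t` is a Lebesgue point of `g`, is non-negative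
  set H : ℝ → ℝ := fun y => δ * D * y + (∫ τ in (0 : ℝ)..y, (Ici (0 : ℝ)).indicator g τ) * m
    - ∫ τ in (0 : ℝ)..y, B (max τ 0) with hH
  have hBc' : Continuous fun τ => B (max τ 0) :=
    hBc.comp_continuous (by fun_prop) fun τ => mem_Ici.2 (le_max_right _ _)
  have hHd : HasDerivAt H (δ * D + g t * m - B t) t := by
    have h1 : HasDerivAt (fun y => δ * D * y) (δ * D) t := by
      simpa using (hasDerivAt_id t).const_mul (δ * D)
    have h2 := (ht 0).mul_const m
    rw [indicator_of_mem (show t ∈ Ici (0 : ℝ) from htm)] at h2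
    have h3 := (hBc'.integral_hasStrictDerivAt 0 t).hasDerivAt
    rw [max_eq_left htpos.le] at h3
    exact (h1.add h2).sub h3
  have hgi : ∀ y z, IntervalIntegrable ((Ici (0 : ℝ)).indicator g) volume y z := fun y z =>
    (hg'.integrableOn_isCompact isCompact_uIcc).intervalIntegrable
  have hmono : MonotoneOn H (Ici 0) := by
    intro y hy z hz hyz
    rcases hyz.eq_or_lt with rfl | hlt
    · exact le_rfl
    have hk := key y z hy hlt
    have i1 : (∫ τ in (0 : ℝ)..z, (Ici (0 : ℝ)).indicator g τ)
        = (∫ τ in (0 : ℝ)..y, (Ici (0 : ℝ)).indicator g τ) + ∫ τ in Icc y z, g τ := by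
      rw [← intervalIntegral.integral_add_adjacent_intervals (hgi 0 y) (hgi y z),
        intervalIntegral.integral_of_le hyz, integral_Icc_eq_integral_Ioc]
      congr 1
      refine setIntegral_congr_fun measurableSet_Ioc fun τ hτ => ?_
      exact indicator_of_mem (show τ ∈ Ici (0 : ℝ) from le_trans hy hτ.1.le) _
    have i2 : (∫ τ in (0 : ℝ)..z, B (max τ 0))
        = (∫ τ in (0 : ℝ)..y, B (max τ 0)) + ∫ τ in Icc y z, B τ := by
      rw [← intervalIntegral.integral_add_adjacent_intervals (hBc'.intervalIntegrable _ _) (b := y)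
        (hBc'.intervalIntegrable _ _), intervalIntegral.integral_of_le hyz,
        integral_Icc_eq_integral_Ioc]
      congr 1
      refine setIntegral_congr_fun measurableSet_Ioc fun τ hτ => ?_
      simp only [max_eq_left (le_trans (show (0 : ℝ) ≤ y from hy) hτ.1.le)]
    have i3 : ∫ t in Icc y z, D = (z - y) * D := by
      simp [hyz]
    simp only [hH, i1, i2]
    rw [i3] at hk
    nlinarith
  have hnn : 0 ≤ δ * D + g t * m - B t := by
    have h1 : HasDerivWithinAt H (δ * D + g t * m - B t) (Ioi t) t := hHd.hasDerivWithinAt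
    have h2 := (hasDerivWithinAt_iff_tendsto_slope' (s := Ioi t) (by simp)).1 h1
    refine ge_of_tendsto h2 ?_
    filter_upwards [self_mem_nhdsWithin] with y hy
    have hty : t < y := hy
    rw [slope_def_field]
    exact div_nonneg (sub_nonneg.2 (hmono htpos.le (htpos.le.trans hty.le) hty.le))
      (sub_pos.2 hty).le
  linarith

/-! ### Powers of the norm, divergence and integration by parts -/

section Slices
variable {V : Type*} [NormedAddCommGroup V] [InnerProductSpace ℝ V]

lemma fderiv_eq_zero_of_notMem_tsupport {ζ : V → ℝ} {x : V} (hx : x ∉ tsupport ζ) :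
    fderiv ℝ ζ x = 0 := by
  by_contra h
  exact hx (support_fderiv_subset ℝ h)

lemma contDiff_norm_rpow_comp {E : Type*} [NormedAddCommGroup E] [InnerProductSpace ℝ E]
    {z : V → E} (hz : ContDiff ℝ 1 z) {p : ℝ} (hp : 1 < p) :
    ContDiff ℝ 1 fun x => ‖z x‖ ^ p :=
  (contDiff_norm_rpow hp).comp hz

variable {ι : Type*} [Fintype ι] (e : OrthonormalBasis ι ℝ V)

/-- The divergence of a vector field, computed in an orthonormal basis. -/
noncomputable def divergence (Φ : V → V) (x : V) : ℝ := ∑ i, inner ℝ (e i) (fderiv ℝ Φ x (e i))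

/-- The square of the Hilbert–Schmidt norm of an operator, computed in an orthonormal basis. -/
noncomputable def hsSq (A : V →L[ℝ] V) : ℝ := ∑ i, ‖A (e i)‖ ^ 2

lemma hsSq_nonneg (A : V →L[ℝ] V) : 0 ≤ hsSq e A := Finset.sum_nonneg fun _ _ => by positivity

lemma sq_sum_inner_le (A : V →L[ℝ] V) :
    (∑ i, inner ℝ (e i) (A (e i))) ^ 2 ≤ Fintype.card ι * hsSq e A := by
  refine (sq_sum_le_card_mul_sum_sq (s := Finset.univ)).trans ?_
  rw [Finset.card_univ, hsSq]
  refine mul_le_mul_of_nonneg_left (Finset.sum_le_sum fun i _ => ?_) (Nat.cast_nonneg _)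
  have := abs_real_inner_le_norm (e i) (A (e i))
  rw [e.norm_eq_one, one_mul] at this
  exact sq_le_sq' (abs_le.1 this).1 (abs_le.1 this).2

lemma norm_apply_sq_le (A : V →L[ℝ] V) (w : V) : ‖A w‖ ^ 2 ≤ hsSq e A * ‖w‖ ^ 2 := by
  have h1 : A w = ∑ i, inner ℝ (e i) w • A (e i) := by
    conv_lhs => rw [← e.sum_repr' w]
    simp
  have h2 : ‖A w‖ ≤ ∑ i, |inner ℝ (e i) w| * ‖A (e i)‖ := by
    rw [h1]
    refine (norm_sum_le _ _).trans_eq ?_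
    simp [norm_smul]
  calc ‖A w‖ ^ 2 ≤ (∑ i, |inner ℝ (e i) w| * ‖A (e i)‖) ^ 2 := by gcongr
    _ ≤ (∑ i, |inner ℝ (e i) w| ^ 2) * ∑ i, ‖A (e i)‖ ^ 2 := Finset.sum_mul_sq_le_sq_mul_sq _ _ _
    _ = _ := by
      rw [mul_comm, hsSq]
      congr 1
      simpa using e.sum_sq_norm_inner_right w

lemma divergence_eq_zero_of_notMem_tsupport {Φ : V → V} {x : V} (hx : x ∉ tsupport Φ) :
    divergence e Φ x = 0 := by
  have : fderiv ℝ Φ x = 0 := by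
    by_contra h
    exact hx (support_fderiv_subset ℝ h)
  simp [divergence, this]

lemma fderiv_inner_const_left {Φ : V → V} (hΦ : ContDiff ℝ 1 Φ) (c x y : V) :
    fderiv ℝ (fun x => inner ℝ c (Φ x)) x y = inner ℝ c (fderiv ℝ Φ x y) := by
  have h : HasFDerivAt (fun x => inner ℝ c (Φ x)) ((innerSL ℝ c).comp (fderiv ℝ Φ x)) x :=
    (innerSL ℝ c).hasFDerivAt.comp x (hΦ.differentiable (by norm_num) x).hasFDerivAt
  rw [h.fderiv]; simp

variable [FiniteDimensional ℝ V]

lemma continuous_divergence {Φ : V → V} (hΦ : ContDiff ℝ 1 Φ) : Continuous (divergence e Φ) := by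
  have := hΦ.continuous_fderiv (by norm_num)
  unfold divergence
  fun_prop

variable [MeasurableSpace V] [BorelSpace V]

lemma integrable_of_forall_notMem_tsupport {f ζ : V → ℝ} (hf : Continuous f)
    (hζ : HasCompactSupport ζ) (h : ∀ x, x ∉ tsupport ζ → f x = 0) : Integrable f :=
  hf.integrable_of_hasCompactSupport (HasCompactSupport.intro hζ.isCompact fun x hx => h x hx)

/-- The form bound tested with `‖z‖^{q/2} ζ`. -/
lemma SliceFormBound.norm_rpow_mul {E : Type*} [NormedAddCommGroup E] [InnerProductSpace ℝ E]
    {B : V → ℝ} {δ g q ε : ℝ} (hB : SliceFormBound B δ g) (hδ : 0 < δ) (hq : 2 < q) (hε : 0 < ε)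
    {z : V → E} (hz : ContDiff ℝ 1 z) {ζ : V → ℝ} (hζ : ContDiff ℝ 1 ζ)
    (hζc : HasCompactSupport ζ) :
    ∫ x, B x ^ 2 * ‖z x‖ ^ q * ζ x ^ 2 ≤
      δ * (1 + ε) * (∫ x, ‖fderiv ℝ (fun y => ‖z y‖ ^ (q / 2)) x‖ ^ 2 * ζ x ^ 2)
      + δ * (1 + ε⁻¹) * (∫ x, ‖z x‖ ^ q * ‖fderiv ℝ ζ x‖ ^ 2)
      + g * ∫ x, ‖z x‖ ^ q * ζ x ^ 2 := by
  have hP := contDiff_norm_rpow_comp hz (p := q / 2) (by linarith)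
  set P : V → ℝ := fun x => ‖z x‖ ^ (q / 2) with hPdef
  have hP2 : ∀ x, P x ^ 2 = ‖z x‖ ^ q := fun x => by
    rw [hPdef]; simp only
    rw [← Real.rpow_mul_natCast (norm_nonneg _)]; norm_num
  have h := hB (fun x => P x * ζ x) (hP.mul hζ) hζc.mul_left
  have hζd := hζ.continuous_fderiv (by norm_num)
  have hPd := hP.continuous_fderiv (by norm_num)
  have i1 : Integrable fun x => ‖fderiv ℝ P x‖ ^ 2 * ζ x ^ 2 :=
    integrable_of_forall_notMem_tsupport (hζ := hζc) ((hPd.norm.pow 2).mul (hζ.continuous.pow 2))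
      fun x hx => by simp [image_eq_zero_of_notMem_tsupport hx]
  have i2 : Integrable fun x => P x ^ 2 * ‖fderiv ℝ ζ x‖ ^ 2 :=
    integrable_of_forall_notMem_tsupport (hζ := hζc) ((hP.continuous.pow 2).mul (hζd.norm.pow 2))
      fun x hx => by simp [fderiv_eq_zero_of_notMem_tsupport hx]
  have i3 : Integrable fun x => ‖fderiv ℝ (fun x => P x * ζ x) x‖ ^ 2 :=
    integrable_of_forall_notMem_tsupport (hζ := hζc)
      (((hP.mul hζ).continuous_fderiv (by norm_num)).norm.pow 2)
      fun x hx => by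
        have : x ∉ tsupport fun x => P x * ζ x := fun h =>
          hx (closure_mono (Function.support_mul_subset_right _ _) h)
        simp [fderiv_eq_zero_of_notMem_tsupport this]
  have h1 : ∫ x, ‖fderiv ℝ (fun x => P x * ζ x) x‖ ^ 2 ≤
      (1 + ε) * (∫ x, ‖fderiv ℝ P x‖ ^ 2 * ζ x ^ 2)
        + (1 + ε⁻¹) * ∫ x, P x ^ 2 * ‖fderiv ℝ ζ x‖ ^ 2 := by
    rw [← integral_const_mul, ← integral_const_mul, ← integral_add (i1.const_mul _)
      (i2.const_mul _)]
    refine integral_mono i3 ((i1.const_mul _).add (i2.const_mul _)) fun x => ?_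
    have e : fderiv ℝ (fun x => P x * ζ x) x = P x • fderiv ℝ ζ x + ζ x • fderiv ℝ P x :=
      fderiv_fun_mul (hP.differentiable (by norm_num) x) (hζ.differentiable (by norm_num) x)
    have e2 : ‖fderiv ℝ (fun x => P x * ζ x) x‖
        ≤ |P x| * ‖fderiv ℝ ζ x‖ + |ζ x| * ‖fderiv ℝ P x‖ := by
      rw [e]
      refine (norm_add_le _ _).trans_eq ?_
      rw [norm_smul, norm_smul]; rfl
    have e3 := pow_le_pow_left₀ (norm_nonneg _) e2 2
    refine e3.trans ?_
    rw [← sq_abs (ζ x), ← sq_abs (P x)]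
    set α := |P x| * ‖fderiv ℝ ζ x‖
    set γ := |ζ x| * ‖fderiv ℝ P x‖
    have e4 : 2 * α * γ ≤ ε * γ ^ 2 + ε⁻¹ * α ^ 2 := by
      have : ε * γ ^ 2 + ε⁻¹ * α ^ 2 - 2 * α * γ = ε⁻¹ * (ε * γ - α) ^ 2 := by
        field_simp; ring
      have h0 : 0 ≤ ε⁻¹ * (ε * γ - α) ^ 2 := by positivity
      linarith
    have e5 : (1 + ε) * (‖fderiv ℝ P x‖ ^ 2 * |ζ x| ^ 2)
        + (1 + ε⁻¹) * (|P x| ^ 2 * ‖fderiv ℝ ζ x‖ ^ 2)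
      = (1 + ε) * γ ^ 2 + (1 + ε⁻¹) * α ^ 2 := by simp only [α, γ]; ring
    simp only [e5]
    nlinarith
  have e0' : ∀ x, (P x * ζ x) ^ 2 = ‖z x‖ ^ q * ζ x ^ 2 := fun x => by
    rw [mul_pow, hP2]
  simp only [e0'] at h
  simp only [hP2] at h1
  have h2 := mul_le_mul_of_nonneg_left h1 hδ.le
  simp only [mul_assoc] at h h2 ⊢
  linarith

lemma integral_mul_divergence {f : V → ℝ} {Φ : V → V} (hf : ContDiff ℝ 1 f)
    (hΦ : ContDiff ℝ 1 Φ) (hΦc : HasCompactSupport Φ) :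
    ∫ x, f x * divergence e Φ x = -∫ x, fderiv ℝ f x (Φ x) := by
  have hdf := hf.continuous_fderiv (by norm_num)
  have hdΦ := hΦ.continuous_fderiv (by norm_num)
  have hf0 := hf.continuous
  have hΦ0 := hΦ.continuous
  have hΦi : ∀ i, ContDiff ℝ 1 fun x => inner ℝ (e i) (Φ x) := fun i => contDiff_const.inner ℝ hΦ
  have hΦic : ∀ i, HasCompactSupport fun x => inner ℝ (e i) (Φ x) := fun i =>
    hΦc.comp_left (g := fun y => inner ℝ (e i) y) (by simp)
  have h1 : ∀ i, ∫ x, f x * inner ℝ (e i) (fderiv ℝ Φ x (e i))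
      = -∫ x, fderiv ℝ f x (e i) * inner ℝ (e i) (Φ x) := fun i => by
    rw [← integral_mul_fderiv_of_hasCompactSupport hf (hΦi i) (hΦic i) (e i)]
    simp only [fderiv_inner_const_left hΦ]
  have h2 : ∀ x, fderiv ℝ f x (Φ x) = ∑ i, fderiv ℝ f x (e i) * inner ℝ (e i) (Φ x) := fun x => by
    conv_lhs => rw [← e.sum_repr' (Φ x)]
    simp [mul_comm]
  have i1 : ∀ i, Integrable fun x => f x * inner ℝ (e i) (fderiv ℝ Φ x (e i)) := fun i => by
    refine Continuous.integrable_of_hasCompactSupport (by fun_prop)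
      (HasCompactSupport.intro hΦc.isCompact fun x hx => ?_)
    have : fderiv ℝ Φ x = 0 := by
      by_contra h
      exact hx (support_fderiv_subset ℝ h)
    simp [this]
  have i2 : ∀ i, Integrable fun x => fderiv ℝ f x (e i) * inner ℝ (e i) (Φ x) := fun i =>
    Continuous.integrable_of_hasCompactSupport (by fun_prop) (hΦic i).mul_left
  simp only [divergence, Finset.mul_sum, h2]
  rw [integral_finsetSum _ fun i _ => i1 i, integral_finsetSum _ fun i _ => i2 i,
    ← Finset.sum_neg_distrib]
  exact Finset.sum_congr rfl fun i _ => h1 i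

/-- For a curl-free field `w` of class `C¹`, `∫ div w div Φ = ∫ Dw : DΦ`. -/
lemma integral_divergence_mul_divergence {w Φ : V → V} (hw : ContDiff ℝ 1 w)
    (hws : ∀ x y z, inner ℝ (fderiv ℝ w x y) z = inner ℝ y (fderiv ℝ w x z))
    (hΦ : ContDiff ℝ 1 Φ) (hΦc : HasCompactSupport Φ) :
    ∫ x, divergence e w x * divergence e Φ x
      = ∫ x, ∑ i, inner ℝ (fderiv ℝ w x (e i)) (fderiv ℝ Φ x (e i)) := by
  have hdw := hw.continuous_fderiv (by norm_num)
  have hdΦ := hΦ.continuous_fderiv (by norm_num)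
  have hc : ∀ {w : V → V}, ContDiff ℝ 1 w → ∀ i, ContDiff ℝ 1 fun x => inner ℝ (e i) (w x) :=
    fun hw i => contDiff_const.inner ℝ hw
  have hΦic : ∀ i, HasCompactSupport fun x => inner ℝ (e i) (Φ x) := fun i =>
    hΦc.comp_left (g := fun y => inner ℝ (e i) y) (by simp)
  have h1 : ∀ i j, ∫ x, inner ℝ (e i) (fderiv ℝ w x (e i)) * inner ℝ (e j) (fderiv ℝ Φ x (e j))
      = ∫ x, inner ℝ (e i) (fderiv ℝ w x (e j)) * inner ℝ (e j) (fderiv ℝ Φ x (e i)) := by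
    intro i j
    have := integral_fderiv_mul_fderiv_comm (hc hw i) (hc hΦ j) (hΦic j) (e i) (e j)
    simpa only [fderiv_inner_const_left hw, fderiv_inner_const_left hΦ] using this
  have h0 : ∀ x, x ∉ tsupport Φ → fderiv ℝ Φ x = 0 := fun x hx => by
    by_contra h
    exact hx (support_fderiv_subset ℝ h)
  have i1 : ∀ i j k l, Integrable fun x =>
      inner ℝ (e i) (fderiv ℝ w x (e j)) * inner ℝ (e k) (fderiv ℝ Φ x (e l)) := fun i j k l =>
    Continuous.integrable_of_hasCompactSupport (by fun_prop)
      (HasCompactSupport.intro hΦc.isCompact fun x hx => by simp [h0 x hx])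
  have h2 : ∀ x, ∑ i, inner ℝ (fderiv ℝ w x (e i)) (fderiv ℝ Φ x (e i))
      = ∑ i, ∑ j, inner ℝ (e i) (fderiv ℝ w x (e j)) * inner ℝ (e j) (fderiv ℝ Φ x (e i)) := by
    intro x
    refine Finset.sum_congr rfl fun i _ => ?_
    rw [← e.sum_inner_mul_inner]
    refine Finset.sum_congr rfl fun j _ => ?_
    rw [hws]
  simp only [divergence, Finset.sum_mul_sum, h2]
  rw [integral_finsetSum _ fun i _ => integrable_finsetSum _ fun j _ => i1 i i j j,
    integral_finsetSum _ fun i _ => integrable_finsetSum _ fun j _ => i1 i j j i]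
  refine Finset.sum_congr rfl fun i _ => ?_
  rw [integral_finsetSum _ fun j _ => i1 i i j j, integral_finsetSum _ fun j _ => i1 i j j i]
  exact Finset.sum_congr rfl fun j _ => h1 i j

end Slices

/-! ### The power field -/

section PowerField
variable {V : Type*} [NormedAddCommGroup V] [InnerProductSpace ℝ V]

/-- The vector field `σ |w|^{q-2} w`, whose divergence is the test function for the gradient
estimate. -/
noncomputable def powerField (q : ℝ) (σ : V → ℝ) (w : V → V) (x : V) : V :=
  (‖w x‖ ^ (q - 2) * σ x) • w x

variable {q : ℝ} {σ : V → ℝ} {w : V → V}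

lemma contDiff_powerField (hq : 3 < q) (hσ : ContDiff ℝ 1 σ) (hw : ContDiff ℝ 1 w) :
    ContDiff ℝ 1 (powerField q σ w) :=
  ((contDiff_norm_rpow_comp hw (by linarith)).mul hσ).smul hw

lemma tsupport_powerField_subset : tsupport (powerField q σ w) ⊆ tsupport σ := by
  refine closure_mono fun x hx => ?_
  simp only [Function.mem_support, powerField] at hx ⊢
  contrapose! hx
  simp [hx]

lemma fderiv_powerField (hq : 3 < q) (hσ : ContDiff ℝ 1 σ) (hw : ContDiff ℝ 1 w) (x y : V) :
    fderiv ℝ (powerField q σ w) x y = (‖w x‖ ^ (q - 2) * σ x) • fderiv ℝ w x y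
      + ((q - 2) * ‖w x‖ ^ (q - 4) * inner ℝ (w x) (fderiv ℝ w x y) * σ x
        + ‖w x‖ ^ (q - 2) * fderiv ℝ σ x y) • w x := by
  have hwd := hw.differentiable (by norm_num)
  have h1 : HasFDerivAt (fun x => ‖w x‖ ^ (q - 2))
      ((((q - 2) * ‖w x‖ ^ (q - 2 - 2)) • innerSL ℝ (w x)).comp (fderiv ℝ w x)) x :=
    (hasFDerivAt_norm_rpow (w x) (p := q - 2) (by linarith)).comp x (hwd x).hasFDerivAt
  have h2 := (h1.mul (hσ.differentiable (by norm_num) x).hasFDerivAt).smul (hwd x).hasFDerivAt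
  have h3 : fderiv ℝ (powerField q σ w) x = _ := h2.fderiv
  rw [h3]
  have e : q - 2 - 2 = q - 4 := by ring
  simp only [e, add_apply, smul_apply,
    ContinuousLinearMap.smulRight_apply, ContinuousLinearMap.comp_apply, innerSL_apply_apply,
    smul_eq_mul]
  congr 2
  ring

variable {ι : Type*} [Fintype ι] (e : OrthonormalBasis ι ℝ V)

lemma divergence_powerField (hq : 3 < q) (hσ : ContDiff ℝ 1 σ) (hw : ContDiff ℝ 1 w)
    (hws : ∀ x y z, inner ℝ (fderiv ℝ w x y) z = inner ℝ y (fderiv ℝ w x z)) (x : V) :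
    divergence e (powerField q σ w) x = ‖w x‖ ^ (q - 2) * σ x * divergence e w x
      + (q - 2) * (‖w x‖ ^ (q - 4) * inner ℝ (w x) (fderiv ℝ w x (w x))) * σ x
      + ‖w x‖ ^ (q - 2) * fderiv ℝ σ x (w x) := by
  have h1 : ∑ i, inner ℝ (w x) (fderiv ℝ w x (e i)) * inner ℝ (e i) (w x)
      = inner ℝ (w x) (fderiv ℝ w x (w x)) := by
    rw [← hws x (w x) (w x), ← e.sum_inner_mul_inner]
    refine Finset.sum_congr rfl fun i _ => ?_
    rw [← hws x (w x) (e i)]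
  have h2 : ∑ i, fderiv ℝ σ x (e i) * inner ℝ (e i) (w x) = fderiv ℝ σ x (w x) := by
    conv_rhs => rw [← e.sum_repr' (w x)]
    simp [mul_comm]
  rw [← h1, ← h2]
  simp only [divergence, fderiv_powerField hq hσ hw, inner_add_right, inner_smul_right,
    Finset.mul_sum, Finset.sum_mul, ← Finset.sum_add_distrib]
  refine Finset.sum_congr rfl fun i _ => ?_
  ring

/-- The contraction `Dw : DΦ` of the derivatives of a curl-free field `w` and of its power field
`Φ`. -/
lemma contraction_powerField (hq : 3 < q) (hσ : ContDiff ℝ 1 σ) (hw : ContDiff ℝ 1 w)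
    (hws : ∀ x y z, inner ℝ (fderiv ℝ w x y) z = inner ℝ y (fderiv ℝ w x z)) (x : V) :
    ∑ i, inner ℝ (fderiv ℝ w x (e i)) (fderiv ℝ (powerField q σ w) x (e i))
      = ‖w x‖ ^ (q - 2) * σ x * hsSq e (fderiv ℝ w x)
      + (q - 2) * (‖w x‖ ^ (q - 4) * ‖fderiv ℝ w x (w x)‖ ^ 2) * σ x
      + ‖w x‖ ^ (q - 2) * fderiv ℝ σ x (fderiv ℝ w x (w x)) := by
  have h1 : ∑ i, inner ℝ (w x) (fderiv ℝ w x (e i)) * inner ℝ (fderiv ℝ w x (e i)) (w x)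
      = ‖fderiv ℝ w x (w x)‖ ^ 2 := by
    rw [← real_inner_self_eq_norm_sq, ← e.sum_inner_mul_inner]
    refine Finset.sum_congr rfl fun i _ => ?_
    rw [← hws x (w x) (e i), hws x (e i) (w x)]
  have h2 : ∑ i, fderiv ℝ σ x (e i) * inner ℝ (fderiv ℝ w x (e i)) (w x)
      = fderiv ℝ σ x (fderiv ℝ w x (w x)) := by
    conv_rhs => rw [← e.sum_repr' (fderiv ℝ w x (w x))]
    simp [mul_comm, hws]
  rw [← h1, ← h2, hsSq]
  simp only [fderiv_powerField hq hσ hw, inner_add_right, inner_smul_right,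
    Finset.mul_sum, Finset.sum_mul, ← Finset.sum_add_distrib]
  refine Finset.sum_congr rfl fun i _ => ?_
  rw [real_inner_self_eq_norm_sq]
  ring

lemma norm_fderiv_norm_rpow_comp_of_symm (hq : 2 < q) (hw : ContDiff ℝ 1 w)
    (hws : ∀ x y z, inner ℝ (fderiv ℝ w x y) z = inner ℝ y (fderiv ℝ w x z)) (x : V) :
    ‖fderiv ℝ (fun y => ‖w y‖ ^ (q / 2)) x‖
      = q / 2 * (‖w x‖ ^ (q / 2 - 2) * ‖fderiv ℝ w x (w x)‖) := by
  rw [(hw.differentiable (by norm_num)).fderiv_norm_rpow (by linarith)]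
  have : (innerSL ℝ (w x)).comp (fderiv ℝ w x) = innerSL ℝ (fderiv ℝ w x (w x)) := by
    ext y
    simp [hws x (w x) y]
  rw [this, norm_smul, innerSL_apply_norm, Real.norm_of_nonneg (by positivity), mul_assoc]

lemma rpow_half_sub_one_sq {W : ℝ} (hW : 0 ≤ W) : (W ^ (q / 2 - 1)) ^ 2 = W ^ (q - 2) := by
  rw [← Real.rpow_mul_natCast hW]; congr 1; push_cast; ring

lemma rpow_half_sub_two_sq {W : ℝ} (hW : 0 ≤ W) : (W ^ (q / 2 - 2)) ^ 2 = W ^ (q - 4) := by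
  rw [← Real.rpow_mul_natCast hW]; congr 1; push_cast; ring

lemma rpow_sub_two_mul_sq {W : ℝ} (hW : 0 ≤ W) (hq : 2 < q) : W ^ (q - 2) * W ^ 2 = W ^ q := by
  rw [← Real.rpow_natCast W 2, ← Real.rpow_add_of_nonneg hW (by linarith) (by norm_num)]
  congr 1; push_cast; ring

lemma rpow_sub_four_mul_inner_le (w z : V) :
    |‖w‖ ^ (q - 4) * inner ℝ w z| ≤ ‖w‖ ^ (q / 2 - 1) * (‖w‖ ^ (q / 2 - 2) * ‖z‖) := by
  rcases eq_or_ne w 0 with rfl | hw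
  · simp only [inner_zero_left, mul_zero, abs_zero]; positivity
  have hW : 0 < ‖w‖ := norm_pos_iff.2 hw
  rw [abs_mul, abs_of_nonneg (by positivity : 0 ≤ ‖w‖ ^ (q - 4))]
  calc ‖w‖ ^ (q - 4) * |inner ℝ w z| ≤ ‖w‖ ^ (q - 4) * (‖w‖ * ‖z‖) := by
        gcongr; exact abs_real_inner_le_norm w z
    _ = _ := by
      rw [← mul_assoc, ← mul_assoc, ← Real.rpow_add_one hW.ne', ← Real.rpow_add hW]
      congr 2; ring

lemma rpow_sub_two_mul_norm_le {A : V →L[ℝ] V} {a : ℝ} {w : V}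
    (h : ‖A w‖ ≤ a * ‖w‖) (ha : 0 ≤ a) :
    ‖w‖ ^ (q / 2 - 2) * ‖A w‖ ≤ ‖w‖ ^ (q / 2 - 1) * a := by
  rcases eq_or_ne w 0 with rfl | hw
  · simp only [map_zero, norm_zero, mul_zero]; positivity
  have hW : 0 < ‖w‖ := norm_pos_iff.2 hw
  calc ‖w‖ ^ (q / 2 - 2) * ‖A w‖ ≤ ‖w‖ ^ (q / 2 - 2) * (a * ‖w‖) := by gcongr
    _ = ‖w‖ ^ (q / 2 - 2) * ‖w‖ * a := by ring
    _ = _ := by rw [← Real.rpow_add_one hW.ne']; congr 2; ring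

lemma norm_apply_le_sqrt (A : V →L[ℝ] V) (w : V) : ‖A w‖ ≤ √(hsSq e A) * ‖w‖ := by
  refine le_of_sq_le_sq ?_ (by positivity)
  rw [mul_pow, Real.sq_sqrt (hsSq_nonneg e A)]
  exact norm_apply_sq_le e A w

lemma abs_divergence_le (w : V → V) (x : V) :
    |divergence e w x| ≤ √(Fintype.card ι) * √(hsSq e (fderiv ℝ w x)) := by
  rw [← Real.sqrt_mul (Nat.cast_nonneg _)]
  exact Real.abs_le_sqrt (sq_sum_inner_le e _)

lemma abs_divergence_powerField_le (hq : 3 < q) (hσ : ContDiff ℝ 1 σ) (hσ0 : ∀ x, 0 ≤ σ x)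
    (hw : ContDiff ℝ 1 w)
    (hws : ∀ x y z, inner ℝ (fderiv ℝ w x y) z = inner ℝ y (fderiv ℝ w x z)) (x : V) :
    |divergence e (powerField q σ w) x| ≤
      (‖w x‖ ^ (q / 2 - 1)) ^ 2 * σ x * (√(Fintype.card ι) * √(hsSq e (fderiv ℝ w x)))
      + (q - 2) * (‖w x‖ ^ (q / 2 - 1) * (‖w x‖ ^ (q / 2 - 2) * ‖fderiv ℝ w x (w x)‖)) * σ x
      + (‖w x‖ ^ (q / 2 - 1)) ^ 2 * (‖fderiv ℝ σ x‖ * ‖w x‖) := by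
  rw [divergence_powerField e hq hσ hw hws, rpow_half_sub_one_sq (norm_nonneg _)]
  have hp : 0 ≤ ‖w x‖ ^ (q - 2) := by positivity
  refine (abs_add_le _ _).trans (add_le_add ((abs_add_le _ _).trans (add_le_add ?_ ?_)) ?_)
  · rw [abs_mul, abs_of_nonneg (mul_nonneg hp (hσ0 x))]
    exact mul_le_mul_of_nonneg_left (abs_divergence_le e w x) (mul_nonneg hp (hσ0 x))
  · rw [abs_mul, abs_mul, abs_of_nonneg (hσ0 x), abs_of_pos (by linarith : 0 < q - 2)]
    exact mul_le_mul_of_nonneg_right (mul_le_mul_of_nonneg_left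
      (rpow_sub_four_mul_inner_le _ _) (by linarith)) (hσ0 x)
  · rw [abs_mul, abs_of_nonneg hp]
    exact mul_le_mul_of_nonneg_left ((fderiv ℝ σ x).le_opNorm _) hp

/-- The contraction `Dw : DΦ` bounds the coercive terms up to one with a derivative of `σ`. -/
lemma le_contraction_powerField (hq : 3 < q) (hσ : ContDiff ℝ 1 σ) (hw : ContDiff ℝ 1 w)
    (hws : ∀ x y z, inner ℝ (fderiv ℝ w x y) z = inner ℝ y (fderiv ℝ w x z)) (x : V) :
    (‖w x‖ ^ (q / 2 - 1)) ^ 2 * σ x * hsSq e (fderiv ℝ w x)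
      + (q - 2) * (‖w x‖ ^ (q / 2 - 2) * ‖fderiv ℝ w x (w x)‖) ^ 2 * σ x
      - (‖w x‖ ^ (q / 2 - 1)) ^ 2 * (‖fderiv ℝ σ x‖ * (√(hsSq e (fderiv ℝ w x)) * ‖w x‖))
    ≤ ∑ i, inner ℝ (fderiv ℝ w x (e i)) (fderiv ℝ (powerField q σ w) x (e i)) := by
  rw [contraction_powerField e hq hσ hw hws, rpow_half_sub_one_sq (norm_nonneg _), mul_pow,
    rpow_half_sub_two_sq (norm_nonneg _), sub_eq_add_neg]
  have hp : 0 ≤ ‖w x‖ ^ (q - 2) := by positivity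
  refine add_le_add le_rfl ?_
  rw [← mul_neg]
  refine mul_le_mul_of_nonneg_left ?_ hp
  have h1 := (fderiv ℝ σ x).le_opNorm (fderiv ℝ w x (w x))
  have h2 := norm_apply_le_sqrt e (fderiv ℝ w x) (w x)
  have h3 := mul_le_mul_of_nonneg_left h2 (norm_nonneg (fderiv ℝ σ x))
  have h4 := neg_abs_le (fderiv ℝ σ x (fderiv ℝ w x (w x)))
  rw [← Real.norm_eq_abs] at h4
  linarith

end PowerField

/-! ### The energy estimates on a time slice -/

/-- The quadratic form behind the gradient estimate. For `m > 1` the coefficients of `X²` and `Z²`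
stay below those of the coercive terms `X² + m Z²`. -/
lemma quadratic_bound {m D X Z N U H : ℝ} (hm : 0 ≤ m) :
    (U + H) * (D * X + m * Z + 2 * N) + 2 * X * N ≤ 5 / 8 * X ^ 2 + (m / 4 + 1 / 40) * Z ^ 2
      + (D ^ 2 / 2 + m + 1 / 20) * U ^ 2 + 37 * N ^ 2 + (4 * D ^ 2 + 10 * m ^ 2 + 1) * H ^ 2 := by
  have h1 : 0 ≤ (X - D * U) ^ 2 := sq_nonneg _
  have h2 : 0 ≤ m * (Z / 2 - U) ^ 2 := by positivity
  have h3 : 0 ≤ (U - 20 * N) ^ 2 := sq_nonneg _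
  have h4 : 0 ≤ (X / 4 - 2 * D * H) ^ 2 := sq_nonneg _
  have h5 : 0 ≤ (Z - 20 * m * H) ^ 2 := sq_nonneg _
  have h6 : 0 ≤ (H - N) ^ 2 := sq_nonneg _
  have h7 : 0 ≤ (X / 4 - 4 * N) ^ 2 := sq_nonneg _
  linarith

section Slices
variable {V : Type*} [NormedAddCommGroup V] [InnerProductSpace ℝ V] [FiniteDimensional ℝ V]
  [MeasurableSpace V] [BorelSpace V] {ι : Type*} [Fintype ι] (e : OrthonormalBasis ι ℝ V)
  {q : ℝ}

/-- If `δ q² < 1`, the form bound tested with `‖z‖^{q/2} ζ` has the constant `1 / q²` in front of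
the main term. -/
lemma SliceFormBound.norm_rpow_mul_of_lt {E : Type*} [NormedAddCommGroup E]
    [InnerProductSpace ℝ E] {δ : ℝ} (hδ : 0 < δ) (hq : 2 < q) (hδq : δ * q ^ 2 < 1) :
    ∃ C : ℝ, 0 ≤ C ∧ ∀ {B : V → ℝ} {g : ℝ}, SliceFormBound B δ g →
      ∀ {z : V → E}, ContDiff ℝ 1 z → ∀ {ζ : V → ℝ}, ContDiff ℝ 1 ζ → HasCompactSupport ζ →
      ∫ x, B x ^ 2 * ‖z x‖ ^ q * ζ x ^ 2 ≤
        1 / q ^ 2 * (∫ x, ‖fderiv ℝ (fun y => ‖z y‖ ^ (q / 2)) x‖ ^ 2 * ζ x ^ 2)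
        + C * (∫ x, ‖z x‖ ^ q * ‖fderiv ℝ ζ x‖ ^ 2)
        + g * ∫ x, ‖z x‖ ^ q * ζ x ^ 2 := by
  have hε : 0 < 1 / (δ * q ^ 2) - 1 := by
    rw [sub_pos, lt_div_iff₀ (by positivity)]; linarith
  refine ⟨δ * (1 + (1 / (δ * q ^ 2) - 1)⁻¹), by positivity, fun hB z hz ζ hζ hζc => ?_⟩
  have := hB.norm_rpow_mul hδ hq hε hz hζ hζc
  have e1 : δ * (1 + (1 / (δ * q ^ 2) - 1)) = 1 / q ^ 2 := by field_simp; ring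
  rwa [e1] at this

set_option maxHeartbeats 600000 in
/-- The energy estimate for the gradient `w` on a time slice: the equation is tested with the
divergence of `ζ² |w|^{q-2} w`. The drift is absorbed since `δ q² < 1` and `q > d`. -/
lemma exists_gradient_slice_bound {δ β : ℝ} (hd : 3 ≤ Fintype.card ι) (hq : Fintype.card ι < q)
    (hδ : 0 < δ) (hδq : δ * q ^ 2 < 1) (hβ : 0 < β) :
    ∃ C : ℝ, 0 ≤ C ∧ ∀ {w : V → V}, ContDiff ℝ 1 w →
      (∀ x y z, inner ℝ (fderiv ℝ w x y) z = inner ℝ y (fderiv ℝ w x z)) →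
      ∀ {ζ : V → ℝ}, ContDiff ℝ 1 ζ → HasCompactSupport ζ → (∀ x, 0 ≤ ζ x) →
      ∀ {b : V → V}, Continuous b → ∀ {f h : V → ℝ}, Continuous f → Continuous h →
      ∀ {gb gf : ℝ}, 0 ≤ gb → 0 ≤ gf → SliceFormBound (fun x => ‖b x‖) δ gb →
      SliceFormBound f β gf →
      -∫ x, (divergence e w x - inner ℝ (b x) (w x) + f x * h x)
          * divergence e (powerField q (fun x => ζ x ^ 2) w) x
        ≤ -(1 / (8 * q ^ 2)) * ((∫ x, ‖w x‖ ^ (q - 2) * hsSq e (fderiv ℝ w x) * ζ x ^ 2)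
            + ∫ x, ‖fderiv ℝ (fun y => ‖w y‖ ^ (q / 2)) x‖ ^ 2 * ζ x ^ 2)
          + C * ((∫ x, ‖w x‖ ^ q * ‖fderiv ℝ ζ x‖ ^ 2)
            + (gb + gf) * (∫ x, ‖w x‖ ^ q * ζ x ^ 2)
            + ∫ x, f x ^ 2 * |h x| ^ q * ζ x ^ 2) := by
  have hd' : (3 : ℝ) ≤ Fintype.card ι := by exact_mod_cast hd
  have hq3 : 3 < q := by linarith
  obtain ⟨C1, hC1, hform⟩ := SliceFormBound.norm_rpow_mul_of_lt (V := V) (E := V) hδ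
    (by linarith : 2 < q) hδq
  set m : ℝ := q - 2 with hm
  set D : ℝ := √(Fintype.card ι) with hD
  have hD2 : D ^ 2 = Fintype.card ι := Real.sq_sqrt (Nat.cast_nonneg _)
  set cU : ℝ := D ^ 2 / 2 + m + 1 / 20 with hcU
  set cH : ℝ := 4 * D ^ 2 + 10 * m ^ 2 + 1 with hcH
  have hm0 : 0 < m := by linarith
  have hcU0 : 0 < cU := by positivity
  have hcH0 : 0 < cH := by positivity
  -- this choice bounds the contribution of `f² |w|^q` by `1 / 32` of the coercive term
  set ε : ℝ := 1 / (16 * cH * β * q ^ 2) with hε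
  have hε0 : 0 < ε := by positivity
  obtain ⟨Cy, hCy, hyoung⟩ := exists_rpow_mul_rpow_le (α := 2) (q := q) two_pos (by linarith) hε0
  refine ⟨cU * C1 + 37 + cH * ε * (2 * β) + cU + cH * ε + cH * Cy, by positivity, ?_⟩
  intro w hw hws ζ hζ hζc hζ0 b hb f h hf hh gb gf hgb hgf hbB hfB
  have hσ : ContDiff ℝ 1 fun x => ζ x ^ 2 := hζ.pow 2
  have hσd : ∀ x, ‖fderiv ℝ (fun x => ζ x ^ 2) x‖ = 2 * ζ x * ‖fderiv ℝ ζ x‖ := fun x => by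
    rw [fderiv_fun_pow 2 (hζ.differentiable (by norm_num) x), norm_smul,
      Real.norm_of_nonneg (by have := hζ0 x; positivity)]
    simp
  have hΦ := contDiff_powerField hq3 hσ hw
  have hdw := hw.continuous_fderiv (by norm_num)
  have hζd := hζ.continuous_fderiv (by norm_num)
  have hP := contDiff_norm_rpow_comp hw (p := q / 2) (by linarith)
  have hPd := hP.continuous_fderiv (by norm_num)
  have hw0 := hw.continuous
  have hz0 : ∀ x, x ∉ tsupport ζ → ζ x = 0 := fun x hx => image_eq_zero_of_notMem_tsupport hx
  have hz1 : ∀ x, x ∉ tsupport ζ → fderiv ℝ ζ x = 0 := fun x hx =>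
    fderiv_eq_zero_of_notMem_tsupport hx
  have hsupp : tsupport (fun x => ζ x ^ 2) ⊆ tsupport ζ := closure_mono fun x hx => by
    simpa using hx
  have hΦz : ∀ x, x ∉ tsupport ζ → x ∉ tsupport (powerField q (fun x => ζ x ^ 2) w) :=
    fun x hx hx' => hx (hsupp (tsupport_powerField_subset hx'))
  have hΦc : HasCompactSupport (powerField q (fun x => ζ x ^ 2) w) :=
    HasCompactSupport.intro hζc.isCompact fun x hx =>
      image_eq_zero_of_notMem_tsupport (hΦz x hx)
  have hΦ0 : ∀ x, x ∉ tsupport ζ → divergence e (powerField q (fun x => ζ x ^ 2) w) x = 0 :=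
    fun x hx => divergence_eq_zero_of_notMem_tsupport e (hΦz x hx)
  have hΦd0 : ∀ x, x ∉ tsupport ζ → fderiv ℝ (powerField q (fun x => ζ x ^ 2) w) x = 0 :=
    fun x hx => by
      by_contra h
      exact hΦz x hx (support_fderiv_subset ℝ h)
  have hdivw := continuous_divergence e hw
  have hdivΦ := continuous_divergence e hΦ
  have hdΦ := hΦ.continuous_fderiv (by norm_num)
  have hcq : Continuous fun x => ‖w x‖ ^ q := hw0.norm.rpow_const fun x => Or.inr (by linarith)
  have hcq2 : Continuous fun x => ‖w x‖ ^ (q - 2) :=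
    hw0.norm.rpow_const fun x => Or.inr (by linarith)
  have hch : Continuous fun x => |h x| ^ q := hh.abs.rpow_const fun x => Or.inr (by linarith)
  have hhs : Continuous fun x => hsSq e (fderiv ℝ w x) := by unfold hsSq; fun_prop
  have iI : Integrable fun x => ‖w x‖ ^ (q - 2) * hsSq e (fderiv ℝ w x) * ζ x ^ 2 :=
    integrable_of_forall_notMem_tsupport ((hcq2.mul hhs).mul (hζ.continuous.pow 2)) hζc
      fun x hx => by simp [hz0 x hx]
  have iJ : Integrable fun x => ‖fderiv ℝ (fun y => ‖w y‖ ^ (q / 2)) x‖ ^ 2 * ζ x ^ 2 :=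
    integrable_of_forall_notMem_tsupport ((hPd.norm.pow 2).mul (hζ.continuous.pow 2)) hζc
      fun x hx => by simp [hz0 x hx]
  have iN : Integrable fun x => ‖w x‖ ^ q * ‖fderiv ℝ ζ x‖ ^ 2 :=
    integrable_of_forall_notMem_tsupport (hcq.mul (hζd.norm.pow 2)) hζc
      fun x hx => by simp [hz1 x hx]
  have iW : Integrable fun x => ‖w x‖ ^ q * ζ x ^ 2 :=
    integrable_of_forall_notMem_tsupport (hcq.mul (hζ.continuous.pow 2)) hζc
      fun x hx => by simp [hz0 x hx]
  have iU : Integrable fun x => ‖b x‖ ^ 2 * ‖w x‖ ^ q * ζ x ^ 2 :=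
    integrable_of_forall_notMem_tsupport (((hb.norm.pow 2).mul hcq).mul (hζ.continuous.pow 2)) hζc
      fun x hx => by simp [hz0 x hx]
  have iF : Integrable fun x => f x ^ 2 * ‖w x‖ ^ q * ζ x ^ 2 :=
    integrable_of_forall_notMem_tsupport (((hf.pow 2).mul hcq).mul (hζ.continuous.pow 2)) hζc
      fun x hx => by simp [hz0 x hx]
  have iH : Integrable fun x => f x ^ 2 * |h x| ^ q * ζ x ^ 2 :=
    integrable_of_forall_notMem_tsupport (((hf.pow 2).mul hch).mul (hζ.continuous.pow 2)) hζc
      fun x hx => by simp [hz0 x hx]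
  have i1 : Integrable fun x => divergence e w x
      * divergence e (powerField q (fun x => ζ x ^ 2) w) x :=
    integrable_of_forall_notMem_tsupport (hdivw.mul hdivΦ) hζc fun x hx => by simp [hΦ0 x hx]
  have i2 : Integrable fun x => (f x * h x - inner ℝ (b x) (w x))
      * divergence e (powerField q (fun x => ζ x ^ 2) w) x :=
    integrable_of_forall_notMem_tsupport (((hf.mul hh).sub (hb.inner hw0)).mul hdivΦ) hζc
      fun x hx => by simp [hΦ0 x hx]
  have i3 : Integrable fun x => ∑ i, inner ℝ (fderiv ℝ w x (e i))
      (fderiv ℝ (powerField q (fun x => ζ x ^ 2) w) x (e i)) :=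
    integrable_of_forall_notMem_tsupport (by fun_prop) hζc fun x hx => by simp [hΦd0 x hx]
  have hsplit : ∫ x, (divergence e w x - inner ℝ (b x) (w x) + f x * h x)
        * divergence e (powerField q (fun x => ζ x ^ 2) w) x
      = ∫ x, ((∑ i, inner ℝ (fderiv ℝ w x (e i))
          (fderiv ℝ (powerField q (fun x => ζ x ^ 2) w) x (e i)))
        + (f x * h x - inner ℝ (b x) (w x))
          * divergence e (powerField q (fun x => ζ x ^ 2) w) x) := by
    rw [integral_add i3 i2, ← integral_divergence_mul_divergence e hw hws hΦ hΦc,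
      ← integral_add i1 i2]
    congr 1; ext x; ring
  -- pointwise coercivity: `X`, `Z`, `N`, `U`, `H` in `quadratic_bound` are the square roots of the
  -- densities of the second derivatives, of `|∇|w|^{q/2}|²` (up to a factor), of the cut-off error,
  -- of the drift and of the source
  have hpt : ∀ x, 3 / 8 * (‖w x‖ ^ (q - 2) * hsSq e (fderiv ℝ w x) * ζ x ^ 2)
      + (m - (m / 4 + 1 / 40)) * (4 / q ^ 2 *
          (‖fderiv ℝ (fun y => ‖w y‖ ^ (q / 2)) x‖ ^ 2 * ζ x ^ 2))
      - cU * (‖b x‖ ^ 2 * ‖w x‖ ^ q * ζ x ^ 2) - 37 * (‖w x‖ ^ q * ‖fderiv ℝ ζ x‖ ^ 2)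
      - cH * (ε * (f x ^ 2 * ‖w x‖ ^ q * ζ x ^ 2) + Cy * (f x ^ 2 * |h x| ^ q * ζ x ^ 2))
      ≤ (∑ i, inner ℝ (fderiv ℝ w x (e i))
          (fderiv ℝ (powerField q (fun x => ζ x ^ 2) w) x (e i)))
        + (f x * h x - inner ℝ (b x) (w x))
          * divergence e (powerField q (fun x => ζ x ^ 2) w) x := by
    intro x
    have hA := le_contraction_powerField e hq3 hσ hw hws x
    have hB := abs_divergence_powerField_le e hq3 hσ (fun x => sq_nonneg _) hw hws x
    rw [hσd] at hA hB
    have hJ := norm_fderiv_norm_rpow_comp_of_symm (by linarith : 2 < q) hw hws x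
    set W := ‖w x‖ with hW
    have hW0 : 0 ≤ W := norm_nonneg _
    set p := W ^ (q / 2 - 1) with hp
    have hp0 : 0 ≤ p := by positivity
    have hp2 : p ^ 2 = W ^ (q - 2) := rpow_half_sub_one_sq hW0
    have hpW : p ^ 2 * W ^ 2 = W ^ q := by rw [hp2, rpow_sub_two_mul_sq hW0 (by linarith)]
    set y := W ^ (q / 2 - 2) * ‖fderiv ℝ w x (w x)‖ with hy
    set a := √(hsSq e (fderiv ℝ w x)) with ha
    have ha2 : hsSq e (fderiv ℝ w x) = a ^ 2 := (Real.sq_sqrt (hsSq_nonneg e _)).symm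
    set z := ζ x with hz
    have hz' : 0 ≤ z := hζ0 x
    set n := ‖fderiv ℝ ζ x‖ with hn
    set Ψ := divergence e (powerField q (fun x => ζ x ^ 2) w) x with hΨ
    have hY : h x ^ 2 * W ^ (q - 2) ≤ ε * W ^ q + Cy * |h x| ^ q := by
      have := hyoung |h x| W (abs_nonneg _) hW0
      rwa [Real.rpow_two, sq_abs] at this
    have hcross : -((‖b x‖ * W + |f x| * |h x|) * |Ψ|)
        ≤ (f x * h x - inner ℝ (b x) (w x)) * Ψ := by
      have h1 : |f x * h x - inner ℝ (b x) (w x)| ≤ ‖b x‖ * W + |f x| * |h x| := by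
        refine (abs_sub _ _).trans ?_
        rw [abs_mul, add_comm]
        gcongr
        exact abs_real_inner_le_norm _ _
      have h2 := neg_abs_le ((f x * h x - inner ℝ (b x) (w x)) * Ψ)
      rw [abs_mul] at h2
      have h3 := mul_le_mul_of_nonneg_right h1 (abs_nonneg Ψ)
      linarith
    have hcross2 := mul_le_mul_of_nonneg_left hB
      (by positivity : 0 ≤ ‖b x‖ * W + |f x| * |h x|)
    have hquad := quadratic_bound (m := m) (D := D) (X := p * a * z) (Z := y * z) (N := p * W * n)
      (U := ‖b x‖ * p * W * z) (H := |f x| * |h x| * p * z) hm0.le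
    have hH : (|f x| * |h x| * p * z) ^ 2
        ≤ ε * (f x ^ 2 * W ^ q * z ^ 2) + Cy * (f x ^ 2 * |h x| ^ q * z ^ 2) := by
      have e1 : (|f x| * |h x| * p * z) ^ 2 = f x ^ 2 * z ^ 2 * (h x ^ 2 * W ^ (q - 2)) := by
        rw [← hp2, ← sq_abs (f x), ← sq_abs (h x)]; ring
      rw [e1]
      refine (mul_le_mul_of_nonneg_left hY (by positivity)).trans_eq ?_
      ring
    have hH' := mul_le_mul_of_nonneg_left hH hcH0.le
    have eJ : 4 / q ^ 2 * (‖fderiv ℝ (fun y => ‖w y‖ ^ (q / 2)) x‖ ^ 2 * z ^ 2) = (y * z) ^ 2 := by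
      rw [hJ]; field_simp; ring
    rw [eJ, ha2, ← hp2, ← hpW]
    rw [ha2] at hA
    rw [← hpW] at hH'
    have g1 : (‖b x‖ * W + |f x| * |h x|) * (p ^ 2 * z ^ 2 * (D * a) + m * (p * y) * z ^ 2
        + p ^ 2 * (2 * z * n * W)) = (‖b x‖ * p * W * z + |f x| * |h x| * p * z)
        * (D * (p * a * z) + m * (y * z) + 2 * (p * W * n)) := by ring
    rw [g1] at hcross2
    have g2 : p ^ 2 * (2 * z * n * (a * W)) = 2 * (p * a * z) * (p * W * n) := by ring
    rw [g2] at hA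
    clear_value W p y a z n Ψ
    linear_combination hA + hcross + hcross2 + hquad + hH'
  have j1 := (iI.const_mul (3 / 8)).add ((iJ.const_mul (4 / q ^ 2)).const_mul
    (m - (m / 4 + 1 / 40)))
  have j2 := j1.sub (iU.const_mul cU)
  have j3 := j2.sub (iN.const_mul 37)
  have j4 := ((iF.const_mul ε).add (iH.const_mul Cy)).const_mul cH
  have hint := integral_mono (j3.sub j4) (i3.add i2) hpt
  simp only [Pi.add_apply, Pi.sub_apply] at hint
  rw [← hsplit, integral_sub, integral_sub, integral_sub, integral_add, integral_const_mul,
    integral_const_mul, integral_const_mul, integral_const_mul, integral_const_mul,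
    integral_const_mul, integral_add, integral_const_mul, integral_const_mul] at hint
  rotate_left
  · exact iF.const_mul ε
  · exact iH.const_mul Cy
  · exact iI.const_mul _
  · exact (iJ.const_mul (4 / q ^ 2)).const_mul _
  · exact j1
  · exact iU.const_mul _
  · exact j2
  · exact iN.const_mul _
  · exact j3
  · exact j4
  have hU := hform hbB hw hζ hζc
  have hF := hfB.norm_rpow_mul (ε := 1) hβ (by linarith : 2 < q) one_pos hw hζ hζc
  have p1 : 0 ≤ ∫ x, ‖w x‖ ^ (q - 2) * hsSq e (fderiv ℝ w x) * ζ x ^ 2 :=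
    integral_nonneg fun x => by have := hsSq_nonneg e (fderiv ℝ w x); positivity
  have p2 : 0 ≤ ∫ x, ‖fderiv ℝ (fun y => ‖w y‖ ^ (q / 2)) x‖ ^ 2 * ζ x ^ 2 :=
    integral_nonneg fun x => by positivity
  have p3 : 0 ≤ ∫ x, ‖w x‖ ^ q * ‖fderiv ℝ ζ x‖ ^ 2 := integral_nonneg fun x => by positivity
  have p4 : 0 ≤ ∫ x, ‖w x‖ ^ q * ζ x ^ 2 := integral_nonneg fun x => by positivity
  have p5 : 0 ≤ ∫ x, f x ^ 2 * |h x| ^ q * ζ x ^ 2 := integral_nonneg fun x => by positivity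
  generalize ∫ x, ‖w x‖ ^ (q - 2) * hsSq e (fderiv ℝ w x) * ζ x ^ 2 = I at *
  generalize ∫ x, ‖fderiv ℝ (fun y => ‖w y‖ ^ (q / 2)) x‖ ^ 2 * ζ x ^ 2 = J at *
  generalize ∫ x, ‖w x‖ ^ q * ‖fderiv ℝ ζ x‖ ^ 2 = N at *
  generalize ∫ x, ‖w x‖ ^ q * ζ x ^ 2 = Q at *
  generalize ∫ x, f x ^ 2 * |h x| ^ q * ζ x ^ 2 = H at *
  generalize ∫ x, ‖b x‖ ^ 2 * ‖w x‖ ^ q * ζ x ^ 2 = U at *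
  generalize ∫ x, f x ^ 2 * ‖w x‖ ^ q * ζ x ^ 2 = F at *
  generalize ∫ x, (divergence e w x - inner ℝ (b x) (w x) + f x * h x)
        * divergence e (powerField q (fun x => ζ x ^ 2) w) x = T at *
  have hU' := mul_le_mul_of_nonneg_left hU hcU0.le
  have hF' := mul_le_mul_of_nonneg_left hF (by positivity : 0 ≤ cH * ε)
  have eF : cH * ε * (β * (1 + 1)) = 1 / (8 * q ^ 2) := by rw [hε]; field_simp; ring
  have hq2 : 0 < 1 / q ^ 2 := by positivity
  -- the coefficient of `J` is negative because `q > d ≥ 3`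
  have k1 : (cU * (1 / q ^ 2) + 1 / (8 * q ^ 2) - (m - (m / 4 + 1 / 40)) * (4 / q ^ 2)) * J
      ≤ -(1 / (8 * q ^ 2)) * J := by
    refine mul_le_mul_of_nonneg_right ?_ p2
    have : cU * (1 / q ^ 2) + 1 / (8 * q ^ 2) - (m - (m / 4 + 1 / 40)) * (4 / q ^ 2)
        = (cU + 1 / 8 - 4 * (m - (m / 4 + 1 / 40))) * (1 / q ^ 2) := by ring
    rw [this, show -(1 / (8 * q ^ 2)) = (-1 / 8) * (1 / q ^ 2) by ring]
    refine mul_le_mul_of_nonneg_right ?_ hq2.le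
    rw [hcU, hD2]; linarith
  have k2 : 1 / (8 * q ^ 2) * I ≤ 3 / 8 * I := by
    refine mul_le_mul_of_nonneg_right ?_ p1
    rw [div_le_div_iff₀ (by positivity) (by norm_num)]; nlinarith
  have hεH : 0 ≤ cH * ε := by positivity
  have k3 : (cU * C1 + 37 + cH * ε * (2 * β)) * N ≤
      (cU * C1 + 37 + cH * ε * (2 * β) + cU + cH * ε + cH * Cy) * N :=
    mul_le_mul_of_nonneg_right (by linarith [mul_nonneg hcH0.le hCy]) p3
  have k4 : cU * (gb * Q) + cH * ε * (gf * Q) ≤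
      (cU * C1 + 37 + cH * ε * (2 * β) + cU + cH * ε + cH * Cy) * ((gb + gf) * Q) := by
    have m1 := mul_nonneg hgb p4
    have m2 := mul_nonneg hgf p4
    have n1 : 0 ≤ cU * C1 + 37 + cH * ε * (2 * β) + cH * ε + cH * Cy := by positivity
    have n2 : 0 ≤ cU * C1 + 37 + cH * ε * (2 * β) + cU + cH * Cy := by positivity
    linarith [mul_nonneg n1 m1, mul_nonneg n2 m2]
  have k5 : cH * Cy * H ≤
      (cU * C1 + 37 + cH * ε * (2 * β) + cU + cH * ε + cH * Cy) * H := by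
    refine mul_le_mul_of_nonneg_right ?_ p5
    have : 0 ≤ cU * C1 + 37 + cH * ε * (2 * β) + cU + cH * ε := by positivity
    linarith
  have hF'' : cH * ε * F ≤ 1 / (8 * q ^ 2) * J + cH * ε * (2 * β) * N + cH * ε * (gf * Q) := by
    refine hF'.trans_eq ?_
    rw [← eF, inv_one]; ring
  linear_combination hint + hU' + hF'' + k1 + k2 + k3 + k4 + k5

end Slices

/-! ### The estimate of the solution on a time slice -/

section Slices
variable {V : Type*} [NormedAddCommGroup V] [InnerProductSpace ℝ V] {ι : Type*} [Fintype ι]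
  (e : OrthonormalBasis ι ℝ V) {q : ℝ}

lemma hasFDerivAt_norm_rpow_mul_self (hq : 3 < q) {u : V → ℝ} (hu : ContDiff ℝ 1 u) (x : V) :
    HasFDerivAt (fun x => ‖u x‖ ^ (q - 2) * u x)
      (((q - 1) * ‖u x‖ ^ (q - 2)) • fderiv ℝ u x) x := by
  have hud := (hu.differentiable (by norm_num) x).hasFDerivAt
  have h1 : HasFDerivAt (fun x => ‖u x‖ ^ (q - 2))
      ((((q - 2) * ‖u x‖ ^ (q - 2 - 2)) • innerSL ℝ (u x)).comp (fderiv ℝ u x)) x :=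
    (hasFDerivAt_norm_rpow (u x) (p := q - 2) (by linarith)).comp x hud
  refine (h1.mul hud).congr_fderiv ?_
  ext y
  have e1 : ‖u x‖ ^ (q - 2 - 2) * u x ^ 2 = ‖u x‖ ^ (q - 2) := by
    rcases eq_or_ne (u x) 0 with h | h
    · simp only [h, norm_zero]
      rw [Real.zero_rpow (x := q - 2) (by linarith)]; simp
    · have : 0 < ‖u x‖ := norm_pos_iff.2 h
      rw [← sq_abs, ← Real.norm_eq_abs, ← Real.rpow_natCast, ← Real.rpow_add this]
      congr 1; push_cast; ring
  simp only [add_apply, smul_apply, ContinuousLinearMap.comp_apply, innerSL_apply_apply,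
    smul_eq_mul, RCLike.inner_apply, conj_trivial]
  linear_combination ((q - 2) * fderiv ℝ u x y) * e1

variable [FiniteDimensional ℝ V]

lemma contDiff_gradient {u : V → ℝ} (hu : ContDiff ℝ 2 u) : ContDiff ℝ 1 (gradient u) :=
  (InnerProductSpace.toDual ℝ V).symm.contDiff.comp
    (hu.fderiv_right (m := 1) (by norm_num))

lemma inner_fderiv_gradient {u : V → ℝ} (hu : ContDiff ℝ 2 u) (x y z : V) :
    inner ℝ (fderiv ℝ (gradient u) x y) z = fderiv ℝ (fderiv ℝ u) x y z := by
  have hd : DifferentiableAt ℝ (fderiv ℝ u) x :=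
    (hu.fderiv_right (m := 1) (by norm_num)).differentiable (by norm_num) x
  rw [real_inner_comm, ← fderiv_inner_const_left (contDiff_gradient hu)]
  have h : (fun x => inner ℝ z (gradient u x)) = fun x => fderiv ℝ u x z := by
    ext x; rw [real_inner_comm, inner_gradient_left]
  rw [h, fderiv_clm_apply hd (differentiableAt_const _)]
  simp

lemma inner_fderiv_gradient_symm {u : V → ℝ} (hu : ContDiff ℝ 2 u) (x y z : V) :
    inner ℝ (fderiv ℝ (gradient u) x y) z = inner ℝ y (fderiv ℝ (gradient u) x z) := by
  rw [inner_fderiv_gradient hu, real_inner_comm, inner_fderiv_gradient hu]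
  exact (hu.contDiffAt (x := x)).isSymmSndFDerivAt (by simp) y z

lemma fderiv_eq_inner_gradient (u : V → ℝ) (x y : V) :
    fderiv ℝ u x y = inner ℝ (gradient u x) y := inner_gradient_left.symm

lemma norm_fderiv_norm_rpow_real (hq : 3 < q) {u : V → ℝ} (hu : ContDiff ℝ 1 u) (x : V) :
    ‖fderiv ℝ (fun y => ‖u y‖ ^ (q / 2)) x‖ = q / 2 * (‖u x‖ ^ (q / 2 - 1) * ‖gradient u x‖) := by
  rw [(hu.differentiable (by norm_num)).fderiv_norm_rpow (by linarith)]
  have h1 : (innerSL ℝ (u x)).comp (fderiv ℝ u x) = u x • fderiv ℝ u x := by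
    ext y; simp [mul_comm]
  rw [h1, norm_smul, norm_smul, Real.norm_of_nonneg (by positivity), norm_gradient, mul_assoc,
    ← mul_assoc (‖u x‖ ^ (q / 2 - 2))]
  congr 3
  rcases eq_or_ne (u x) 0 with h | h
  · simp only [h, norm_zero, mul_zero]; rw [Real.zero_rpow (by linarith)]
  · rw [← Real.rpow_add_one (norm_ne_zero_iff.2 h)]; congr 1; ring

variable [MeasurableSpace V] [BorelSpace V]

/-- Integration by parts of the Laplacian against a compactly supported function. -/
lemma integral_divergence_mul {w : V → V} {f : V → ℝ} (hw : ContDiff ℝ 1 w)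
    (hf : ContDiff ℝ 1 f) (hfc : HasCompactSupport f) :
    ∫ x, divergence e w x * f x = -∫ x, fderiv ℝ f x (w x) := by
  have hfw : ContDiff ℝ 1 fun x => f x • w x := hf.smul hw
  have h := integral_mul_divergence e (f := fun _ => 1) contDiff_const hfw hfc.smul_right
  have h1 : ∀ x, divergence e (fun x => f x • w x) x
      = divergence e w x * f x + fderiv ℝ f x (w x) := by
    intro x
    have h2 : fderiv ℝ f x (w x) = ∑ i, fderiv ℝ f x (e i) * inner ℝ (e i) (w x) := by
      conv_lhs => rw [← e.sum_repr' (w x)]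
      simp [mul_comm]
    rw [h2, divergence, divergence, Finset.sum_mul, ← Finset.sum_add_distrib]
    refine Finset.sum_congr rfl fun i _ => ?_
    rw [fderiv_fun_smul (hf.differentiable (by norm_num) x) (hw.differentiable (by norm_num) x)]
    simp [inner_add_right, inner_smul_right]
    ring
  have hdf := hf.continuous_fderiv (by norm_num)
  have i1 : Integrable fun x => divergence e w x * f x :=
    ((continuous_divergence e hw).mul hf.continuous).integrable_of_hasCompactSupport hfc.mul_left
  have i2 : Integrable fun x => fderiv ℝ f x (w x) :=
    integrable_of_forall_notMem_tsupport (hdf.clm_apply hw.continuous) hfc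
      fun x hx => by simp [fderiv_eq_zero_of_notMem_tsupport hx]
  simp only [h1, one_mul, fderiv_fun_const, Pi.zero_apply, zero_apply,
    integral_zero, neg_zero] at h
  rw [integral_add i1 i2] at h
  linarith

/-- The energy estimate for the solution itself on a time slice: the equation is tested with
`ζ² |u|^{q-2} u`. -/
lemma exists_value_slice_bound {δ β : ℝ} (hq : 3 < q)
    (hδ : 0 < δ) (hδq : δ * q ^ 2 < 1) (hβ : 0 < β) :
    ∃ C : ℝ, 0 ≤ C ∧ ∀ {u : V → ℝ}, ContDiff ℝ 2 u →
      ∀ {ζ : V → ℝ}, ContDiff ℝ 1 ζ → HasCompactSupport ζ → (∀ x, 0 ≤ ζ x) →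
      ∀ {b : V → V}, Continuous b → ∀ {f h : V → ℝ}, Continuous f → Continuous h →
      ∀ {gb gf : ℝ}, 0 ≤ gb → 0 ≤ gf → SliceFormBound (fun x => ‖b x‖) δ gb →
      SliceFormBound f β gf →
      ∫ x, (divergence e (gradient u) x - inner ℝ (b x) (gradient u x) + f x * h x)
          * (‖u x‖ ^ (q - 2) * u x * ζ x ^ 2)
        ≤ C * ((∫ x, ‖u x‖ ^ q * ‖fderiv ℝ ζ x‖ ^ 2)
            + (1 + gb + gf) * (∫ x, ‖u x‖ ^ q * ζ x ^ 2)
            + ∫ x, f x ^ 2 * |h x| ^ q * ζ x ^ 2) := by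
  obtain ⟨C1, hC1, hform⟩ := SliceFormBound.norm_rpow_mul_of_lt (V := V) (E := ℝ) hδ
    (by linarith : 2 < q) hδq
  set ε : ℝ := 1 / (4 * β * q ^ 2) with hε
  have hε0 : 0 < ε := by positivity
  obtain ⟨Cy, hCy, hyoung⟩ := exists_rpow_mul_rpow_le (α := 2) (q := q) two_pos (by linarith) hε0
  refine ⟨C1 + 4 + ε * (2 * β) + 1 + ε + Cy, by positivity, ?_⟩
  intro u hu2 ζ hζ hζc hζ0 b hb f h hf hh gb gf hgb hgf hbB hfB
  have hu : ContDiff ℝ 1 u := hu2.of_le (by norm_num)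
  have hw := contDiff_gradient hu2
  have hζd := hζ.continuous_fderiv (by norm_num)
  have hP := contDiff_norm_rpow_comp hu (p := q / 2) (by linarith)
  have hPd := hP.continuous_fderiv (by norm_num)
  have hw0 := hw.continuous
  have hu0 := hu.continuous
  have hz0 : ∀ x, x ∉ tsupport ζ → ζ x = 0 := fun x hx => image_eq_zero_of_notMem_tsupport hx
  have hz1 : ∀ x, x ∉ tsupport ζ → fderiv ℝ ζ x = 0 := fun x hx =>
    fderiv_eq_zero_of_notMem_tsupport hx
  have hdivw := continuous_divergence e hw
  have hcq : Continuous fun x => ‖u x‖ ^ q := hu0.norm.rpow_const fun x => Or.inr (by linarith)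
  have hcq2 : Continuous fun x => ‖u x‖ ^ (q - 2) :=
    hu0.norm.rpow_const fun x => Or.inr (by linarith)
  have hch : Continuous fun x => |h x| ^ q := hh.abs.rpow_const fun x => Or.inr (by linarith)
  set Φ : V → ℝ := fun x => ‖u x‖ ^ (q - 2) * u x * ζ x ^ 2 with hΦdef
  have hΦ : ContDiff ℝ 1 Φ :=
    ((contDiff_norm_rpow_comp hu (by linarith)).mul hu).mul (hζ.pow 2)
  have hΦ0 : ∀ x, x ∉ tsupport ζ → Φ x = 0 := fun x hx => by simp [Φ, hz0 x hx]
  have hΦc : HasCompactSupport Φ := HasCompactSupport.intro hζc.isCompact hΦ0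
  have hΦd : ∀ x, fderiv ℝ Φ x (gradient u x) =
      (q - 1) * ‖u x‖ ^ (q - 2) * ‖gradient u x‖ ^ 2 * ζ x ^ 2
      + ‖u x‖ ^ (q - 2) * u x * (2 * ζ x * fderiv ℝ ζ x (gradient u x)) := by
    intro x
    have h1 := (hasFDerivAt_norm_rpow_mul_self hq hu x).mul
      ((hζ.differentiable (by norm_num) x).hasFDerivAt.pow 2)
    have h2 : fderiv ℝ Φ x = _ := h1.fderiv
    rw [h2]
    simp only [add_apply, smul_apply, smul_eq_mul, nsmul_eq_mul]
    rw [fderiv_eq_inner_gradient u, real_inner_self_eq_norm_sq]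
    simp
    ring
  have iJ : Integrable fun x => ‖fderiv ℝ (fun y => ‖u y‖ ^ (q / 2)) x‖ ^ 2 * ζ x ^ 2 :=
    integrable_of_forall_notMem_tsupport ((hPd.norm.pow 2).mul (hζ.continuous.pow 2)) hζc
      fun x hx => by simp [hz0 x hx]
  have iN : Integrable fun x => ‖u x‖ ^ q * ‖fderiv ℝ ζ x‖ ^ 2 :=
    integrable_of_forall_notMem_tsupport (hcq.mul (hζd.norm.pow 2)) hζc
      fun x hx => by simp [hz1 x hx]
  have iW : Integrable fun x => ‖u x‖ ^ q * ζ x ^ 2 :=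
    integrable_of_forall_notMem_tsupport (hcq.mul (hζ.continuous.pow 2)) hζc
      fun x hx => by simp [hz0 x hx]
  have iU : Integrable fun x => ‖b x‖ ^ 2 * ‖u x‖ ^ q * ζ x ^ 2 :=
    integrable_of_forall_notMem_tsupport (((hb.norm.pow 2).mul hcq).mul (hζ.continuous.pow 2)) hζc
      fun x hx => by simp [hz0 x hx]
  have iF : Integrable fun x => f x ^ 2 * ‖u x‖ ^ q * ζ x ^ 2 :=
    integrable_of_forall_notMem_tsupport (((hf.pow 2).mul hcq).mul (hζ.continuous.pow 2)) hζc
      fun x hx => by simp [hz0 x hx]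
  have iH : Integrable fun x => f x ^ 2 * |h x| ^ q * ζ x ^ 2 :=
    integrable_of_forall_notMem_tsupport (((hf.pow 2).mul hch).mul (hζ.continuous.pow 2)) hζc
      fun x hx => by simp [hz0 x hx]
  have i1 : Integrable fun x => divergence e (gradient u) x * Φ x :=
    integrable_of_forall_notMem_tsupport (hdivw.mul hΦ.continuous) hζc
      fun x hx => by simp [hΦ0 x hx]
  have i2 : Integrable fun x => (f x * h x - inner ℝ (b x) (gradient u x)) * Φ x :=
    integrable_of_forall_notMem_tsupport
      (((hf.mul hh).sub (hb.inner hw0)).mul hΦ.continuous) hζc fun x hx => by simp [hΦ0 x hx]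
  have i3 : Integrable fun x => fderiv ℝ Φ x (gradient u x) :=
    integrable_of_forall_notMem_tsupport ((hΦ.continuous_fderiv (by norm_num)).clm_apply hw0) hΦc
      (fun x hx => by simp [fderiv_eq_zero_of_notMem_tsupport hx])
  have hsplit : ∫ x, (divergence e (gradient u) x - inner ℝ (b x) (gradient u x) + f x * h x) * Φ x
      = ∫ x, (-fderiv ℝ Φ x (gradient u x)
        + (f x * h x - inner ℝ (b x) (gradient u x)) * Φ x) := by
    have i3' : Integrable fun x => -fderiv ℝ Φ x (gradient u x) := i3.neg
    rw [integral_add i3' i2]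
    simp only [integral_neg]
    rw [← integral_divergence_mul e hw hΦ hΦc, ← integral_add i1 i2]
    congr 1; ext x; ring
  have hpt : ∀ x, -fderiv ℝ Φ x (gradient u x) + (f x * h x - inner ℝ (b x) (gradient u x)) * Φ x
      ≤ (-5 / 4) * (4 / q ^ 2 * (‖fderiv ℝ (fun y => ‖u y‖ ^ (q / 2)) x‖ ^ 2 * ζ x ^ 2))
      + 4 * (‖u x‖ ^ q * ‖fderiv ℝ ζ x‖ ^ 2) + 1 / 2 * (‖b x‖ ^ 2 * ‖u x‖ ^ q * ζ x ^ 2)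
      + ‖u x‖ ^ q * ζ x ^ 2
      + (ε * (f x ^ 2 * ‖u x‖ ^ q * ζ x ^ 2) + Cy * (f x ^ 2 * |h x| ^ q * ζ x ^ 2)) := by
    intro x
    rw [hΦd, norm_fderiv_norm_rpow_real hq hu x]
    simp only [hΦdef]
    set U := ‖u x‖ with hU
    have hU0 : 0 ≤ U := norm_nonneg _
    set p := U ^ (q / 2 - 1) with hp
    have hp0 : 0 ≤ p := by positivity
    have hp2 : p ^ 2 = U ^ (q - 2) := rpow_half_sub_one_sq hU0
    have hpW : p ^ 2 * U ^ 2 = U ^ q := by rw [hp2, rpow_sub_two_mul_sq hU0 (by linarith)]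
    have hY : h x ^ 2 * U ^ (q - 2) ≤ ε * U ^ q + Cy * |h x| ^ q := by
      have := hyoung |h x| U (abs_nonneg _) hU0
      rwa [Real.rpow_two, sq_abs] at this
    have hz' : 0 ≤ ζ x := hζ0 x
    set W := ‖gradient u x‖ with hW
    set z := ζ x with hz
    set n := ‖fderiv ℝ ζ x‖ with hn
    have t1 : -(U ^ (q - 2) * u x * (2 * z * fderiv ℝ ζ x (gradient u x)))
        ≤ 2 * (p * W * z) * (p * U * n) := by
      have h1 : |fderiv ℝ ζ x (gradient u x)| ≤ n * W := (fderiv ℝ ζ x).le_opNorm _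
      calc _ ≤ |U ^ (q - 2) * u x * (2 * z * fderiv ℝ ζ x (gradient u x))| := neg_le_abs _
        _ = p ^ 2 * U * (2 * z) * |fderiv ℝ ζ x (gradient u x)| := by
          rw [abs_mul, abs_mul, abs_mul, abs_mul, ← hp2, abs_of_nonneg (sq_nonneg p),
            abs_of_nonneg hz', hU, Real.norm_eq_abs]
          simp; ring
        _ ≤ p ^ 2 * U * (2 * z) * (n * W) := by gcongr
        _ = _ := by ring
    have t2 : (f x * h x - inner ℝ (b x) (gradient u x)) * (U ^ (q - 2) * u x * z ^ 2)
        ≤ (‖b x‖ * p * U * z) * (p * W * z) + (|f x| * |h x| * p * z) * (p * U * z) := by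
      have h1 : |f x * h x - inner ℝ (b x) (gradient u x)| ≤ ‖b x‖ * W + |f x| * |h x| := by
        refine (abs_sub _ _).trans ?_
        rw [abs_mul, add_comm]
        gcongr
        exact abs_real_inner_le_norm _ _
      calc _ ≤ |(f x * h x - inner ℝ (b x) (gradient u x)) * (U ^ (q - 2) * u x * z ^ 2)| :=
            le_abs_self _
        _ = |f x * h x - inner ℝ (b x) (gradient u x)| * (p ^ 2 * U * z ^ 2) := by
          rw [abs_mul, abs_mul, abs_mul, ← hp2, abs_of_nonneg (sq_nonneg p),
            abs_of_nonneg (sq_nonneg z), hU, Real.norm_eq_abs]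
        _ ≤ (‖b x‖ * W + |f x| * |h x|) * (p ^ 2 * U * z ^ 2) := by gcongr
        _ = _ := by ring
    have hH : (|f x| * |h x| * p * z) ^ 2
        ≤ ε * (f x ^ 2 * U ^ q * z ^ 2) + Cy * (f x ^ 2 * |h x| ^ q * z ^ 2) := by
      have e1 : (|f x| * |h x| * p * z) ^ 2 = f x ^ 2 * z ^ 2 * (h x ^ 2 * U ^ (q - 2)) := by
        rw [← hp2, ← sq_abs (f x), ← sq_abs (h x)]; ring
      rw [e1]
      refine (mul_le_mul_of_nonneg_left hY (by positivity)).trans_eq ?_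
      ring
    have eJ : 4 / q ^ 2 * ((q / 2 * (p * W)) ^ 2 * z ^ 2) = (p * W * z) ^ 2 := by
      field_simp; ring
    rw [eJ, ← hp2, ← hpW]
    rw [← hp2] at t1 t2
    rw [← hpW] at hH
    have s1 : 0 ≤ (p * W * z / 2 - 2 * (p * U * n)) ^ 2 := sq_nonneg _
    have s2 : 0 ≤ (p * W * z - ‖b x‖ * p * U * z) ^ 2 := sq_nonneg _
    have s3 : 0 ≤ (|f x| * |h x| * p * z - p * U * z) ^ 2 := sq_nonneg _
    have s4 : 0 ≤ (q - 3) * (p * W * z) ^ 2 := mul_nonneg (by linarith) (sq_nonneg _)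
    have s6 : 0 ≤ (p * U * z) ^ 2 := sq_nonneg _
    have s7 : 0 ≤ (|f x| * |h x| * p * z) ^ 2 := sq_nonneg _
    clear_value U p W z n
    linear_combination t1 + t2 + hH + s1 + s2 / 2 + s3 / 2 + s4 + s6 / 2 + s7 / 2
  have j1 := ((iJ.const_mul (4 / q ^ 2)).const_mul (-5 / 4)).add (iN.const_mul 4)
  have j2 := j1.add (iU.const_mul (1 / 2))
  have j3 := j2.add iW
  have j4 := (iF.const_mul ε).add (iH.const_mul Cy)
  have hint := integral_mono (i3.neg.add i2) (j3.add j4) hpt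
  simp only [Pi.add_apply] at hint
  simp only [Pi.neg_apply] at hint
  rw [← hsplit, integral_add, integral_add, integral_add, integral_add, integral_const_mul,
    integral_const_mul, integral_const_mul, integral_const_mul, integral_add, integral_const_mul,
    integral_const_mul] at hint
  rotate_left
  · exact iF.const_mul ε
  · exact iH.const_mul Cy
  · exact (iJ.const_mul (4 / q ^ 2)).const_mul _
  · exact iN.const_mul _
  · exact j1
  · exact iU.const_mul _
  · exact j2
  · exact iW
  · exact j3
  · exact j4
  have hU := hform hbB hu hζ hζc
  have hF := hfB.norm_rpow_mul (ε := 1) hβ (by linarith : 2 < q) one_pos hu hζ hζc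
  have p2 : 0 ≤ ∫ x, ‖fderiv ℝ (fun y => ‖u y‖ ^ (q / 2)) x‖ ^ 2 * ζ x ^ 2 :=
    integral_nonneg fun x => by positivity
  have p3 : 0 ≤ ∫ x, ‖u x‖ ^ q * ‖fderiv ℝ ζ x‖ ^ 2 := integral_nonneg fun x => by positivity
  have p4 : 0 ≤ ∫ x, ‖u x‖ ^ q * ζ x ^ 2 := integral_nonneg fun x => by positivity
  have p5 : 0 ≤ ∫ x, f x ^ 2 * |h x| ^ q * ζ x ^ 2 := integral_nonneg fun x => by positivity
  generalize ∫ x, ‖fderiv ℝ (fun y => ‖u y‖ ^ (q / 2)) x‖ ^ 2 * ζ x ^ 2 = J at *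
  generalize ∫ x, ‖u x‖ ^ q * ‖fderiv ℝ ζ x‖ ^ 2 = N at *
  generalize ∫ x, ‖u x‖ ^ q * ζ x ^ 2 = Q at *
  generalize ∫ x, f x ^ 2 * |h x| ^ q * ζ x ^ 2 = H at *
  generalize ∫ x, ‖b x‖ ^ 2 * ‖u x‖ ^ q * ζ x ^ 2 = U at *
  generalize ∫ x, f x ^ 2 * ‖u x‖ ^ q * ζ x ^ 2 = F at *
  refine hint.trans ?_
  have hF' := mul_le_mul_of_nonneg_left hF hε0.le
  have eF : ε * (β * (1 + 1)) = 1 / 2 * (1 / q ^ 2) := by rw [hε]; field_simp; ring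
  have hq2 : 0 < 1 / q ^ 2 := by positivity
  have hF'' : ε * F ≤ 1 / 2 * (1 / q ^ 2) * J + ε * (2 * β) * N + ε * (gf * Q) := by
    refine hF'.trans_eq ?_
    rw [← eF, inv_one]; ring
  have k0 : 0 ≤ (1 / q ^ 2) * J := by positivity
  have k3 : 0 ≤ (1 / 2 * C1 + 1 + ε + Cy) * N := by positivity
  have k4 : 0 ≤ (C1 + 4 + ε * (2 * β) + 1 / 2 + ε + Cy) * (gb * Q)
      + (C1 + 4 + ε * (2 * β) + 1 + Cy) * (gf * Q)
      + (C1 + 4 + ε * (2 * β) + ε + Cy) * Q := by positivity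
  have k5 : 0 ≤ (C1 + 4 + ε * (2 * β) + 1 + ε) * H := by positivity
  linear_combination hU / 2 + hF'' + k3 + k4 + k5 + 4 * k0

set_option maxHeartbeats 800000 in
/-- A bounded function has weighted gradient bounds: since `w = ∇u`, the integral of `|w|^q` is
that of `-u div (|w|^{q-2} w)`, so it is controlled by the second derivatives of `u` and `sup |u|`.
The powers of the cut-off `ψ` are those for which Young's inequality closes. -/
lemma exists_interpolation_bound (hq : 3 < q) {η cρ : ℝ} (hη : 0 < η) (hcρ : 0 ≤ cρ) :
    ∃ C : ℝ, 0 ≤ C ∧ ∀ {u : V → ℝ}, ContDiff ℝ 2 u → ∀ {M : ℝ}, (∀ x, |u x| ≤ M) →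
      ∀ {ρ : V → ℝ}, ContDiff ℝ 1 ρ → Integrable ρ → (∀ x, 0 ≤ ρ x) →
      (∀ x, ‖fderiv ℝ ρ x‖ ≤ cρ * ρ x) →
      ∀ {ψ : V → ℝ}, ContDiff ℝ 1 ψ → HasCompactSupport ψ → (∀ x, 0 ≤ ψ x) → (∀ x, ψ x ≤ 1) →
      (∀ x, ‖fderiv ℝ ψ x‖ ≤ 1) →
      ∫ x, ‖gradient u x‖ ^ q * (ρ x * ψ x ^ q) ≤
        η * (∫ x, ‖gradient u x‖ ^ (q - 2) * hsSq e (fderiv ℝ (gradient u) x)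
          * (ρ x * ψ x ^ (q + 2))) + C * M ^ q * ∫ x, ρ x := by
  set k : ℝ := √(Fintype.card ι) + (q - 2) with hk
  have hk0 : 0 < k := by have := Real.sqrt_nonneg (Fintype.card ι); linarith
  set cτ : ℝ := cρ + q with hcτ
  have hcτ0 : 0 < cτ := by linarith
  obtain ⟨C1, hC1, hy1⟩ := exists_rpow_mul_rpow_le (α := 2) (q := q) (ε := η / k ^ 2 / 2)
    two_pos (by linarith) (by positivity)
  obtain ⟨C2, hC2, hy2⟩ := exists_rpow_mul_rpow_le (α := 1) (q := q) (ε := 1 / (4 * cτ))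
    one_pos (by linarith) (by positivity)
  refine ⟨k ^ 2 / (2 * η) * C1 * 2 + cτ * C2 * 2, by positivity, ?_⟩
  intro u hu M hM ρ hρ hρi hρ0 hρd ψ hψ hψc hψ0 hψ1 hψd
  have hw := contDiff_gradient hu
  have hM0 : 0 ≤ M := (abs_nonneg _).trans (hM 0)
  have hψq : ContDiff ℝ 1 fun x => ψ x ^ q :=
    hψ.rpow_const_of_le (by norm_num; linarith)
  have hψq2 : Continuous fun x => ψ x ^ (q + 2) :=
    hψ.continuous.rpow_const fun x => Or.inr (by linarith)
  set τ : V → ℝ := fun x => ρ x * ψ x ^ q with hτ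
  have hτ1 : ContDiff ℝ 1 τ := hρ.mul hψq
  have hτ0 : ∀ x, 0 ≤ τ x := fun x => mul_nonneg (hρ0 x) (Real.rpow_nonneg (hψ0 x) _)
  have hz : ∀ x, x ∉ tsupport ψ → ψ x = 0 := fun x hx => image_eq_zero_of_notMem_tsupport hx
  have hτz : ∀ x, x ∉ tsupport ψ → τ x = 0 := fun x hx => by
    simp [τ, hz x hx, Real.zero_rpow (by linarith : q ≠ 0)]
  have hτc : HasCompactSupport τ := HasCompactSupport.intro hψc.isCompact hτz
  have hs1 : ∀ x, ψ x ^ q = ψ x ^ (q - 2) * ψ x ^ 2 := fun x =>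
    (rpow_sub_two_mul_sq (hψ0 x) (by linarith)).symm
  have hs2 : ∀ x, ψ x ^ (q + 2) = ψ x ^ (q - 2) * ψ x ^ 4 := fun x => by
    rw [← Real.rpow_natCast, ← Real.rpow_add_of_nonneg (hψ0 x) (by linarith) (by norm_num)]
    congr 1; push_cast; ring
  have hs3 : ∀ x, ψ x ^ (q - 1) = ψ x ^ (q - 2) * ψ x := fun x => by
    rw [← Real.rpow_add_one' (hψ0 x) (by linarith)]
    congr 1; ring
  have hτd : ∀ x, ‖fderiv ℝ τ x‖ ≤ cτ * (ρ x * (ψ x ^ (q - 2) * ψ x)) := by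
    intro x
    have h1 : HasFDerivAt τ _ x := (hρ.differentiable (by norm_num) x).hasFDerivAt.mul
      ((hψ.differentiable (by norm_num) x).hasFDerivAt.rpow_const (p := q)
        (Or.inr (by linarith)))
    have p0 := hψ0 x
    have r0 := hρ0 x
    have h2 : ψ x ^ q ≤ ψ x ^ (q - 2) * ψ x := by
      rw [hs1]
      refine mul_le_mul_of_nonneg_left ?_ (by positivity)
      nlinarith [hψ1 x]
    rw [h1.fderiv]
    refine (norm_add_le _ _).trans ?_
    rw [norm_smul, norm_smul, norm_smul, Real.norm_of_nonneg r0,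
      Real.norm_of_nonneg (by positivity : 0 ≤ ψ x ^ q),
      Real.norm_of_nonneg (by positivity : 0 ≤ q * ψ x ^ (q - 1)), hs3]
    calc ρ x * (q * (ψ x ^ (q - 2) * ψ x) * ‖fderiv ℝ ψ x‖) + ψ x ^ q * ‖fderiv ℝ ρ x‖
        ≤ ρ x * (q * (ψ x ^ (q - 2) * ψ x) * 1) + (ψ x ^ (q - 2) * ψ x) * (cρ * ρ x) := by
          gcongr
          · exact hψd x
          · exact hρd x
      _ = _ := by rw [hcτ]; ring
  have hΦ := contDiff_powerField hq hτ1 hw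
  have hΦt : tsupport (powerField q τ (gradient u)) ⊆ tsupport τ := tsupport_powerField_subset
  have hΦc : HasCompactSupport (powerField q τ (gradient u)) :=
    HasCompactSupport.intro hτc.isCompact fun x hx =>
      image_eq_zero_of_notMem_tsupport fun h => hx (hΦt h)
  have hby := integral_mul_divergence e (hu.of_le (by norm_num)) hΦ hΦc
  have h1 : ∀ x, fderiv ℝ u x (powerField q τ (gradient u) x) = ‖gradient u x‖ ^ q * τ x := by
    intro x
    rw [fderiv_eq_inner_gradient, powerField, inner_smul_right, real_inner_self_eq_norm_sq,
      ← rpow_sub_two_mul_sq (norm_nonneg (gradient u x)) (by linarith : 2 < q)]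
    ring
  simp only [h1] at hby
  have hw0 := hw.continuous
  have hdw := hw.continuous_fderiv (by norm_num)
  have hcq : Continuous fun x => ‖gradient u x‖ ^ q :=
    hw0.norm.rpow_const fun x => Or.inr (by linarith)
  have hcq2 : Continuous fun x => ‖gradient u x‖ ^ (q - 2) :=
    hw0.norm.rpow_const fun x => Or.inr (by linarith)
  have hhs : Continuous fun x => hsSq e (fderiv ℝ (gradient u) x) := by unfold hsSq; fun_prop
  have iW : Integrable fun x => ‖gradient u x‖ ^ q * τ x :=
    integrable_of_forall_notMem_tsupport (hcq.mul hτ1.continuous) hψc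
      fun x hx => by simp [hτz x hx]
  have iI : Integrable fun x => ‖gradient u x‖ ^ (q - 2) * hsSq e (fderiv ℝ (gradient u) x)
      * (ρ x * ψ x ^ (q + 2)) :=
    integrable_of_forall_notMem_tsupport ((hcq2.mul hhs).mul (hρ.continuous.mul hψq2)) hψc
      fun x hx => by simp [hz x hx, Real.zero_rpow (by linarith : q + 2 ≠ 0)]
  have iΦ : Integrable fun x => -(u x * divergence e (powerField q τ (gradient u)) x) :=
    (integrable_of_forall_notMem_tsupport
      (hu.continuous.mul (continuous_divergence e hΦ)) hτc
      fun x hx => by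
        simp [divergence_eq_zero_of_notMem_tsupport e fun h => hx (hΦt h)]).neg
  have hpt : ∀ x, -(u x * divergence e (powerField q τ (gradient u)) x)
      ≤ 1 / 2 * (‖gradient u x‖ ^ q * τ x)
      + η / 2 * (‖gradient u x‖ ^ (q - 2) * hsSq e (fderiv ℝ (gradient u) x)
        * (ρ x * ψ x ^ (q + 2)))
      + (k ^ 2 / (2 * η) * C1 + cτ * C2) * M ^ q * ρ x := by
    intro x
    have hB := abs_divergence_powerField_le e hq hτ1 hτ0 hw (inner_fderiv_gradient_symm hu) x
    have hτx := hτd x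
    have hpa := rpow_sub_two_mul_norm_le (q := q)
      (norm_apply_le_sqrt e (fderiv ℝ (gradient u) x) (gradient u x)) (Real.sqrt_nonneg _)
    have hy1x := hy1 M (‖gradient u x‖ * ψ x) hM0 (mul_nonneg (norm_nonneg _) (hψ0 x))
    have hy2x := hy2 M (‖gradient u x‖ * ψ x) hM0 (mul_nonneg (norm_nonneg _) (hψ0 x))
    have hu1 : -(u x * divergence e (powerField q τ (gradient u)) x)
        ≤ M * |divergence e (powerField q τ (gradient u)) x| := by
      refine (neg_le_abs _).trans ?_
      rw [abs_mul]
      exact mul_le_mul_of_nonneg_right (hM x) (abs_nonneg _)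
    rw [Real.mul_rpow (norm_nonneg _) (hψ0 x), Real.mul_rpow (norm_nonneg _) (hψ0 x),
      Real.rpow_two] at hy1x
    rw [Real.mul_rpow (norm_nonneg _) (hψ0 x), Real.mul_rpow (norm_nonneg _) (hψ0 x),
      Real.rpow_one, hs3] at hy2x
    have e4 : ‖gradient u x‖ ^ (q - 1) = ‖gradient u x‖ ^ (q - 2) * ‖gradient u x‖ := by
      rw [← Real.rpow_add_one' (norm_nonneg _) (by linarith)]; congr 1; ring
    rw [e4] at hy2x
    rw [hs2]
    have hτe : τ x = ρ x * (ψ x ^ (q - 2) * ψ x ^ 2) := by simp only [hτ, hs1]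
    rw [hs1] at hy1x hy2x
    have r0 := hρ0 x
    have p0 := hψ0 x
    set W := ‖gradient u x‖ with hW
    have hW0 : 0 ≤ W := norm_nonneg _
    set p := W ^ (q / 2 - 1) with hp
    have hp0 : 0 ≤ p := by positivity
    have hp2 : p ^ 2 = W ^ (q - 2) := rpow_half_sub_one_sq hW0
    set y := W ^ (q / 2 - 2) * ‖fderiv ℝ (gradient u) x (gradient u x)‖ with hy
    set a := √(hsSq e (fderiv ℝ (gradient u) x)) with ha
    have ha0 : 0 ≤ a := Real.sqrt_nonneg _
    have ha2 : hsSq e (fderiv ℝ (gradient u) x) = a ^ 2 :=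
      (Real.sq_sqrt (hsSq_nonneg e _)).symm
    set s := ψ x ^ (q - 2) with hs
    have hs0 : 0 ≤ s := by positivity
    rw [ha2, ← hp2]
    rw [← hp2] at hy1x hy2x
    have hD : |divergence e (powerField q τ (gradient u)) x|
        ≤ p ^ 2 * τ x * (k * a) + p ^ 2 * (cτ * (ρ x * (s * ψ x)) * W) := by
      refine hB.trans ?_
      have h2 : (q - 2) * (p * y) * τ x ≤ (q - 2) * (p * (p * a)) * τ x := by
        have := hτ0 x
        have hq2 : 0 ≤ q - 2 := by linarith
        gcongr
      have h3 : p ^ 2 * (‖fderiv ℝ τ x‖ * W) ≤ p ^ 2 * (cτ * (ρ x * (s * ψ x)) * W) := by gcongr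
      rw [hk]
      linarith
    have hMD := mul_le_mul_of_nonneg_left hD hM0
    -- `ψ²` is split so that the second derivatives carry `ψ^{q+2}`
    have t1 : M * (k * a * ψ x ^ 2) ≤ η / 2 * (a ^ 2 * ψ x ^ 4) + k ^ 2 / (2 * η) * M ^ 2 := by
      have h : η / 2 * (a ^ 2 * ψ x ^ 4) + k ^ 2 / (2 * η) * M ^ 2 - M * (k * a * ψ x ^ 2)
          = 1 / (2 * η) * (η * (a * ψ x ^ 2) - k * M) ^ 2 := by field_simp; ring
      have h' : 0 ≤ 1 / (2 * η) * (η * (a * ψ x ^ 2) - k * M) ^ 2 := by positivity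
      linarith
    have t1' := mul_le_mul_of_nonneg_left t1 (by positivity : 0 ≤ p ^ 2 * ρ x * s)
    have t2 := mul_le_mul_of_nonneg_left hy1x (by positivity : 0 ≤ k ^ 2 / (2 * η) * ρ x)
    have t3 := mul_le_mul_of_nonneg_left hy2x (by positivity : 0 ≤ cτ * ρ x)
    have e5 : k ^ 2 / (2 * η) * (η / k ^ 2 / 2) = 1 / 4 := by field_simp; norm_num
    have e6 : cτ * (1 / (4 * cτ)) = 1 / 4 := by field_simp
    rw [hτe] at hMD ⊢
    clear_value W p y a s
    linear_combination hu1 + hMD + t1' + t2 + t3 + (ρ x * (W ^ q * (s * ψ x ^ 2))) * (e5 + e6)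
  have j1 := (iW.const_mul (1 / 2)).add (iI.const_mul (η / 2))
  have j2 := hρi.const_mul ((k ^ 2 / (2 * η) * C1 + cτ * C2) * M ^ q)
  have hint := integral_mono iΦ (j1.add j2) hpt
  simp only [Pi.add_apply] at hint
  rw [integral_neg, hby, integral_add, integral_add, integral_const_mul, integral_const_mul,
    integral_const_mul] at hint
  rotate_left
  · exact iW.const_mul _
  · exact iI.const_mul _
  · exact j1
  · exact j2
  linarith

end Slices

/-! ### Weights and cut-offs -/

section Weights
variable {d : ℕ}

lemma weight_pos (θ : ℝ) (x : EuclideanSpace ℝ (Fin d)) : 0 < weight 1 θ x :=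
  Real.rpow_pos_of_pos (by positivity) _

lemma contDiff_weight (θ : ℝ) : ContDiff ℝ 1 (weight (d := d) 1 θ) := by
  have h : ContDiff ℝ 1 fun x : EuclideanSpace ℝ (Fin d) => 1 + 1 * ‖x‖ ^ 2 :=
    contDiff_const.add (contDiff_const.mul (contDiff_norm_sq ℝ))
  exact h.rpow_const_of_ne fun x => by positivity

lemma norm_fderiv_weight_le {θ : ℝ} (hθ : 0 ≤ θ) (x : EuclideanSpace ℝ (Fin d)) :
    ‖fderiv ℝ (weight 1 θ) x‖ ≤ θ * weight 1 θ x := by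
  have hpos : 0 < 1 + 1 * ‖x‖ ^ 2 := by positivity
  have h1 : HasFDerivAt (fun x : EuclideanSpace ℝ (Fin d) => 1 + 1 * ‖x‖ ^ 2)
      ((1 : ℝ) • (2 • innerSL ℝ x)) x :=
    ((hasStrictFDerivAt_norm_sq x).hasFDerivAt.const_mul 1).const_add 1
  have h2 : HasFDerivAt (weight 1 θ) _ x := h1.rpow_const (p := -θ) (Or.inl hpos.ne')
  rw [h2.fderiv, norm_smul, one_smul, Real.norm_eq_abs, abs_mul, abs_neg, abs_of_nonneg hθ,
    abs_of_pos (Real.rpow_pos_of_pos hpos _), Real.rpow_sub_one hpos.ne', mul_assoc]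
  refine mul_le_mul_of_nonneg_left ?_ hθ
  have h3 : ‖(2 • innerSL ℝ x : StrongDual ℝ (EuclideanSpace ℝ (Fin d)))‖ ≤ 1 + 1 * ‖x‖ ^ 2 := by
    rw [← Nat.cast_smul_eq_nsmul ℝ, norm_smul, innerSL_apply_norm]
    norm_num
    nlinarith [sq_nonneg (‖x‖ - 1)]
  have h4 : 0 < (1 + 1 * ‖x‖ ^ 2) ^ (-θ) := Real.rpow_pos_of_pos hpos _
  calc _ ≤ (1 + 1 * ‖x‖ ^ 2) ^ (-θ) / (1 + 1 * ‖x‖ ^ 2) * (1 + 1 * ‖x‖ ^ 2) := by gcongr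
    _ = weight 1 θ x := div_mul_cancel₀ _ hpos.ne'

lemma weight_half_sq (θ : ℝ) (x : EuclideanSpace ℝ (Fin d)) :
    weight 1 (θ / 2) x ^ 2 = weight 1 θ x := by
  rw [weight, weight, ← Real.rpow_mul_natCast (by positivity)]
  congr 1; push_cast; ring

lemma integrable_weight {θ : ℝ} (hθ : (d : ℝ) / 2 < θ) :
    Integrable (weight (d := d) 1 θ) := by
  have := integrable_rpow_neg_one_add_norm_sq (E := EuclideanSpace ℝ (Fin d)) (μ := volume)
    (r := 2 * θ) (by simp; linarith)
  refine this.congr (Filter.Eventually.of_forall fun x => ?_)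
  simp only [weight, one_mul]
  congr 1; ring

/-- Cut-off functions equal to `1` on larger and larger balls, with gradients of size
`1 / (k + 1)`. -/
lemma exists_cutoff (d : ℕ) : ∃ ψ : ℕ → EuclideanSpace ℝ (Fin d) → ℝ,
    (∀ k, ContDiff ℝ 1 (ψ k)) ∧ (∀ k, HasCompactSupport (ψ k)) ∧ (∀ k x, 0 ≤ ψ k x) ∧
    (∀ k x, ψ k x ≤ 1) ∧ (∀ k x, ‖fderiv ℝ (ψ k) x‖ ≤ 1 / ((k : ℝ) + 1)) ∧
    ∀ x, ∀ᶠ k in Filter.atTop, ψ k x = 1 := by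
  let φ : ContDiffBump (0 : EuclideanSpace ℝ (Fin d)) := ⟨1, 2, one_pos, one_lt_two⟩
  have hφ : ContDiff ℝ 1 φ := φ.contDiff
  obtain ⟨L, hL⟩ := (φ.hasCompactSupport.fderiv ℝ).exists_bound_of_continuous
    (hφ.continuous_fderiv (by norm_num))
  have hL0 : 0 ≤ L := (norm_nonneg _).trans (hL 0)
  -- a dilation strong enough to bring the gradient of the bump below `1 / (k + 1)`
  let c : ℕ → ℝ := fun k => ((L + 1) * ((k : ℝ) + 1))⁻¹
  have hc : ∀ k, 0 < c k := fun k => by positivity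
  refine ⟨fun k x => φ (c k • x), fun k => hφ.comp (contDiff_const_smul (c k)),
    fun k => φ.hasCompactSupport.comp_smul (hc k).ne', fun k x => φ.nonneg, fun k x => φ.le_one,
    fun k x => ?_, fun x => ?_⟩
  · have h1 : HasFDerivAt (fun x => φ (c k • x)) ((fderiv ℝ φ (c k • x)).comp
        (c k • ContinuousLinearMap.id ℝ _)) x :=
      (hφ.differentiable (by norm_num) _).hasFDerivAt.comp x ((hasFDerivAt_id x).const_smul (c k))
    rw [h1.fderiv, ContinuousLinearMap.comp_smul, ContinuousLinearMap.comp_id, norm_smul,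
      Real.norm_of_nonneg (hc k).le]
    calc c k * ‖fderiv ℝ φ (c k • x)‖ ≤ c k * (L + 1) := by
          gcongr
          linarith [hL (c k • x)]
      _ = 1 / ((k : ℝ) + 1) := by simp only [c]; field_simp
  · have h1 : Filter.Tendsto (fun k : ℕ => (L + 1) * ((k : ℝ) + 1)) Filter.atTop Filter.atTop :=
      (Filter.tendsto_atTop_add_const_right _ _ tendsto_natCast_atTop_atTop).const_mul_atTop
        (by positivity)
    filter_upwards [h1.eventually_ge_atTop ‖x‖] with k hk
    refine φ.one_of_mem_closedBall ?_
    rw [mem_closedBall_zero_iff, norm_smul, Real.norm_of_nonneg (hc k).le]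
    change c k * ‖x‖ ≤ 1
    simp only [c]
    rw [inv_mul_le_iff₀ (by positivity), mul_one]
    exact hk

/-- The square root `ζ` of the weight `ρ ψ^{q+2}`. The exponent is chosen so that `|∇ζ|²` involves,
besides `ζ²`, only `|∇ψ|² ρ ψ^q`, the weight for which the gradient can be interpolated. -/
noncomputable def cutWeight (θ q : ℝ) (ψ : EuclideanSpace ℝ (Fin d) → ℝ)
    (x : EuclideanSpace ℝ (Fin d)) : ℝ :=
  weight 1 (θ / 2) x * ψ x ^ ((q + 2) / 2)

variable {θ q : ℝ} {ψ : EuclideanSpace ℝ (Fin d) → ℝ}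

lemma cutWeight_nonneg (hψ0 : ∀ x, 0 ≤ ψ x) (x : EuclideanSpace ℝ (Fin d)) :
    0 ≤ cutWeight θ q ψ x :=
  mul_nonneg (weight_pos _ x).le (Real.rpow_nonneg (hψ0 x) _)

lemma cutWeight_sq (hψ0 : ∀ x, 0 ≤ ψ x) (x : EuclideanSpace ℝ (Fin d)) :
    cutWeight θ q ψ x ^ 2 = weight 1 θ x * ψ x ^ (q + 2) := by
  rw [cutWeight, mul_pow, weight_half_sq, ← Real.rpow_mul_natCast (hψ0 x)]
  congr 2; push_cast; ring

lemma contDiff_cutWeight (hq : 0 < q) (hψ : ContDiff ℝ 1 ψ) : ContDiff ℝ 1 (cutWeight θ q ψ) :=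
  (contDiff_weight _).mul (hψ.rpow_const_of_le (by norm_num; linarith))

lemma hasCompactSupport_cutWeight (hq : 0 < q) (hψc : HasCompactSupport ψ) :
    HasCompactSupport (cutWeight θ q ψ) :=
  HasCompactSupport.intro hψc.isCompact fun x hx => by
    simp [cutWeight, image_eq_zero_of_notMem_tsupport hx,
      Real.zero_rpow (by linarith : (q + 2) / 2 ≠ 0)]

lemma cutWeight_sq_le (hq : 0 < q) (hψ0 : ∀ x, 0 ≤ ψ x) (hψ1 : ∀ x, ψ x ≤ 1)
    (x : EuclideanSpace ℝ (Fin d)) : cutWeight θ q ψ x ^ 2 ≤ weight 1 θ x := by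
  rw [cutWeight_sq hψ0]
  exact mul_le_of_le_one_right (weight_pos _ x).le
    (Real.rpow_le_one (hψ0 x) (hψ1 x) (by linarith))

lemma norm_fderiv_cutWeight_sq_le {ℓ : ℝ} (hθ : 0 ≤ θ) (hq : 0 < q) (hψ : ContDiff ℝ 1 ψ)
    (hψ0 : ∀ x, 0 ≤ ψ x) (hℓ : ∀ x, ‖fderiv ℝ ψ x‖ ≤ ℓ) (x : EuclideanSpace ℝ (Fin d)) :
    ‖fderiv ℝ (cutWeight θ q ψ) x‖ ^ 2 ≤ θ ^ 2 / 2 * cutWeight θ q ψ x ^ 2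
      + (q + 2) ^ 2 / 2 * ℓ ^ 2 * (weight 1 θ x * ψ x ^ q) := by
  have hψd := (hψ.differentiable (by norm_num) x).hasFDerivAt
  have hwd := ((contDiff_weight (d := d) (θ / 2)).differentiable (by norm_num) x).hasFDerivAt
  have h1 : HasFDerivAt (cutWeight θ q ψ) _ x := hwd.mul (hψd.rpow_const (p := (q + 2) / 2)
    (Or.inr (by linarith)))
  have p0 := hψ0 x
  have r0 := (weight_pos (θ / 2) x).le
  have hn : ‖fderiv ℝ (cutWeight θ q ψ) x‖ ≤ θ / 2 * cutWeight θ q ψ x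
      + (q + 2) / 2 * (ℓ * (weight 1 (θ / 2) x * ψ x ^ (q / 2))) := by
    rw [h1.fderiv]
    refine (norm_add_le _ _).trans ?_
    rw [norm_smul, norm_smul, norm_smul, Real.norm_of_nonneg r0,
      Real.norm_of_nonneg (by positivity : 0 ≤ ψ x ^ ((q + 2) / 2)),
      Real.norm_of_nonneg (by positivity : 0 ≤ (q + 2) / 2 * ψ x ^ ((q + 2) / 2 - 1)),
      show (q + 2) / 2 - 1 = q / 2 by ring, add_comm]
    refine add_le_add ?_ ?_
    · calc _ ≤ ψ x ^ ((q + 2) / 2) * (θ / 2 * weight 1 (θ / 2) x) := by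
            gcongr; exact norm_fderiv_weight_le (by linarith) x
        _ = _ := by rw [cutWeight]; ring
    · calc _ ≤ weight 1 (θ / 2) x * ((q + 2) / 2 * ψ x ^ (q / 2) * ℓ) := by
            gcongr; exact hℓ x
        _ = _ := by ring
  have e1 : (weight 1 (θ / 2) x * ψ x ^ (q / 2)) ^ 2 = weight 1 θ x * ψ x ^ q := by
    rw [mul_pow, weight_half_sq, ← Real.rpow_mul_natCast p0]
    congr 2; push_cast; ring
  rw [← e1]
  refine (pow_le_pow_left₀ (norm_nonneg _) hn 2).trans ?_
  set α := cutWeight θ q ψ x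
  set γ := weight 1 (θ / 2) x * ψ x ^ (q / 2)
  linear_combination sq_nonneg (θ / 2 * α - (q + 2) / 2 * (ℓ * γ))

end Weights

/-! ### Differentiation of convex functionals in time -/

lemma mul_rpow_mul_le {q a b : ℝ} (hq : 1 < q) (ha : 0 ≤ a) (hb : 0 ≤ b) :
    q * (a ^ (q - 1) * b) ≤ b ^ q + (q - 1) * a ^ q := by
  rcases ha.eq_or_lt with rfl | ha
  · rw [Real.zero_rpow (by linarith), Real.zero_rpow (by linarith)]
    simp only [zero_mul, mul_zero, add_zero]
    positivity
  have h := one_add_mul_self_le_rpow_one_add (s := b / a - 1)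
    (by have : 0 ≤ b / a := by positivity
        linarith) hq.le
  rw [add_sub_cancel, Real.div_rpow hb ha.le, le_div_iff₀ (by positivity)] at h
  have e : a ^ q = a ^ (q - 1) * a := by
    rw [← Real.rpow_add_one ha.ne']; congr 1; ring
  have e2 : (1 + q * (b / a - 1)) * (a ^ (q - 1) * a)
      = a ^ (q - 1) * a + q * (a ^ (q - 1) * b) - q * (a ^ (q - 1) * a) := by
    field_simp; ring
  rw [e, e2] at h
  rw [e]
  linarith

/-- The subgradient inequality for `‖·‖^q`. -/
lemma norm_rpow_add_inner_le {E : Type*} [NormedAddCommGroup E] [InnerProductSpace ℝ E] {q : ℝ}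
    (hq : 2 < q) (x y : E) :
    q * (‖x‖ ^ (q - 2) * inner ℝ x (y - x)) ≤ ‖y‖ ^ q - ‖x‖ ^ q := by
  have h1 := mul_rpow_mul_le (by linarith : 1 < q) (norm_nonneg x) (norm_nonneg y)
  have h2 := real_inner_le_norm x y
  have e1 : ‖x‖ ^ (q - 1) = ‖x‖ ^ (q - 2) * ‖x‖ := by
    rw [← Real.rpow_add_one' (norm_nonneg _) (by linarith)]; congr 1; ring
  rw [inner_sub_right, real_inner_self_eq_norm_sq, mul_sub,
    rpow_sub_two_mul_sq (norm_nonneg x) hq]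
  have h3 : q * (‖x‖ ^ (q - 2) * inner ℝ x y) ≤ q * (‖x‖ ^ (q - 2) * (‖x‖ * ‖y‖)) := by gcongr
  rw [e1] at h1
  linarith

section Time
variable {V : Type*} [NormedAddCommGroup V] [InnerProductSpace ℝ V] [FiniteDimensional ℝ V]
  [MeasurableSpace V] [BorelSpace V]

lemma tendsto_integral_slope_mul {v G Ψ : ℝ → V → ℝ} {K : Set V} (hK : IsCompact K)
    {s T t₀ : ℝ} (ht₀ : t₀ ∈ Ioo s T) (hv : ∀ t ∈ Icc s T, Continuous (v t))
    (hG : ContinuousOn (fun p : ℝ × V => G p.1 p.2) (Icc s T ×ˢ univ))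
    (hvG : ∀ t ∈ Icc s T, ∀ x, HasDerivWithinAt (fun τ => v τ x) (G t x) (Icc s T) t)
    (hΨ : ContinuousOn (fun p : ℝ × V => Ψ p.1 p.2) (Icc s T ×ˢ univ))
    (hΨ0 : ∀ t ∈ Icc s T, ∀ x, x ∉ K → Ψ t x = 0) :
    Filter.Tendsto (fun t => ∫ x, slope (fun τ => v τ x) t₀ t * Ψ t x) (nhdsWithin t₀ {t₀}ᶜ)
      (nhds (∫ x, G t₀ x * Ψ t₀ x)) := by
  have ht₀' := Ioo_subset_Icc_self ht₀
  have hev : ∀ᶠ t in nhdsWithin t₀ {t₀}ᶜ, t ∈ Icc s T :=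
    nhdsWithin_le_nhds (Icc_mem_nhds ht₀.1 ht₀.2)
  obtain ⟨CG, hCG⟩ := (isCompact_Icc.prod hK).exists_bound_of_continuousOn
    (hG.mono (prod_mono_right (subset_univ K)))
  obtain ⟨CΨ, hCΨ⟩ := (isCompact_Icc.prod hK).exists_bound_of_continuousOn
    (hΨ.mono (prod_mono_right (subset_univ K)))
  refine tendsto_integral_filter_of_dominated_convergence (K.indicator fun _ => CG * CΨ)
    ?_ ?_ ?_ ?_
  · filter_upwards [hev] with t ht
    have hΨt : Continuous (Ψ t) :=
      hΨ.comp_continuous (by fun_prop : Continuous fun x : V => (t, x)) fun x => ⟨ht, mem_univ _⟩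
    simp only [slope_def_field]
    exact ((((hv t ht).sub (hv t₀ ht₀')).div_const _).mul hΨt).aestronglyMeasurable
  · filter_upwards [hev] with t ht
    refine Filter.Eventually.of_forall fun x => ?_
    by_cases hx : x ∈ K
    · rw [indicator_of_mem hx, norm_mul]
      refine mul_le_mul ?_ (hCΨ (t, x) ⟨ht, hx⟩) (norm_nonneg _)
        ((norm_nonneg _).trans (hCG (t, x) ⟨ht, hx⟩))
      have := (convex_Icc s T).norm_image_sub_le_of_norm_hasDerivWithin_le (f := fun τ => v τ x)
        (fun τ hτ => hvG τ hτ x) (fun τ hτ => hCG (τ, x) ⟨hτ, hx⟩) ht₀' ht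
      rw [slope_def_field, norm_div]
      rcases eq_or_ne t t₀ with rfl | hne
      · simp only [sub_self, norm_zero, div_zero]
        exact (norm_nonneg _).trans (hCG (t, x) ⟨ht, hx⟩)
      · rwa [div_le_iff₀ (norm_pos_iff.2 (sub_ne_zero.2 hne))]
    · simp [hx, hΨ0 t ht x hx]
  · rw [integrable_indicator_iff hK.measurableSet]
    exact continuous_const.continuousOn.integrableOn_compact hK
  · refine Filter.Eventually.of_forall fun x => Filter.Tendsto.mul ?_ ?_
    · exact hasDerivAt_iff_tendsto_slope.1
        ((hvG t₀ ht₀' x).hasDerivAt (Icc_mem_nhds ht₀.1 ht₀.2))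
    · have h1 : ContinuousWithinAt (fun t => Ψ t x) (Icc s T) t₀ :=
        ContinuousWithinAt.comp (f := fun t => (t, x)) (g := fun p : ℝ × V => Ψ p.1 p.2)
          (hΨ (t₀, x) ⟨ht₀', mem_univ _⟩)
          (by fun_prop : ContinuousWithinAt (fun t => (t, x)) (Icc s T) t₀)
          fun t ht => ⟨ht, mem_univ _⟩
      exact ((h1.continuousAt (Icc_mem_nhds ht₀.1 ht₀.2)).tendsto).mono_left nhdsWithin_le_nhds

/-- A functional `N` of the solution whose subgradients `Ψ` depend continuously on time is
differentiable in time. This avoids differentiating `∇v` in time, which need not be possible. -/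
lemma hasDerivAt_of_subgradient {v G Ψ : ℝ → V → ℝ} {N : ℝ → ℝ} {K : Set V} (hK : IsCompact K)
    {s T t₀ : ℝ} (ht₀ : t₀ ∈ Ioo s T) (hv : ∀ t ∈ Icc s T, Continuous (v t))
    (hG : ContinuousOn (fun p : ℝ × V => G p.1 p.2) (Icc s T ×ˢ univ))
    (hvG : ∀ t ∈ Icc s T, ∀ x, HasDerivWithinAt (fun τ => v τ x) (G t x) (Icc s T) t)
    (hΨ : ContinuousOn (fun p : ℝ × V => Ψ p.1 p.2) (Icc s T ×ˢ univ))
    (hΨ0 : ∀ t ∈ Icc s T, ∀ x, x ∉ K → Ψ t x = 0)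
    (hN : ∀ t ∈ Icc s T, ∀ t' ∈ Icc s T, ∫ x, (v t' x - v t x) * Ψ t x ≤ N t' - N t) :
    HasDerivAt N (∫ x, G t₀ x * Ψ t₀ x) t₀ := by
  have ht₀' := Ioo_subset_Icc_self ht₀
  have hB := tendsto_integral_slope_mul hK ht₀ hv hG hvG hΨ hΨ0
  have hΨt : Continuous (Ψ t₀) :=
    hΨ.comp_continuous (by fun_prop : Continuous fun x : V => (t₀, x))
      fun x => ⟨ht₀', mem_univ _⟩
  have hA := tendsto_integral_slope_mul (Ψ := fun _ => Ψ t₀) hK ht₀ hv hG hvG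
    (hΨt.comp continuous_snd).continuousOn (fun t _ x hx => hΨ0 t₀ ht₀' x hx)
  rw [hasDerivAt_iff_tendsto_slope]
  have hmin := hA.min hB
  have hmax := hA.max hB
  rw [min_self] at hmin
  rw [max_self] at hmax
  have hev : ∀ᶠ t in nhdsWithin t₀ {t₀}ᶜ, t ∈ Icc s T :=
    nhdsWithin_le_nhds (Icc_mem_nhds ht₀.1 ht₀.2)
  have hslope : ∀ t x (c : ℝ), slope (fun τ => v τ x) t₀ t * c
      = (t - t₀)⁻¹ * ((v t x - v t₀ x) * c) := fun t x c => by
    rw [slope_def_field]; ring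
  have key : ∀ t ∈ Icc s T, t ≠ t₀ →
      min (∫ x, slope (fun τ => v τ x) t₀ t * Ψ t₀ x) (∫ x, slope (fun τ => v τ x) t₀ t * Ψ t x)
        ≤ slope N t₀ t ∧ slope N t₀ t ≤
      max (∫ x, slope (fun τ => v τ x) t₀ t * Ψ t₀ x)
        (∫ x, slope (fun τ => v τ x) t₀ t * Ψ t x) := by
    intro t ht hne
    have h1 := hN t₀ ht₀' t ht
    have h2 := hN t ht t₀ ht₀'
    have h3 : ∫ x, (v t₀ x - v t x) * Ψ t x = -∫ x, (v t x - v t₀ x) * Ψ t x := by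
      rw [← integral_neg]; congr 1; ext x; ring
    rw [h3] at h2
    simp only [hslope, integral_const_mul]
    rw [slope_def_field, div_eq_inv_mul]
    rcases lt_or_gt_of_ne hne with hlt | hgt
    · have hneg : (t - t₀)⁻¹ ≤ 0 := inv_nonpos.2 (by linarith)
      exact ⟨min_le_of_right_le (mul_le_mul_of_nonpos_left (by linarith) hneg),
        le_max_of_le_left (mul_le_mul_of_nonpos_left h1 hneg)⟩
    · have hpos : 0 ≤ (t - t₀)⁻¹ := inv_nonneg.2 (by linarith)
      exact ⟨min_le_of_left_le (mul_le_mul_of_nonneg_left h1 hpos),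
        le_max_of_le_right (mul_le_mul_of_nonneg_left (by linarith) hpos)⟩
  refine tendsto_of_tendsto_of_tendsto_of_le_of_le' hmin hmax ?_ ?_
  · filter_upwards [hev, self_mem_nhdsWithin] with t ht hne using (key t ht hne).1
  · filter_upwards [hev, self_mem_nhdsWithin] with t ht hne using (key t ht hne).2

end Time

/-! ### The combined energy estimate -/

/-- The subgradient of `u ↦ ∫ (|∇u|^q + |u|^q) ζ²`, as a function of `x`; the divergence is
computed in the orthonormal basis `e`. -/
noncomputable def energySubgradient {V ι : Type*} [NormedAddCommGroup V] [InnerProductSpace ℝ V]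
    [FiniteDimensional ℝ V] [Fintype ι] (e : OrthonormalBasis ι ℝ V) (q : ℝ) (ζ u : V → ℝ)
    (x : V) : ℝ :=
  q * (‖u x‖ ^ (q - 2) * u x * ζ x ^ 2)
    - q * divergence e (powerField q (fun x => ζ x ^ 2) (gradient u)) x

section Combined
variable {d : ℕ}

set_option maxHeartbeats 600000 in
/-- The energy estimate on a time slice for the localised energy `∫ (|∇u|^q + |u|^q) ζ²`. The
error made by the cut-off is of order `ℓ²`, where `ℓ` bounds the gradient of the cut-off; its
constant involves `sup |u|` but not the growth of `∇u`. -/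
lemma exists_energy_slice_bound (hd : 3 ≤ d) {θ δ β q : ℝ} (hθ : (d : ℝ) / 2 < θ) (hq : d < q)
    (hδ : 0 < δ) (hδq : δ * q ^ 2 < 1) (hβ : 0 < β) :
    ∃ c C : ℝ, 0 < c ∧ 0 ≤ C ∧ ∀ {u : EuclideanSpace ℝ (Fin d) → ℝ}, ContDiff ℝ 2 u →
      ∀ {M : ℝ}, (∀ x, |u x| ≤ M) →
      ∀ {ψ : EuclideanSpace ℝ (Fin d) → ℝ}, ContDiff ℝ 1 ψ → HasCompactSupport ψ →
      (∀ x, 0 ≤ ψ x) → (∀ x, ψ x ≤ 1) → ∀ {ℓ : ℝ}, ℓ ≤ 1 → (∀ x, ‖fderiv ℝ ψ x‖ ≤ ℓ) →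
      ∀ {b : EuclideanSpace ℝ (Fin d) → EuclideanSpace ℝ (Fin d)}, Continuous b →
      ∀ {f h : EuclideanSpace ℝ (Fin d) → ℝ}, Continuous f → Continuous h →
      ∀ {gb gf : ℝ}, 0 ≤ gb → 0 ≤ gf → SliceFormBound (fun x => ‖b x‖) δ gb →
      SliceFormBound f β gf →
      ∫ x, (divergence (EuclideanSpace.basisFun (Fin d) ℝ) (gradient u) x
          - inner ℝ (b x) (gradient u x) + f x * h x)
          * energySubgradient (EuclideanSpace.basisFun (Fin d) ℝ) q (cutWeight θ q ψ) u x
        ≤ -c * (∫ x, ‖fderiv ℝ (fun y => ‖gradient u y‖ ^ (q / 2)) x‖ ^ 2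
            * cutWeight θ q ψ x ^ 2)
          + C * ((1 + gb + gf) * (∫ x, (‖gradient u x‖ ^ q + ‖u x‖ ^ q) * cutWeight θ q ψ x ^ 2)
            + (∫ x, f x ^ 2 * |h x| ^ q * cutWeight θ q ψ x ^ 2) + ℓ ^ 2 * M ^ q) := by
  set e := EuclideanSpace.basisFun (Fin d) ℝ with he
  have hd' : (3 : ℝ) ≤ d := by exact_mod_cast hd
  have hq3 : 3 < q := by linarith
  have hθ0 : 0 < θ := by linarith
  obtain ⟨C1, hC1, hgrad⟩ := exists_gradient_slice_bound e (by simpa using hd) (by simpa using hq)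
    hδ hδq hβ
  obtain ⟨C2, hC2, hval⟩ := exists_value_slice_bound e hq3 hδ hδq hβ
  set c : ℝ := 1 / (8 * q ^ 2) with hc
  have hc0 : 0 < c := by positivity
  set A : ℝ := θ ^ 2 / 2 with hA
  set B : ℝ := (q + 2) ^ 2 / 2 with hB
  have hA0 : 0 ≤ A := by positivity
  have hB0 : 0 < B := by positivity
  -- with this `η` the interpolation error is absorbed by the second derivatives
  set η : ℝ := c / ((C1 + 1) * B) with hη
  have hη0 : 0 < η := by positivity
  obtain ⟨C3, hC3, hint⟩ := exists_interpolation_bound e hq3 hη0 hθ0.le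
  set P : ℝ := ∫ x : EuclideanSpace ℝ (Fin d), weight 1 θ x with hP
  have hP0 : 0 ≤ P := integral_nonneg fun x => (weight_pos θ x).le
  refine ⟨q * c, q * (C1 + C1 * A + C1 * B * C3 * P + C2 + C2 * A + C2 * B * P), by positivity,
    by positivity, ?_⟩
  intro u hu M hM ψ hψ hψc hψ0 hψ1 ℓ hℓ1 hℓ b hb f h hf hh gb gf hgb hgf hbB hfB
  have hℓ0 : 0 ≤ ℓ := (norm_nonneg _).trans (hℓ 0)
  have hM0 : 0 ≤ M := (abs_nonneg _).trans (hM 0)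
  have hq0 : 0 < q := by linarith
  have hζ : ContDiff ℝ 1 (cutWeight θ q ψ) := contDiff_cutWeight hq0 hψ
  have hζc : HasCompactSupport (cutWeight θ q ψ) := hasCompactSupport_cutWeight hq0 hψc
  have hζ0 := cutWeight_nonneg (θ := θ) (q := q) hψ0
  have hg := hgrad (contDiff_gradient hu) (inner_fderiv_gradient_symm hu) hζ hζc hζ0 hb hf hh
    hgb hgf hbB hfB
  have hv := hval hu hζ hζc hζ0 hb hf hh hgb hgf hbB hfB
  have hi := hint hu hM (contDiff_weight θ) (integrable_weight hθ) (fun x => (weight_pos θ x).le)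
    (norm_fderiv_weight_le hθ0.le) hψ hψc hψ0 hψ1 (fun x => (hℓ x).trans hℓ1)
  simp only [← cutWeight_sq (θ := θ) (q := q) hψ0] at hi
  have hζd := norm_fderiv_cutWeight_sq_le hθ0.le hq0 hψ hψ0 hℓ
  simp only [← hA, ← hB] at hζd
  set ζ := cutWeight θ q ψ with hζdef
  set w := gradient u with hw
  have hw1 : ContDiff ℝ 1 w := contDiff_gradient hu
  have hu0 := hu.continuous
  have hw0 := hw1.continuous
  have hz0 : ∀ x, x ∉ tsupport ζ → ζ x = 0 := fun x hx => image_eq_zero_of_notMem_tsupport hx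
  have hζdc := hζ.continuous_fderiv (by norm_num)
  have hwq : Continuous fun x => ‖w x‖ ^ q := hw0.norm.rpow_const fun x => Or.inr (by linarith)
  have huq : Continuous fun x => ‖u x‖ ^ q := hu0.norm.rpow_const fun x => Or.inr (by linarith)
  have hψq : Continuous fun x => ψ x ^ q := hψ.continuous.rpow_const fun x => Or.inr (by linarith)
  have hρc := (contDiff_weight (d := d) θ).continuous
  have hdiv := continuous_divergence e hw1
  have hΦ := contDiff_powerField hq3 (hζ.pow 2) hw1
  have hΦz : ∀ x, x ∉ tsupport ζ → divergence e (powerField q (fun x => ζ x ^ 2) w) x = 0 :=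
    fun x hx => divergence_eq_zero_of_notMem_tsupport e fun h =>
      hx ((closure_mono fun x hx => by simpa using hx) (tsupport_powerField_subset h))
  have hGc : Continuous fun x => divergence e w x - inner ℝ (b x) (w x) + f x * h x :=
    (hdiv.sub (hb.inner hw0)).add (hf.mul hh)
  have iWN : Integrable fun x => ‖w x‖ ^ q * ‖fderiv ℝ ζ x‖ ^ 2 :=
    integrable_of_forall_notMem_tsupport (hwq.mul (hζdc.norm.pow 2)) hζc
      fun x hx => by simp [fderiv_eq_zero_of_notMem_tsupport hx]
  have iUN : Integrable fun x => ‖u x‖ ^ q * ‖fderiv ℝ ζ x‖ ^ 2 :=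
    integrable_of_forall_notMem_tsupport (huq.mul (hζdc.norm.pow 2)) hζc
      fun x hx => by simp [fderiv_eq_zero_of_notMem_tsupport hx]
  have iW : Integrable fun x => ‖w x‖ ^ q * ζ x ^ 2 :=
    integrable_of_forall_notMem_tsupport (hwq.mul (hζ.continuous.pow 2)) hζc
      fun x hx => by simp [hz0 x hx]
  have iU : Integrable fun x => ‖u x‖ ^ q * ζ x ^ 2 :=
    integrable_of_forall_notMem_tsupport (huq.mul (hζ.continuous.pow 2)) hζc
      fun x hx => by simp [hz0 x hx]
  have iτ : Integrable fun x => ‖w x‖ ^ q * (weight 1 θ x * ψ x ^ q) :=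
    integrable_of_forall_notMem_tsupport (hwq.mul (hρc.mul hψq)) hψc
      fun x hx => by
        simp [image_eq_zero_of_notMem_tsupport hx, Real.zero_rpow hq0.ne']
  have iρ : Integrable (weight (d := d) 1 θ) := integrable_weight hθ
  have iG1 : Integrable fun x => (divergence e w x - inner ℝ (b x) (w x) + f x * h x)
      * (‖u x‖ ^ (q - 2) * u x * ζ x ^ 2) :=
    integrable_of_forall_notMem_tsupport (hGc.mul (((hu0.norm.rpow_const
      fun x => Or.inr (by linarith)).mul hu0).mul (hζ.continuous.pow 2))) hζc
      fun x hx => by simp [hz0 x hx]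
  have iG2 : Integrable fun x => (divergence e w x - inner ℝ (b x) (w x) + f x * h x)
      * divergence e (powerField q (fun x => ζ x ^ 2) w) x :=
    integrable_of_forall_notMem_tsupport (hGc.mul (continuous_divergence e hΦ)) hζc
      fun x hx => by simp [hΦz x hx]
  have hsplit : ∫ x, (divergence e w x - inner ℝ (b x) (w x) + f x * h x)
        * energySubgradient (EuclideanSpace.basisFun (Fin d) ℝ) q ζ u x
      = q * (∫ x, (divergence e w x - inner ℝ (b x) (w x) + f x * h x)
          * (‖u x‖ ^ (q - 2) * u x * ζ x ^ 2))
        - q * ∫ x, (divergence e w x - inner ℝ (b x) (w x) + f x * h x)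
          * divergence e (powerField q (fun x => ζ x ^ 2) w) x := by
    rw [← integral_const_mul, ← integral_const_mul, ← integral_sub (iG1.const_mul q)
      (iG2.const_mul q)]
    congr 1; ext x
    rw [energySubgradient]; ring
  have hX : ∫ x, (‖w x‖ ^ q + ‖u x‖ ^ q) * ζ x ^ 2
      = (∫ x, ‖w x‖ ^ q * ζ x ^ 2) + ∫ x, ‖u x‖ ^ q * ζ x ^ 2 := by
    rw [← integral_add iW iU]; congr 1; ext x; ring
  have hWN : ∫ x, ‖w x‖ ^ q * ‖fderiv ℝ ζ x‖ ^ 2 ≤ A * (∫ x, ‖w x‖ ^ q * ζ x ^ 2)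
      + B * ℓ ^ 2 * ∫ x, ‖w x‖ ^ q * (weight 1 θ x * ψ x ^ q) := by
    rw [← integral_const_mul, ← integral_const_mul, ← integral_add (iW.const_mul _)
      (iτ.const_mul _)]
    refine integral_mono iWN ((iW.const_mul _).add (iτ.const_mul _)) fun x => ?_
    refine (mul_le_mul_of_nonneg_left (hζd x) (by positivity)).trans_eq ?_
    ring
  have hUN : ∫ x, ‖u x‖ ^ q * ‖fderiv ℝ ζ x‖ ^ 2 ≤ A * (∫ x, ‖u x‖ ^ q * ζ x ^ 2)
      + B * ℓ ^ 2 * M ^ q * P := by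
    rw [hP, ← integral_const_mul, ← integral_const_mul, ← integral_add (iU.const_mul _)
      (iρ.const_mul _)]
    refine integral_mono iUN ((iU.const_mul _).add (iρ.const_mul _)) fun x => ?_
    have h1 : ‖u x‖ ^ q ≤ M ^ q := Real.rpow_le_rpow (norm_nonneg _) (hM x) hq0.le
    have h2 : weight 1 θ x * ψ x ^ q ≤ weight 1 θ x :=
      mul_le_of_le_one_right (weight_pos θ x).le (Real.rpow_le_one (hψ0 x) (hψ1 x) hq0.le)
    have h3 : ‖u x‖ ^ q * (weight 1 θ x * ψ x ^ q) ≤ M ^ q * weight 1 θ x :=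
      mul_le_mul h1 h2 (mul_nonneg (weight_pos θ x).le (Real.rpow_nonneg (hψ0 x) _))
        (by positivity)
    have h4 := mul_le_mul_of_nonneg_left h3 (by positivity : 0 ≤ B * ℓ ^ 2)
    have h5 := mul_le_mul_of_nonneg_left (hζd x) (by positivity : 0 ≤ ‖u x‖ ^ q)
    linarith
  rw [hsplit, hX]
  have p1 : 0 ≤ ∫ x, ‖w x‖ ^ (q - 2) * hsSq e (fderiv ℝ w x) * ζ x ^ 2 :=
    integral_nonneg fun x => by have := hsSq_nonneg e (fderiv ℝ w x); positivity
  have p4 : 0 ≤ ∫ x, ‖w x‖ ^ q * ζ x ^ 2 := integral_nonneg fun x => by positivity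
  have p5 : 0 ≤ ∫ x, f x ^ 2 * |h x| ^ q * ζ x ^ 2 := integral_nonneg fun x => by positivity
  have p6 : 0 ≤ ∫ x, ‖u x‖ ^ q * ζ x ^ 2 := integral_nonneg fun x => by positivity
  have p7 : 0 ≤ M ^ q := by positivity
  rw [← hP] at hi
  generalize ∫ x, ‖w x‖ ^ (q - 2) * hsSq e (fderiv ℝ w x) * ζ x ^ 2 = I at hg hi p1 ⊢
  generalize ∫ x, ‖fderiv ℝ (fun y => ‖w y‖ ^ (q / 2)) x‖ ^ 2 * ζ x ^ 2 = J at hg ⊢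
  generalize ∫ x, ‖w x‖ ^ q * ‖fderiv ℝ ζ x‖ ^ 2 = N at hg hWN
  generalize ∫ x, ‖u x‖ ^ q * ‖fderiv ℝ ζ x‖ ^ 2 = N' at hv hUN
  generalize ∫ x, ‖w x‖ ^ q * ζ x ^ 2 = Q at hg hWN p4 ⊢
  generalize ∫ x, ‖u x‖ ^ q * ζ x ^ 2 = Q' at hv hUN p6 ⊢
  generalize ∫ x, f x ^ 2 * |h x| ^ q * ζ x ^ 2 = H at hg hv p5 ⊢
  generalize ∫ x, ‖w x‖ ^ q * (weight 1 θ x * ψ x ^ q) = τ at hWN hi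
  generalize ∫ x, (divergence e w x - inner ℝ (b x) (w x) + f x * h x)
        * divergence e (powerField q (fun x => ζ x ^ 2) w) x = T at hg ⊢
  generalize ∫ x, (divergence e w x - inner ℝ (b x) (w x) + f x * h x)
        * (‖u x‖ ^ (q - 2) * u x * ζ x ^ 2) = T' at hv ⊢
  generalize M ^ q = m at *
  have hℓ2 : ℓ ^ 2 ≤ 1 := pow_le_one₀ hℓ0 hℓ1
  have a1 : C1 * N ≤ C1 * A * Q + C1 * B * ℓ ^ 2 * (η * I + C3 * m * P) := by
    have h1 := mul_le_mul_of_nonneg_left hWN hC1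
    have h2 := mul_le_mul_of_nonneg_left hi (by positivity : 0 ≤ C1 * B * ℓ ^ 2)
    linarith
  have a2 : C1 * B * ℓ ^ 2 * (η * I) ≤ c * I := by
    have h1 : C1 * B * η ≤ c := by
      rw [hη, mul_div_assoc', div_le_iff₀ (by positivity)]
      nlinarith [mul_pos hc0 hB0]
    have h2 : C1 * B * η * ℓ ^ 2 ≤ c * 1 := mul_le_mul h1 hℓ2 (sq_nonneg _) hc0.le
    have h3 := mul_le_mul_of_nonneg_right h2 p1
    linarith
  have a3 : C2 * N' ≤ C2 * A * Q' + C2 * (B * ℓ ^ 2 * m * P) := by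
    have h1 := mul_le_mul_of_nonneg_left hUN hC2
    linarith
  have b1 : 0 ≤ (gb + gf) * Q := by positivity
  have b2 : 0 ≤ (gb + gf) * Q' := by positivity
  have b3 : 0 ≤ ℓ ^ 2 * m := by positivity
  have key : T' - T ≤ -c * J + (C1 + C1 * A + C1 * B * C3 * P + C2 + C2 * A + C2 * B * P)
      * ((1 + gb + gf) * (Q + Q') + H + ℓ ^ 2 * m) := by
    have k1 : 0 ≤ (C1 + C1 * B * C3 * P + C2 + C2 * A + C2 * B * P) * Q := by positivity
    have k2 : 0 ≤ (C1 + C1 * A + C1 * B * C3 * P + C2 * B * P) * Q' := by positivity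
    have k3 : 0 ≤ (C1 * A + C1 * B * C3 * P + C2 + C2 * A + C2 * B * P) * ((gb + gf) * Q) := by
      positivity
    have k4 : 0 ≤ (C1 + C1 * A + C1 * B * C3 * P + C2 * A + C2 * B * P) * ((gb + gf) * Q') := by
      positivity
    have k5 : 0 ≤ (C1 * A + C1 * B * C3 * P + C2 * A + C2 * B * P) * H := by positivity
    have k6 : 0 ≤ (C1 + C1 * A + C2 + C2 * A) * (ℓ ^ 2 * m) := by positivity
    linear_combination hg + hv + a1 + a2 + a3 + k1 + k2 + k3 + k4 + k5 + k6
  have := mul_le_mul_of_nonneg_left key hq0.le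
  linarith

end Combined

/-! ### Continuity in time and space of the quantities entering the energy -/

section JointContinuity
variable {V : Type*} [NormedAddCommGroup V] [InnerProductSpace ℝ V] {I : Set ℝ}

lemma continuousOn_divergence {ι : Type*} [Fintype ι] (e : OrthonormalBasis ι ℝ V)
    {w : ℝ → V → V}
    (h : ContinuousOn (fun p : ℝ × V => fderiv ℝ (w p.1) p.2) (I ×ˢ univ)) :
    ContinuousOn (fun p : ℝ × V => divergence e (w p.1) p.2) (I ×ˢ univ) :=
  continuousOn_finsetSum _ fun _ _ =>
    ContinuousOn.inner continuousOn_const (h.clm_apply continuousOn_const)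

lemma continuousOn_fderiv_norm_rpow {w : ℝ → V → V} {p : ℝ} (hp : 1 < p)
    (hw : ∀ t ∈ I, ContDiff ℝ 1 (w t))
    (h0 : ContinuousOn (fun p : ℝ × V => w p.1 p.2) (I ×ˢ univ))
    (h1 : ContinuousOn (fun p : ℝ × V => fderiv ℝ (w p.1) p.2) (I ×ˢ univ)) :
    ContinuousOn (fun z : ℝ × V => fderiv ℝ (fun y => ‖w z.1 y‖ ^ p) z.2) (I ×ˢ univ) := by
  have hN : ContDiff ℝ 1 (fun y : V => ‖y‖ ^ p) := contDiff_norm_rpow hp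
  have h2 : ContinuousOn (fun z : ℝ × V =>
      (fderiv ℝ (fun y : V => ‖y‖ ^ p) (w z.1 z.2)).comp (fderiv ℝ (w z.1) z.2)) (I ×ˢ univ) :=
    ((hN.continuous_fderiv (by norm_num)).comp_continuousOn h0).clm_comp h1
  refine h2.congr fun z hz => ?_
  exact ((hN.differentiable (by norm_num) _).hasFDerivAt.comp z.2
    ((hw z.1 hz.1).differentiable (by norm_num) z.2).hasFDerivAt).fderiv

variable [FiniteDimensional ℝ V] {v : ℝ → V → ℝ}

lemma continuousOn_gradient
    (h : ContinuousOn (fun p : ℝ × V => fderiv ℝ (v p.1) p.2) (I ×ˢ univ)) :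
    ContinuousOn (fun p : ℝ × V => gradient (v p.1) p.2) (I ×ˢ univ) :=
  (InnerProductSpace.toDual ℝ V).symm.continuous.comp_continuousOn h

lemma continuousOn_fderiv_gradient (hv : ∀ t ∈ I, ContDiff ℝ 2 (v t))
    (h : ContinuousOn (fun p : ℝ × V => fderiv ℝ (fderiv ℝ (v p.1)) p.2) (I ×ˢ univ)) :
    ContinuousOn (fun p : ℝ × V => fderiv ℝ (gradient (v p.1)) p.2) (I ×ˢ univ) := by
  rw [continuousOn_clm_apply]
  intro y
  have h1 : ContinuousOn (fun p : ℝ × V =>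
      (InnerProductSpace.toDual ℝ V).symm (fderiv ℝ (fderiv ℝ (v p.1)) p.2 y)) (I ×ˢ univ) :=
    (InnerProductSpace.toDual ℝ V).symm.continuous.comp_continuousOn
      (h.clm_apply continuousOn_const)
  refine h1.congr fun p hp => ?_
  refine ext_inner_right ℝ fun z => ?_
  rw [inner_fderiv_gradient (hv p.1 hp.1), InnerProductSpace.toDual_symm_apply]

lemma continuousOn_fderiv_powerField {w : ℝ → V → V} {σ : V → ℝ} {q : ℝ} (hq : 3 < q)
    (hσ : ContDiff ℝ 1 σ) (hw : ∀ t ∈ I, ContDiff ℝ 1 (w t))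
    (h0 : ContinuousOn (fun p : ℝ × V => w p.1 p.2) (I ×ˢ univ))
    (h1 : ContinuousOn (fun p : ℝ × V => fderiv ℝ (w p.1) p.2) (I ×ˢ univ)) :
    ContinuousOn (fun z : ℝ × V => fderiv ℝ (powerField q σ (w z.1)) z.2) (I ×ˢ univ) := by
  -- the power of the norm is composed as a `C¹` map, which avoids the factor `‖w‖ ^ (q - 4)`
  set Φ : V → V := powerField q (fun _ => 1) id with hΦ
  have hΦ1 : ContDiff ℝ 1 Φ := contDiff_powerField hq contDiff_const contDiff_id
  have h2 : ContinuousOn (fun z : ℝ × V =>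
      σ z.2 • (fderiv ℝ Φ (w z.1 z.2)).comp (fderiv ℝ (w z.1) z.2)
        + (fderiv ℝ σ z.2).smulRight (Φ (w z.1 z.2))) (I ×ˢ univ) := by
    have hσ0 : ContinuousOn (fun z : ℝ × V => σ z.2) (I ×ˢ univ) :=
      (hσ.continuous.comp continuous_snd).continuousOn
    have hσ1 : ContinuousOn (fun z : ℝ × V => fderiv ℝ σ z.2) (I ×ˢ univ) :=
      ((hσ.continuous_fderiv (by norm_num)).comp continuous_snd).continuousOn
    refine (hσ0.smul (((hΦ1.continuous_fderiv (by norm_num)).comp_continuousOn h0).clm_comp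
      h1)).add ?_
    rw [continuousOn_clm_apply]
    intro y
    exact (hσ1.clm_apply continuousOn_const).smul (hΦ1.continuous.comp_continuousOn h0)
  refine h2.congr fun z hz => ?_
  have e : powerField q σ (w z.1) = fun x => σ x • Φ (w z.1 x) := by
    ext1 x
    simp only [hΦ, powerField, id, mul_one, smul_smul]
    rw [mul_comm]
  have h3 := (hσ.differentiable (by norm_num) z.2).hasFDerivAt.smul
    ((hΦ1.differentiable (by norm_num) _).hasFDerivAt.comp z.2
      ((hw z.1 hz.1).differentiable (by norm_num) z.2).hasFDerivAt)
  simp only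
  rw [e]
  exact h3.fderiv

lemma laplacian_eq_divergence_gradient {ι : Type*} [Fintype ι] (e : OrthonormalBasis ι ℝ V)
    {u : V → ℝ} (hu : ContDiff ℝ 2 u) (x : V) :
    Laplacian.laplacian u x = divergence e (gradient u) x := by
  rw [InnerProductSpace.laplacian_eq_iteratedFDeriv_orthonormalBasis u e]
  refine Finset.sum_congr rfl fun i _ => ?_
  rw [iteratedFDeriv_two_apply, real_inner_comm, inner_fderiv_gradient hu]
  rfl

end JointContinuity

section Subgradient
variable {V ι : Type*} [NormedAddCommGroup V] [InnerProductSpace ℝ V] [FiniteDimensional ℝ V]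
  [Fintype ι] (e : OrthonormalBasis ι ℝ V)

lemma continuousOn_energySubgradient {v : ℝ → V → ℝ} {I : Set ℝ}
    {ζ : V → ℝ} {q : ℝ} (hq : 3 < q) (hζ : ContDiff ℝ 1 ζ)
    (hv : ∀ t ∈ I, ContDiff ℝ 2 (v t))
    (h0 : ContinuousOn (fun p : ℝ × V => v p.1 p.2) (I ×ˢ univ))
    (h1 : ContinuousOn (fun p : ℝ × V => fderiv ℝ (v p.1) p.2)
      (I ×ˢ univ))
    (h2 : ContinuousOn (fun p : ℝ × V => fderiv ℝ (fderiv ℝ (v p.1)) p.2)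
      (I ×ˢ univ)) :
    ContinuousOn (fun p : ℝ × V =>
      energySubgradient e q ζ (v p.1) p.2) (I ×ˢ univ) := by
  have hζ0 : ContinuousOn (fun z : ℝ × V => ζ z.2) (I ×ˢ univ) :=
    (hζ.continuous.comp continuous_snd).continuousOn
  have hw : ∀ t ∈ I, ContDiff ℝ 1 (gradient (v t)) := fun t ht => contDiff_gradient (hv t ht)
  have k1 := continuousOn_fderiv_powerField hq (hζ.pow 2) hw
    (continuousOn_gradient h1) (continuousOn_fderiv_gradient hv h2)
  have k2 := continuousOn_divergence
    (w := fun t => powerField q (fun x => ζ x ^ 2) (gradient (v t))) e k1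
  have hq2 : 0 ≤ q - 2 := by linarith
  have k3 : ContinuousOn (fun p : ℝ × V => ‖v p.1 p.2‖ ^ (q - 2) * v p.1 p.2 * ζ p.2 ^ 2)
      (I ×ˢ univ) := ((h0.norm.rpow_const fun _ _ => Or.inr hq2).mul h0).mul (hζ0.pow 2)
  exact (continuousOn_const.mul k3).sub (continuousOn_const.mul k2)

lemma energySubgradient_eq_zero_of_notMem_tsupport {q : ℝ}
    {ζ u : V → ℝ} {x : V}
    (hx : x ∉ tsupport ζ) : energySubgradient e q ζ u x = 0 := by
  have h1 : ζ x = 0 := image_eq_zero_of_notMem_tsupport hx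
  have h2 : x ∉ tsupport (powerField q (fun x => ζ x ^ 2) (gradient u)) := fun h =>
    hx (closure_mono (fun y hy => by
      simp only [Function.mem_support] at hy ⊢
      contrapose! hy
      simp [hy]) (tsupport_powerField_subset h))
  rw [energySubgradient, divergence_eq_zero_of_notMem_tsupport _ h2, h1]
  ring

variable [MeasurableSpace V] [BorelSpace V]

/-- `energySubgradient` is a subgradient of the localised energy; the gradient part is convexity of
`‖·‖^q` after integration by parts. -/
lemma integral_sub_mul_energySubgradient_le {q : ℝ} (hq : 3 < q)
    {ζ u u' : V → ℝ} (hζ : ContDiff ℝ 1 ζ) (hζc : HasCompactSupport ζ)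
    (hu : ContDiff ℝ 2 u) (hu' : ContDiff ℝ 2 u') :
    ∫ x, (u' x - u x) * energySubgradient e q ζ u x
      ≤ (∫ x, (‖gradient u' x‖ ^ q + ‖u' x‖ ^ q) * ζ x ^ 2)
        - ∫ x, (‖gradient u x‖ ^ q + ‖u x‖ ^ q) * ζ x ^ 2 := by
  have hw := contDiff_gradient hu
  have hw' := contDiff_gradient hu'
  set Φ := powerField q (fun x => ζ x ^ 2) (gradient u) with hΦ
  have hΦ1 : ContDiff ℝ 1 Φ := contDiff_powerField hq (hζ.pow 2) hw
  have hζ2c : HasCompactSupport (fun x => ζ x ^ 2) := hζc.comp_left (g := fun a => a ^ 2) (by simp)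
  have hΦc : HasCompactSupport Φ := hζ2c.of_isClosed_subset (isClosed_tsupport _)
    tsupport_powerField_subset
  have hζ0 : ∀ x, x ∉ tsupport ζ → ζ x = 0 := fun x hx => image_eq_zero_of_notMem_tsupport hx
  have hq0 : (0 : ℝ) ≤ q := by linarith
  have cu := hu.continuous
  have cu' := hu'.continuous
  have cw := hw.continuous
  have cw' := hw'.continuous
  have cζ := hζ.continuous
  have hr : ∀ {p : ℝ}, 0 ≤ p → ∀ {g : V → V},
      Continuous g → Continuous fun x => ‖g x‖ ^ p := fun hp _ hg =>
    hg.norm.rpow_const fun _ => Or.inr hp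
  have hr' : ∀ {p : ℝ}, 0 ≤ p → ∀ {g : V → ℝ},
      Continuous g → Continuous fun x => ‖g x‖ ^ p := fun hp _ hg =>
    hg.norm.rpow_const fun _ => Or.inr hp
  have hI : ∀ {u : V → ℝ}, Continuous u → Continuous (gradient u) →
      Integrable (fun x => (‖gradient u x‖ ^ q + ‖u x‖ ^ q) * ζ x ^ 2) := fun hu hw =>
    integrable_of_forall_notMem_tsupport (((hr hq0 hw).add (hr' hq0 hu)).mul (cζ.pow 2)) hζc
      fun x hx => by simp [hζ0 x hx]
  have hI1 : Integrable (fun x => (u' x - u x) * (q * (‖u x‖ ^ (q - 2) * u x * ζ x ^ 2))) :=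
    integrable_of_forall_notMem_tsupport ((cu'.sub cu).mul (continuous_const.mul
      (((hr' (by linarith) cu).mul cu).mul (cζ.pow 2)))) hζc fun x hx => by simp [hζ0 x hx]
  have hI2 : Integrable (fun x => (u' x - u x) * divergence e Φ x) := by
    have h1 : Continuous (divergence e Φ) := continuous_divergence e hΦ1
    have h2 : Continuous fun x => (u' x - u x) * divergence e Φ x := (cu'.sub cu).mul h1
    refine h2.integrable_of_hasCompactSupport (hΦc.mono' fun x hx => ?_)
    by_contra h
    exact hx (by simp only [divergence_eq_zero_of_notMem_tsupport e h, mul_zero])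
  have hI3 : Integrable (fun x => q * (‖gradient u x‖ ^ (q - 2)
      * inner ℝ (gradient u x) (gradient u' x - gradient u x)) * ζ x ^ 2) :=
    integrable_of_forall_notMem_tsupport ((continuous_const.mul ((hr (by linarith) cw).mul
      (cw.inner (cw'.sub cw)))).mul (cζ.pow 2)) hζc fun x hx => by simp [hζ0 x hx]
  have hparts := integral_mul_divergence e (f := fun x => u' x - u x)
    ((hu'.sub hu).of_le (by norm_num)) hΦ1 hΦc
  have hfd : ∀ x, fderiv ℝ (fun x => u' x - u x) x (Φ x) = ‖gradient u x‖ ^ (q - 2)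
      * inner ℝ (gradient u x) (gradient u' x - gradient u x) * ζ x ^ 2 := fun x => by
    rw [fderiv_fun_sub (hu'.differentiable (by norm_num) x) (hu.differentiable (by norm_num) x),
      sub_apply, fderiv_eq_inner_gradient, fderiv_eq_inner_gradient,
      ← inner_sub_left, hΦ, powerField, inner_smul_right, real_inner_comm]
    ring
  have e1 : ∫ x, (u' x - u x) * energySubgradient e q ζ u x
      = ∫ x, ((u' x - u x) * (q * (‖u x‖ ^ (q - 2) * u x * ζ x ^ 2))
        + q * (‖gradient u x‖ ^ (q - 2)
      * inner ℝ (gradient u x) (gradient u' x - gradient u x)) * ζ x ^ 2) := by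
    rw [integral_add hI1 hI3]
    have : ∀ x, (u' x - u x) * energySubgradient e q ζ u x
        = (u' x - u x) * (q * (‖u x‖ ^ (q - 2) * u x * ζ x ^ 2))
          - q * ((u' x - u x) * divergence e Φ x) := fun x => by
      rw [energySubgradient]; ring
    simp only [this]
    rw [integral_sub hI1 (hI2.const_mul q), integral_const_mul, hparts]
    simp only [hfd]
    rw [mul_neg, sub_neg_eq_add, ← integral_const_mul]
    congr 2
    ext x; ring
  rw [e1, ← integral_sub (hI cu' cw') (hI cu cw)]
  refine integral_mono (hI1.add hI3) ((hI cu' cw').sub (hI cu cw)) fun x => ?_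
  have k1 := norm_rpow_add_inner_le (q := q) (by linarith) (u x) (u' x)
  have k2 := norm_rpow_add_inner_le (q := q) (by linarith) (gradient u x) (gradient u' x)
  have k3 : (inner ℝ (u x) (u' x - u x) : ℝ) = u x * (u' x - u x) := by
    simp [mul_comm]
  rw [k3] at k1
  have h2 : 0 ≤ ζ x ^ 2 := sq_nonneg _
  have := mul_le_mul_of_nonneg_right (add_le_add k1 k2) h2
  simp only
  linarith

end Subgradient

/-! ### The localised energy of a solution -/

/-- From a differential inequality that holds at almost every time to a bound of the energy `N` and
of the dissipation `J`. -/
lemma energy_bound_of_differential_inequality {N D J m a : ℝ → ℝ} {s r c : ℝ} (hsr : s ≤ r)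
    (hc : 0 ≤ c) (hN : ContinuousOn N (Icc s r)) (hN0 : ∀ t ∈ Icc s r, 0 ≤ N t)
    (hD : ContinuousOn D (Icc s r)) (hND : ∀ t ∈ Ioo s r, HasDerivAt N (D t) t)
    (hJ : ContinuousOn J (Icc s r)) (hJ0 : ∀ t ∈ Icc s r, 0 ≤ J t)
    (hm : ContinuousOn m (Icc s r)) (hm0 : ∀ t ∈ Icc s r, 0 ≤ m t)
    (ha : IntegrableOn a (Icc s r)) (ha0 : ∀ t ∈ Icc s r, 0 ≤ a t)
    (h : ∀ᵐ t ∂volume.restrict (Icc s r), D t ≤ -c * J t + a t * N t + m t) :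
    (∀ t ∈ Icc s r, N t ≤ (N s + ∫ t in Icc s r, m t) * Real.exp (∫ t in Icc s r, a t)) ∧
      c * ∫ t in Icc s r, J t ≤ (N s + ∫ t in Icc s r, m t)
        * (1 + (∫ t in Icc s r, a t) * Real.exp (∫ t in Icc s r, a t)) := by
  have key : ∀ t ∈ Icc s r,
      N t + c * (∫ τ in s..t, J τ) ≤ N s + (∫ τ in s..t, a τ * N τ) + ∫ τ in s..t, m τ := by
    intro t ht
    have hsub : Icc s t ⊆ Icc s r := Icc_subset_Icc_right ht.2
    have hI : ∀ {g : ℝ → ℝ}, ContinuousOn g (Icc s r) → IntervalIntegrable g volume s t :=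
      fun hg => (hg.mono (by rw [uIcc_of_le ht.1]; exact hsub)).intervalIntegrable
    have haN : IntervalIntegrable (fun τ => a τ * N τ) volume s t := by
      refine IntervalIntegrable.mul_continuousOn ?_ (hN.mono (by rw [uIcc_of_le ht.1]; exact hsub))
      rw [intervalIntegrable_iff_integrableOn_Icc_of_le ht.1]
      exact ha.mono_set hsub
    have hFTC := intervalIntegral.integral_eq_sub_of_hasDerivAt_of_le ht.1 (hN.mono hsub)
      (fun τ hτ => hND τ ⟨hτ.1, hτ.2.trans_le ht.2⟩) (hI hD)
    have hmono := intervalIntegral.integral_mono_ae_restrict ht.1 (hI hD)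
      ((((hI hJ).const_mul (-c)).add haN).add (hI hm))
      (ae_restrict_of_ae_restrict_of_subset hsub h)
    rw [intervalIntegral.integral_add (((hI hJ).const_mul (-c)).add haN) (hI hm),
      intervalIntegral.integral_add ((hI hJ).const_mul (-c)) haN,
      intervalIntegral.integral_const_mul, hFTC] at hmono
    linarith
  have hIcc : ∀ g : ℝ → ℝ, ∫ τ in Icc s r, g τ = ∫ τ in s..r, g τ := fun g => by
    rw [intervalIntegral.integral_of_le hsr, integral_Icc_eq_integral_Ioc]
  have hle : ∀ {g : ℝ → ℝ}, ContinuousOn g (Icc s r) → (∀ t ∈ Icc s r, 0 ≤ g t) →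
      ∀ t ∈ Icc s r, 0 ≤ ∫ τ in s..t, g τ ∧ ∫ τ in s..t, g τ ≤ ∫ τ in Icc s r, g τ := by
    intro g hg hg0 t ht
    have hi : IntegrableOn g (Icc s r) := hg.integrableOn_compact isCompact_Icc
    refine ⟨intervalIntegral.integral_nonneg ht.1 fun τ hτ => hg0 τ ⟨hτ.1, hτ.2.trans ht.2⟩, ?_⟩
    rw [intervalIntegral.integral_of_le ht.1]
    refine setIntegral_mono_set hi ?_
      (Ioc_subset_Icc_self.trans (Icc_subset_Icc_right ht.2)).eventuallyLE
    exact (ae_restrict_mem measurableSet_Icc).mono fun τ hτ => hg0 τ hτ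
  have hNs : 0 ≤ N s + ∫ t in Icc s r, m t :=
    add_nonneg (hN0 s ⟨le_rfl, hsr⟩) (setIntegral_nonneg measurableSet_Icc hm0)
  have hbound := gronwall_of_integrable hNs hN hN0 ha ha0 (fun t ht => by
    have h1 := key t ht
    have h2 := (hle hm hm0 t ht).2
    have h3 := mul_nonneg hc (hle hJ hJ0 t ht).1
    linarith)
  refine ⟨hbound, ?_⟩
  have hr : r ∈ Icc s r := ⟨hsr, le_rfl⟩
  have h1 := key r hr
  have h2 := hN0 r hr
  rw [← hIcc, ← hIcc, ← hIcc] at h1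
  have h3 : ∫ t in Icc s r, a t * N t ≤ ∫ t in Icc s r, a t *
      ((N s + ∫ t in Icc s r, m t) * Real.exp (∫ t in Icc s r, a t)) := by
    refine setIntegral_mono_on (ha.mul_continuousOn hN isCompact_Icc) (ha.mul_const _)
      measurableSet_Icc fun t ht => mul_le_mul_of_nonneg_left (hbound t ht) (ha0 t ht)
  rw [integral_mul_const] at h3
  nlinarith [h1, h2, h3]

lemma continuousOn_integral_mul_sq {V : Type*} [NormedAddCommGroup V] [InnerProductSpace ℝ V]
    [FiniteDimensional ℝ V] [MeasurableSpace V] [BorelSpace V] {g : ℝ → V → ℝ} {ζ : V → ℝ}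
    {I : Set ℝ} (hg : ContinuousOn (fun p : ℝ × V => g p.1 p.2) (I ×ˢ univ)) (hζ : Continuous ζ)
    (hζc : HasCompactSupport ζ) : ContinuousOn (fun t => ∫ x, g t x * ζ x ^ 2) I := by
  refine continuousOn_integral_of_compact_support hζc
    (hg.mul ((hζ.comp continuous_snd).continuousOn.pow 2)) fun t x _ hx => ?_
  simp [image_eq_zero_of_notMem_tsupport hx]

section Solution
variable {d : ℕ}

/-- The energy of `v` localised by the square of `ζ`. -/
noncomputable def localEnergy (q : ℝ) (ζ : EuclideanSpace ℝ (Fin d) → ℝ)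
    (v : ℝ → EuclideanSpace ℝ (Fin d) → ℝ) (t : ℝ) : ℝ :=
  ∫ x, (‖gradient (v t) x‖ ^ q + ‖v t x‖ ^ q) * ζ x ^ 2

lemma continuousOn_slice {X Y : Type*} [TopologicalSpace X] [TopologicalSpace Y] {g : ℝ → X → Y}
    {I : Set ℝ} (hg : ContinuousOn (fun p : ℝ × X => g p.1 p.2) (I ×ˢ univ)) {t : ℝ}
    (ht : t ∈ I) : Continuous (g t) :=
  hg.comp_continuous (by fun_prop : Continuous fun x : X => (t, x)) fun _ => ⟨ht, mem_univ _⟩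

/-- Gronwall's lemma for the localised energy of a solution: the energy and the dissipation are
bounded in terms of the initial energy and of the source, up to an error `ℓ² M^q` from the
cut-off. -/
lemma exists_localEnergy_bound (hd : 3 ≤ d) {θ δ β q : ℝ} (hθ : (d : ℝ) / 2 < θ) (hq : d < q)
    (hδ : 0 < δ) (hδq : δ * q ^ 2 < 1) (hβ : 0 < β) :
    ∃ c C : ℝ, 0 < c ∧ 0 ≤ C ∧
      ∀ {b F : ℝ → EuclideanSpace ℝ (Fin d) → EuclideanSpace ℝ (Fin d)} {gδ gβ : ℝ → ℝ},
      IsFormBounded b δ gδ → IsBoundedSmooth b → IsFormBounded F β gβ → IsBoundedSmooth F →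
      ∀ {s r T : ℝ}, 0 ≤ s → s ≤ r → r ≤ T →
      ∀ {h : ℝ → EuclideanSpace ℝ (Fin d) → ℝ},
      ContinuousOn (fun p : ℝ × EuclideanSpace ℝ (Fin d) => h p.1 p.2) (Icc 0 T ×ˢ univ) →
      ∀ {f : EuclideanSpace ℝ (Fin d) → ℝ} {v : ℝ → EuclideanSpace ℝ (Fin d) → ℝ},
      IsSolution b (fun t x => ‖F t x‖ * h t x) f s T v →
      ∀ {M : ℝ}, 0 ≤ M → (∀ t ∈ Icc s T, ∀ x, |v t x| ≤ M) →
      ∀ {ψ : EuclideanSpace ℝ (Fin d) → ℝ}, ContDiff ℝ 1 ψ → HasCompactSupport ψ →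
      (∀ x, 0 ≤ ψ x) → (∀ x, ψ x ≤ 1) → ∀ {ℓ : ℝ}, 0 ≤ ℓ → ℓ ≤ 1 → (∀ x, ‖fderiv ℝ ψ x‖ ≤ ℓ) →
      (∀ t ∈ Icc s r, localEnergy q (cutWeight θ q ψ) v t
        ≤ (localEnergy q (cutWeight θ q ψ) v s
          + ∫ t in Icc s r, C * ((∫ x, ‖F t x‖ ^ 2 * |h t x| ^ q * cutWeight θ q ψ x ^ 2)
            + ℓ ^ 2 * M ^ q)) * Real.exp (∫ t in Icc 0 T, C * (1 + gδ t + gβ t))) ∧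
      c * ∫ t in Icc s r, (∫ x, ‖fderiv ℝ (fun y => ‖gradient (v t) y‖ ^ (q / 2)) x‖ ^ 2
            * cutWeight θ q ψ x ^ 2)
        ≤ (localEnergy q (cutWeight θ q ψ) v s
          + ∫ t in Icc s r, C * ((∫ x, ‖F t x‖ ^ 2 * |h t x| ^ q * cutWeight θ q ψ x ^ 2)
            + ℓ ^ 2 * M ^ q)) * (1 + (∫ t in Icc 0 T, C * (1 + gδ t + gβ t))
              * Real.exp (∫ t in Icc 0 T, C * (1 + gδ t + gβ t))) := by
  have hd' : (3 : ℝ) ≤ d := by exact_mod_cast hd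
  have hq3 : 3 < q := by linarith
  have hq0 : 0 < q := by linarith
  obtain ⟨c, C, hc, hC, hslice⟩ := exists_energy_slice_bound hd hθ hq hδ hδq hβ
  refine ⟨c, C, hc, hC, ?_⟩
  intro b F gδ gβ hb hbs hF hFs s r T hs hsr hrT h hh f v hv M hM0 hM ψ hψ hψc hψ0 hψ1 ℓ hℓ0 hℓ1 hℓ
  set e := EuclideanSpace.basisFun (Fin d) ℝ with he
  set ζ := cutWeight θ q ψ with hζdef
  have hζ : ContDiff ℝ 1 ζ := contDiff_cutWeight hq0 hψ
  have hζc : HasCompactSupport ζ := hasCompactSupport_cutWeight hq0 hψc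
  have hsub : Icc s r ⊆ Icc s T := Icc_subset_Icc_right hrT
  have hsub0 : Icc s T ⊆ Icc 0 T := Icc_subset_Icc_left hs
  have hsubI : Icc s T ⊆ Ici (0 : ℝ) := fun t ht => hs.trans ht.1
  have hh' := hh.mono (prod_mono_left (t := univ) hsub0)
  have hbc := hbs.smooth.continuousOn
  have hFc := hFs.smooth.continuousOn
  have hbc' := hbc.mono (prod_mono_left (t := univ) hsubI)
  have hFc' := hFc.mono (prod_mono_left (t := univ) hsubI)
  have hv0 := hv.continuousOn
  have hv1 := hv.continuousOn_fderiv
  have hv2 := hv.continuousOn_fderiv_fderiv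
  have hw : ∀ t ∈ Icc s T, ContDiff ℝ 1 (gradient (v t)) := fun t ht =>
    contDiff_gradient (hv.contDiff t ht)
  have hw0 := continuousOn_gradient hv1
  have hw1 := continuousOn_fderiv_gradient hv.contDiff hv2
  set G : ℝ → EuclideanSpace ℝ (Fin d) → ℝ := fun t x => divergence e (gradient (v t)) x
    - inner ℝ (b t x) (gradient (v t) x) + ‖F t x‖ * h t x with hG
  set Ψ : ℝ → EuclideanSpace ℝ (Fin d) → ℝ := fun t => energySubgradient e q ζ (v t) with hΨ
  have hGc : ContinuousOn (fun p : ℝ × EuclideanSpace ℝ (Fin d) => G p.1 p.2)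
      (Icc s T ×ˢ univ) :=
    ((continuousOn_divergence e (w := fun t => gradient (v t)) hw1).sub
      (hbc'.inner hw0)).add (hFc'.norm.mul hh')
  have hΨc : ContinuousOn (fun p : ℝ × EuclideanSpace ℝ (Fin d) => Ψ p.1 p.2)
      (Icc s T ×ˢ univ) := continuousOn_energySubgradient e hq3 hζ hv.contDiff hv0 hv1 hv2
  have hΨ0 : ∀ t ∈ Icc s T, ∀ x, x ∉ tsupport ζ → Ψ t x = 0 := fun t _ x hx =>
    energySubgradient_eq_zero_of_notMem_tsupport e hx
  have hvG : ∀ t ∈ Icc s T, ∀ x, HasDerivWithinAt (fun τ => v τ x) (G t x) (Icc s T) t :=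
    fun t ht x => by
      have := hv.equation t ht x
      rwa [laplacian_eq_divergence_gradient e (hv.contDiff t ht)] at this
  have hNc : ContinuousOn (localEnergy q ζ v) (Icc s T) :=
    continuousOn_integral_mul_sq ((hw0.norm.rpow_const fun _ _ => Or.inr hq0.le).add
      (hv0.norm.rpow_const fun _ _ => Or.inr hq0.le)) hζ.continuous hζc
  have hJc : ContinuousOn (fun t => ∫ x, ‖fderiv ℝ (fun y => ‖gradient (v t) y‖ ^ (q / 2)) x‖ ^ 2
      * ζ x ^ 2) (Icc s T) :=
    continuousOn_integral_mul_sq ((continuousOn_fderiv_norm_rpow (w := fun t => gradient (v t))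
      (by linarith) hw hw0 hw1).norm.pow 2) hζ.continuous hζc
  have hkc : ContinuousOn (fun t => ∫ x, ‖F t x‖ ^ 2 * |h t x| ^ q * ζ x ^ 2) (Icc s T) :=
    continuousOn_integral_mul_sq (g := fun t x => ‖F t x‖ ^ 2 * |h t x| ^ q) ((hFc'.norm.pow 2).mul
      (hh'.abs.rpow_const fun _ _ => Or.inr hq0.le)) hζ.continuous hζc
  have hDc : ContinuousOn (fun t => ∫ x, G t x * Ψ t x) (Icc s T) :=
    continuousOn_integral_of_compact_support hζc (hGc.mul hΨc) fun t x ht hx => by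
      simp only [hΨ0 t ht x hx, mul_zero]
  have hg0 : ∀ t ∈ Icc 0 T, 0 ≤ C * (1 + gδ t + gβ t) := fun t ht => by
    have := hb.g_nonneg t ht.1
    have := hF.g_nonneg t ht.1
    positivity
  have hgi : IntegrableOn (fun t => C * (1 + gδ t + gβ t)) (Icc 0 T) := by
    have hIci : Icc 0 T ⊆ Ici (0 : ℝ) := fun t ht => ht.1
    have k0 : IntegrableOn (fun _ : ℝ => (1 : ℝ)) (Icc 0 T) :=
      continuousOn_const.integrableOn_compact isCompact_Icc
    have k1 := hb.g_locallyIntegrable.integrableOn_compact_subset hIci (isCompact_Icc (b := T))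
    have k2 := hF.g_locallyIntegrable.integrableOn_compact_subset hIci (isCompact_Icc (b := T))
    exact ((Integrable.add k0 k1).add k2).const_mul C
  have hsub' : Icc s r ⊆ Icc 0 T := hsub.trans hsub0
  have hA : ∫ t in Icc s r, C * (1 + gδ t + gβ t) ≤ ∫ t in Icc 0 T, C * (1 + gδ t + gβ t) :=
    setIntegral_mono_set hgi ((ae_restrict_mem measurableSet_Icc).mono fun t ht => hg0 t ht)
      hsub'.eventuallyLE
  have hA0 : 0 ≤ ∫ t in Icc s r, C * (1 + gδ t + gβ t) :=
    setIntegral_nonneg measurableSet_Icc fun t ht => hg0 t (hsub' ht)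
  have hk0 : ∀ t, 0 ≤ C * ((∫ x, ‖F t x‖ ^ 2 * |h t x| ^ q * ζ x ^ 2) + ℓ ^ 2 * M ^ q) :=
    fun t => mul_nonneg hC (add_nonneg (integral_nonneg fun x => by positivity) (by positivity))
  have hN0 : ∀ t, 0 ≤ localEnergy q ζ v t := fun t => integral_nonneg fun x => by positivity
  have hae : ∀ᵐ t ∂volume.restrict (Icc s r), (∫ x, G t x * Ψ t x)
      ≤ -c * (∫ x, ‖fderiv ℝ (fun y => ‖gradient (v t) y‖ ^ (q / 2)) x‖ ^ 2 * ζ x ^ 2)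
        + C * (1 + gδ t + gβ t) * localEnergy q ζ v t
        + C * ((∫ x, ‖F t x‖ ^ 2 * |h t x| ^ q * ζ x ^ 2) + ℓ ^ 2 * M ^ q) := by
    have hsubr : Icc s r ⊆ Ici (0 : ℝ) := hsub.trans hsubI
    filter_upwards [ae_restrict_of_ae_restrict_of_subset hsubr (hb.ae_slice hbc),
      ae_restrict_of_ae_restrict_of_subset hsubr (hF.ae_slice hFc),
      ae_restrict_mem measurableSet_Icc] with t ht1 ht2 ht
    have htT := hsub ht
    have := hslice (hv.contDiff t htT) (hM t htT) hψ hψc hψ0 hψ1 hℓ1 hℓ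
      (continuousOn_slice hbc' htT) (continuousOn_slice hFc' htT).norm (continuousOn_slice hh' htT)
      (hb.g_nonneg t (hsubr ht)) (hF.g_nonneg t (hsubr ht)) ht1 ht2
    refine this.trans (le_of_eq ?_)
    rw [localEnergy]
    ring
  obtain ⟨r1, r2⟩ := energy_bound_of_differential_inequality hsr hc.le (hNc.mono hsub)
    (fun t _ => hN0 t) (hDc.mono hsub)
    (fun t ht => hasDerivAt_of_subgradient hζc ⟨ht.1, ht.2.trans_le hrT⟩
      (fun t ht => (hv.contDiff t ht).continuous) hGc hvG hΨc hΨ0 fun t ht t' ht' =>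
        integral_sub_mul_energySubgradient_le e hq3 hζ hζc (hv.contDiff t ht) (hv.contDiff t' ht'))
    (hJc.mono hsub) (fun t _ => integral_nonneg fun x => by positivity)
    (continuousOn_const.mul ((hkc.mono hsub).add continuousOn_const)) (fun t _ => hk0 t)
    (hgi.mono_set hsub') (fun t ht => hg0 t (hsub' ht)) hae
  have hE0 : 0 ≤ localEnergy q ζ v s
      + ∫ t in Icc s r, C * ((∫ x, ‖F t x‖ ^ 2 * |h t x| ^ q * ζ x ^ 2) + ℓ ^ 2 * M ^ q) :=
    add_nonneg (hN0 s) (setIntegral_nonneg measurableSet_Icc fun t _ => hk0 t)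
  have hexp := Real.exp_le_exp.2 hA
  refine ⟨fun t ht => (r1 t ht).trans (mul_le_mul_of_nonneg_left hexp hE0),
    r2.trans (mul_le_mul_of_nonneg_left (add_le_add_right ?_ 1) hE0)⟩
  exact mul_le_mul hA hexp (Real.exp_pos _).le (hA0.trans hA)

end Solution

/-! ### Removing the cut-off -/

section Limit
variable {d : ℕ} {θ q : ℝ}

lemma eLpNorm_weightMeasure_rpow {G : Type*} [NormedAddCommGroup G] (hq : 0 < q)
    (f : EuclideanSpace ℝ (Fin d) → G) :
    eLpNorm f (ENNReal.ofReal q) (weightMeasure d 1 θ) ^ q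
      = ∫⁻ x, ENNReal.ofReal (‖f x‖ ^ q * weight 1 θ x) := by
  have hp : (ENNReal.ofReal q).toReal = q := ENNReal.toReal_ofReal hq.le
  rw [eLpNorm_eq_lintegral_rpow_enorm_toReal (by simpa using hq) ENNReal.ofReal_ne_top, hp,
    ← ENNReal.rpow_mul, one_div_mul_cancel hq.ne', ENNReal.rpow_one, weightMeasure,
    lintegral_withDensity_eq_lintegral_mul_non_measurable _
      (contDiff_weight θ).continuous.measurable.ennreal_ofReal (by simp)]
  refine lintegral_congr fun x => ?_
  rw [Pi.mul_apply, mul_comm, ENNReal.ofReal_mul (by positivity), ← ofReal_norm,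
    ENNReal.ofReal_rpow_of_nonneg (norm_nonneg _) hq.le]

lemma eLpNorm_two_weightMeasure_sq {G : Type*} [NormedAddCommGroup G]
    (f : EuclideanSpace ℝ (Fin d) → G) :
    eLpNorm f 2 (weightMeasure d 1 θ) ^ 2
      = ∫⁻ x, ENNReal.ofReal (‖f x‖ ^ 2 * weight 1 θ x) := by
  have := eLpNorm_weightMeasure_rpow (θ := θ) (q := 2) two_pos f
  rw [ENNReal.ofReal_ofNat] at this
  simpa using this

lemma ofReal_integral_le_lintegral {α : Type*} [MeasurableSpace α] {μ : Measure α} {g : α → ℝ}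
    (hg : ∀ x, 0 ≤ g x) : ENNReal.ofReal (∫ x, g x ∂μ) ≤ ∫⁻ x, ENNReal.ofReal (g x) ∂μ := by
  refine (Real.ofReal_le_enorm _).trans ((enorm_integral_le_lintegral_enorm _).trans_eq ?_)
  exact lintegral_congr fun x => Real.enorm_eq_ofReal (hg x)

lemma ofReal_integral_mul_cutWeight_sq_le (hq : 0 < q) {ψ g : EuclideanSpace ℝ (Fin d) → ℝ}
    (hψ0 : ∀ x, 0 ≤ ψ x) (hψ1 : ∀ x, ψ x ≤ 1) (hg : ∀ x, 0 ≤ g x) :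
    ENNReal.ofReal (∫ x, g x * cutWeight θ q ψ x ^ 2)
      ≤ ∫⁻ x, ENNReal.ofReal (g x * weight 1 θ x) :=
  (ofReal_integral_le_lintegral fun x => mul_nonneg (hg x) (sq_nonneg _)).trans <|
    lintegral_mono fun x => ENNReal.ofReal_le_ofReal <|
      mul_le_mul_of_nonneg_left (cutWeight_sq_le hq hψ0 hψ1 x) (hg x)

/-- Fatou's lemma for cut-offs that increase to the whole space. -/
lemma lintegral_mul_weight_le_liminf (hq : 0 < q) {ψ : ℕ → EuclideanSpace ℝ (Fin d) → ℝ}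
    (hψ : ∀ k, ContDiff ℝ 1 (ψ k)) (hψc : ∀ k, HasCompactSupport (ψ k))
    (hψ0 : ∀ k x, 0 ≤ ψ k x) (hψ1 : ∀ x, ∀ᶠ k in Filter.atTop, ψ k x = 1)
    {g : EuclideanSpace ℝ (Fin d) → ℝ} (hg : Continuous g) (hg0 : ∀ x, 0 ≤ g x) :
    ∫⁻ x, ENNReal.ofReal (g x * weight 1 θ x)
      ≤ Filter.liminf (fun k => ENNReal.ofReal (∫ x, g x * cutWeight θ q (ψ k) x ^ 2))
        Filter.atTop := by
  have hζ : ∀ k, Continuous (cutWeight θ q (ψ k)) := fun k =>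
    (contDiff_cutWeight hq (hψ k)).continuous
  have h1 : ∀ k, ENNReal.ofReal (∫ x, g x * cutWeight θ q (ψ k) x ^ 2)
      = ∫⁻ x, ENNReal.ofReal (g x * cutWeight θ q (ψ k) x ^ 2) := fun k => by
    refine ofReal_integral_eq_lintegral_ofReal ?_
      (Filter.Eventually.of_forall fun x => mul_nonneg (hg0 x) (sq_nonneg _))
    refine integrable_of_forall_notMem_tsupport (hg.mul ((hζ k).pow 2))
      (hasCompactSupport_cutWeight (θ := θ) hq (hψc k)) fun x hx => ?_
    simp [image_eq_zero_of_notMem_tsupport hx]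
  simp only [h1]
  refine le_trans (lintegral_mono fun x => ?_)
    (lintegral_liminf_le' fun k => ((hg.mul ((hζ k).pow 2)).measurable.ennreal_ofReal).aemeasurable)
  have h2 : Filter.Tendsto (fun k => ENNReal.ofReal (g x * cutWeight θ q (ψ k) x ^ 2))
      Filter.atTop (nhds (ENNReal.ofReal (g x * weight 1 θ x))) := by
    refine tendsto_const_nhds.congr' ?_
    filter_upwards [hψ1 x] with k hk
    rw [cutWeight_sq (hψ0 k), hk, Real.one_rpow, mul_one]
  exact h2.liminf_eq.ge

/-- A bound up to an error that tends to zero is inherited by the lower limit. -/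
lemma liminf_ofReal_le {X : ℕ → ℝ} {K : ℝ} {Y : ℝ≥0∞} {B : ℝ≥0∞} {ε : ℕ → ℝ≥0∞} {Z : ℕ → ℝ}
    (hX : ∀ k, X k ≤ Z k * K) (hZ0 : ∀ k, 0 ≤ Z k) (hZ : ∀ k, ENNReal.ofReal (Z k) ≤ B + ε k)
    (hε : Filter.Tendsto ε Filter.atTop (nhds 0))
    (hY : Y ≤ Filter.liminf (fun k => ENNReal.ofReal (X k)) Filter.atTop) :
    Y ≤ ENNReal.ofReal K * B := by
  have h1 : ∀ k, ENNReal.ofReal (X k) ≤ ENNReal.ofReal K * (B + ε k) := fun k =>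
    calc ENNReal.ofReal (X k) ≤ ENNReal.ofReal (Z k * K) := ENNReal.ofReal_le_ofReal (hX k)
      _ = ENNReal.ofReal K * ENNReal.ofReal (Z k) := by
        rw [ENNReal.ofReal_mul (hZ0 k), mul_comm]
      _ ≤ _ := by gcongr; exact hZ k
  have h2 : Filter.Tendsto (fun k => ENNReal.ofReal K * (B + ε k)) Filter.atTop
      (nhds (ENNReal.ofReal K * B)) := by
    refine ENNReal.Tendsto.const_mul ?_ (Or.inr ENNReal.ofReal_ne_top)
    simpa using tendsto_const_nhds.add hε
  exact hY.trans ((Filter.liminf_le_liminf (Filter.Eventually.of_forall h1)).trans_eq h2.liminf_eq)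

lemma supLpNorm_rpow_le {G : Type*} [NormedAddCommGroup G] (hq : 0 < q) {s r : ℝ}
    {u : ℝ → EuclideanSpace ℝ (Fin d) → G} {B : ℝ≥0∞}
    (h : ∀ t ∈ Icc s r, ∫⁻ x, ENNReal.ofReal (‖u t x‖ ^ q * weight 1 θ x) ≤ B) :
    supLpNorm q s r (weightMeasure d 1 θ) u ^ q ≤ B := by
  rw [← ENNReal.le_rpow_inv_iff hq]
  refine essSup_le_of_ae_le _ ?_
  filter_upwards [ae_restrict_mem measurableSet_Icc] with t ht
  rw [ENNReal.le_rpow_inv_iff hq, eLpNorm_weightMeasure_rpow hq]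
  exact h t ht

end Limit

lemma continuousOn_schwartz_uncurry {V : Type*} [NormedAddCommGroup V] [NormedSpace ℝ V]
    {h : ℝ → 𝓢(V, ℝ)} {I : Set ℝ} (hh : ContinuousOn h I) :
    ContinuousOn (fun p : ℝ × V => h p.1 p.2) (I ×ˢ univ) := by
  have h1 : ContinuousOn (fun p : ℝ × V =>
      SchwartzMap.toBoundedContinuousFunctionCLM ℝ V ℝ (h p.1)) (I ×ˢ univ) :=
    (SchwartzMap.toBoundedContinuousFunctionCLM ℝ V ℝ).continuous.comp_continuousOn
      (hh.comp continuousOn_fst fun p hp => hp.1)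
  have h2 := h1.eval continuousOn_snd
  exact h2

theorem theorem2 (d : ℕ) (hd : 3 ≤ d) (θ : ℝ) (hθ : (d : ℝ) / 2 < θ)
    (δ β : ℝ) (gδ gβ : ℝ → ℝ) (hδ : δ < (d : ℝ) ^ (-2 : ℝ))
    (q : ℝ) (hdq : (d : ℝ) < q) (hqδ : q < δ ^ (-(1 / 2) : ℝ)) (T : ℝ) :
    ∃ (κ : ℝ) (C : ℝ≥0), 0 < κ ∧
      ∀ (b F : ℝ → EuclideanSpace ℝ (Fin d) → EuclideanSpace ℝ (Fin d)),
        IsFormBounded b δ gδ → IsBoundedSmooth b →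
        IsFormBounded F β gβ → IsBoundedSmooth F →
      ∀ (h : ℝ → 𝓢(EuclideanSpace ℝ (Fin d), ℝ)), ContinuousOn h (Icc 0 T) →
      ∀ (f : EuclideanSpace ℝ (Fin d) → ℝ), ContDiff ℝ ∞ f → HasCompactSupport f →
      ∀ (s r : ℝ), 0 ≤ s → s ≤ r → r ≤ T →
      ∀ (v : ℝ → EuclideanSpace ℝ (Fin d) → ℝ),
        IsSolution b (fun t x => ‖F t x‖ * h t x) f s T v →
        supLpNorm q s r (weightMeasure d κ θ) v ^ q
          + supLpNorm q s r (weightMeasure d κ θ) (fun t => gradient (v t)) ^ q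
          + sqLTwoNorm s r (weightMeasure d κ θ)
              (fun t => gradient (fun y => ‖gradient (v t) y‖ ^ (q / 2)))
        ≤ C * (sqLTwoNorm s r (weightMeasure d κ θ)
                (fun t x => |h t x| ^ (q / 2) • F t x)
              + eLpNorm (gradient f) (ENNReal.ofReal q) (weightMeasure d κ θ) ^ q
              + eLpNorm f (ENNReal.ofReal q) (weightMeasure d κ θ) ^ q) := by
  -- form-bounds are positive, so nothing has to be shown unless `δ` and `β` are
  by_cases hpos : 0 < δ ∧ 0 < β
  swap
  · refine ⟨1, 0, one_pos, fun b F hb _ hF => absurd ⟨hb.bound_pos, hF.bound_pos⟩ hpos⟩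
  obtain ⟨hδ0, hβ0⟩ := hpos
  have hd' : (3 : ℝ) ≤ d := by exact_mod_cast hd
  have hq0 : 0 < q := by linarith
  have hδq : δ * q ^ 2 < 1 := by
    have h1 : q ^ 2 < (δ ^ (-(1 / 2) : ℝ)) ^ 2 := by gcongr
    rw [← Real.rpow_mul_natCast hδ0.le] at h1
    norm_num at h1
    rw [Real.rpow_neg_one] at h1
    calc δ * q ^ 2 < δ * δ⁻¹ := by gcongr
      _ = 1 := mul_inv_cancel₀ hδ0.ne'
  obtain ⟨c, C, hc, hC, hmain⟩ := exists_localEnergy_bound hd hθ hdq hδ0 hδq hβ0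
  set E : ℝ := Real.exp (∫ t in Icc 0 T, C * (1 + gδ t + gβ t)) with hE
  set E' : ℝ := 1 + (∫ t in Icc 0 T, C * (1 + gδ t + gβ t)) * E with hE'
  refine ⟨1, (E.toNNReal + E.toNNReal + (E' / c).toNNReal) * (1 + C.toNNReal), one_pos, ?_⟩
  intro b F hb hbs hF hFs h hh f hf hfc s r hs hsr hrT v hv
  obtain ⟨ψ, hψ, hψc, hψ0, hψ1, hψd, hψlim⟩ := exists_cutoff d
  obtain ⟨M, hM⟩ := hv.bounded
  have hsT : s ∈ Icc s T := ⟨le_rfl, hsr.trans hrT⟩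
  have hM0 : 0 ≤ M := (abs_nonneg _).trans (hM s hsT 0)
  have hsub : Icc s r ⊆ Icc s T := Icc_subset_Icc_right hrT
  have hvs : v s = f := funext hv.initial
  have hhc := continuousOn_schwartz_uncurry hh
  set ℓ : ℕ → ℝ := fun k => 1 / ((k : ℝ) + 1) with hℓ
  have hℓ0 : ∀ k, 0 ≤ ℓ k := fun k => by positivity
  have hℓ1 : ∀ k, ℓ k ≤ 1 := fun k => by
    rw [hℓ]; simp only
    rw [div_le_one (by positivity)]
    linarith [Nat.cast_nonneg (α := ℝ) k]
  have hk := fun k => hmain hb hbs hF hFs hs hsr hrT (h := fun t x => h t x) hhc hv hM0 hM (hψ k)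
    (hψc k) (hψ0 k) (hψ1 k) (hℓ0 k) (hℓ1 k) (hψd k)
  set Z : ℕ → ℝ := fun k => localEnergy q (cutWeight θ q (ψ k)) v s
    + ∫ t in Icc s r, C * ((∫ x, ‖F t x‖ ^ 2 * |h t x| ^ q * cutWeight θ q (ψ k) x ^ 2)
            + ℓ k ^ 2 * M ^ q) with hZ
  have hm0 : ∀ k t, 0 ≤ (∫ x, ‖F t x‖ ^ 2 * |h t x| ^ q * cutWeight θ q (ψ k) x ^ 2) := fun k t =>
    integral_nonneg fun x => by positivity
  have hm0' : ∀ k, 0 ≤ ℓ k ^ 2 * M ^ q := fun k => by positivity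
  have hN0 : ∀ k t, 0 ≤ localEnergy q (cutWeight θ q (ψ k)) v t := fun k t =>
    integral_nonneg fun x => by positivity
  have hZ0 : ∀ k, 0 ≤ Z k := fun k => add_nonneg (hN0 k s)
    (setIntegral_nonneg measurableSet_Icc fun t _ =>
      mul_nonneg hC (add_nonneg (hm0 k t) (hm0' k)))
  -- the right-hand side
  set H : ℝ≥0∞ := sqLTwoNorm s r (weightMeasure d 1 θ) (fun t x => |h t x| ^ (q / 2) • F t x)
    with hH
  set I : ℝ≥0∞ := eLpNorm (gradient f) (ENNReal.ofReal q) (weightMeasure d 1 θ) ^ q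
    + eLpNorm f (ENNReal.ofReal q) (weightMeasure d 1 θ) ^ q with hI
  set ε : ℕ → ℝ≥0∞ := fun k => ENNReal.ofReal (C * (ℓ k ^ 2 * M ^ q)) * volume (Icc s r) with hε
  have hεlim : Filter.Tendsto ε Filter.atTop (nhds 0) := by
    have h1 : Filter.Tendsto (fun k => ENNReal.ofReal (C * (ℓ k ^ 2 * M ^ q))) Filter.atTop
        (nhds 0) := by
      have h2 : Filter.Tendsto ℓ Filter.atTop (nhds 0) := tendsto_one_div_add_atTop_nhds_zero_nat
      have h3 := ((h2.pow 2).mul_const (M ^ q)).const_mul C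
      simpa using ENNReal.tendsto_ofReal h3
    have h2 := ENNReal.Tendsto.mul_const (b := volume (Icc s r)) h1 (Or.inr (by simp))
    rwa [zero_mul] at h2
  have hHeq : H = ∫⁻ t in Icc s r, ∫⁻ x, ENNReal.ofReal
      (‖F t x‖ ^ 2 * |h t x| ^ q * weight 1 θ x) := by
    rw [hH, sqLTwoNorm]
    refine lintegral_congr fun t => ?_
    rw [eLpNorm_two_weightMeasure_sq]
    refine lintegral_congr fun x => ?_
    rw [norm_smul, mul_pow, Real.norm_of_nonneg (by positivity), ← Real.rpow_mul_natCast
      (abs_nonneg _), mul_comm (_ ^ _)]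
    norm_num
  have hvc : ∀ t ∈ Icc s T, Continuous fun x => ‖v t x‖ ^ q := fun t ht =>
    (hv.contDiff t ht).continuous.norm.rpow_const fun _ => Or.inr hq0.le
  have hwc : ∀ t ∈ Icc s T, Continuous fun x => ‖gradient (v t) x‖ ^ q := fun t ht =>
    (contDiff_gradient (hv.contDiff t ht)).continuous.norm.rpow_const fun _ => Or.inr hq0.le
  have hZle : ∀ k, ENNReal.ofReal (Z k) ≤ (I + ENNReal.ofReal C * H) + ε k := by
    intro k
    have h1 : ENNReal.ofReal (localEnergy q (cutWeight θ q (ψ k)) v s) ≤ I := by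
      refine (ofReal_integral_mul_cutWeight_sq_le hq0 (hψ0 k) (hψ1 k)
        fun x => by positivity).trans_eq ?_
      rw [hI, eLpNorm_weightMeasure_rpow hq0, eLpNorm_weightMeasure_rpow hq0, ← lintegral_add_left]
      · refine lintegral_congr fun x => ?_
        have := (weight_pos θ x).le
        rw [hvs, add_mul, ENNReal.ofReal_add (by positivity) (by positivity)]
      · rw [← hvs]
        exact ((hwc s hsT).mul (contDiff_weight θ).continuous).measurable.ennreal_ofReal
    have h2 : ENNReal.ofReal (∫ t in Icc s r, C * ((∫ x, ‖F t x‖ ^ 2 * |h t x| ^ q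
        * cutWeight θ q (ψ k) x ^ 2) + ℓ k ^ 2 * M ^ q)) ≤ ENNReal.ofReal C * H + ε k := by
      refine (ofReal_integral_le_lintegral fun t =>
        mul_nonneg hC (add_nonneg (hm0 k t) (hm0' k))).trans ?_
      rw [hHeq, ← lintegral_const_mul' _ _ ENNReal.ofReal_ne_top]
      simp only [hε]
      rw [← setLIntegral_const, ← lintegral_add_right _ measurable_const]
      refine lintegral_mono fun t => ?_
      rw [mul_add, ENNReal.ofReal_add (mul_nonneg hC (hm0 k t)) (mul_nonneg hC (hm0' k)),
        ENNReal.ofReal_mul hC]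
      gcongr
      exact ofReal_integral_mul_cutWeight_sq_le hq0 (hψ0 k) (hψ1 k) fun x => by positivity
    rw [hZ]
    simp only
    rw [ENNReal.ofReal_add (hN0 k s) (setIntegral_nonneg measurableSet_Icc fun t _ =>
      mul_nonneg hC (add_nonneg (hm0 k t) (hm0' k))), add_assoc]
    exact add_le_add h1 h2
  -- the energy
  have hsup : ∀ t ∈ Icc s r, ∫⁻ x, ENNReal.ofReal
      ((‖gradient (v t) x‖ ^ q + ‖v t x‖ ^ q) * weight 1 θ x)
      ≤ ENNReal.ofReal E * (I + ENNReal.ofReal C * H) := fun t ht =>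
    liminf_ofReal_le (fun k => (hk k).1 t ht) hZ0 hZle hεlim
      (lintegral_mul_weight_le_liminf hq0 hψ hψc hψ0 hψlim
        ((hwc t (hsub ht)).add (hvc t (hsub ht))) fun x => by positivity)
  have hv' : supLpNorm q s r (weightMeasure d 1 θ) v ^ q
      ≤ ENNReal.ofReal E * (I + ENNReal.ofReal C * H) :=
    supLpNorm_rpow_le hq0 fun t ht => (lintegral_mono fun x => ENNReal.ofReal_le_ofReal
      (mul_le_mul_of_nonneg_right (le_add_of_nonneg_left (by positivity))
        (weight_pos θ x).le)).trans (hsup t ht)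
  have hw' : supLpNorm q s r (weightMeasure d 1 θ) (fun t => gradient (v t)) ^ q
      ≤ ENNReal.ofReal E * (I + ENNReal.ofReal C * H) :=
    supLpNorm_rpow_le hq0 fun t ht => (lintegral_mono fun x => ENNReal.ofReal_le_ofReal
      (mul_le_mul_of_nonneg_right (le_add_of_nonneg_right (by positivity))
        (weight_pos θ x).le)).trans (hsup t ht)
  -- the dissipation
  set j : ℝ → EuclideanSpace ℝ (Fin d) → ℝ := fun t x =>
    ‖fderiv ℝ (fun y => ‖gradient (v t) y‖ ^ (q / 2)) x‖ ^ 2 with hj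
  have hjc : ContinuousOn (fun p : ℝ × EuclideanSpace ℝ (Fin d) => j p.1 p.2)
      (Icc s T ×ˢ univ) :=
    (continuousOn_fderiv_norm_rpow (w := fun t => gradient (v t)) (by linarith)
      (fun t ht => contDiff_gradient (hv.contDiff t ht))
      (continuousOn_gradient hv.continuousOn_fderiv)
      (continuousOn_fderiv_gradient hv.contDiff hv.continuousOn_fderiv_fderiv)).norm.pow 2
  have hJc : ∀ k, ContinuousOn (fun t => ∫ x, j t x * cutWeight θ q (ψ k) x ^ 2) (Icc s r) :=
    fun k => (continuousOn_integral_mul_sq hjc (contDiff_cutWeight hq0 (hψ k)).continuous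
      (hasCompactSupport_cutWeight hq0 (hψc k))).mono hsub
  have hdis : sqLTwoNorm s r (weightMeasure d 1 θ)
      (fun t => gradient (fun y => ‖gradient (v t) y‖ ^ (q / 2)))
      ≤ ENNReal.ofReal (E' / c) * (I + ENNReal.ofReal C * H) := by
    refine liminf_ofReal_le (X := fun k => ∫ t in Icc s r, ∫ x,
      j t x * cutWeight θ q (ψ k) x ^ 2) (fun k => ?_) hZ0 hZle hεlim ?_
    · rw [mul_div_assoc', le_div_iff₀ hc, mul_comm]
      exact (hk k).2
    have h1 : ∀ k, ENNReal.ofReal (∫ t in Icc s r, ∫ x, j t x * cutWeight θ q (ψ k) x ^ 2)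
        = ∫⁻ t in Icc s r, ENNReal.ofReal (∫ x, j t x * cutWeight θ q (ψ k) x ^ 2) := fun k =>
      ofReal_integral_eq_lintegral_ofReal ((hJc k).integrableOn_compact isCompact_Icc)
        (Filter.Eventually.of_forall fun t => integral_nonneg fun x => by positivity)
    simp only [h1]
    refine le_trans ?_ (lintegral_liminf_le' fun k =>
      ((hJc k).aemeasurable measurableSet_Icc).ennreal_ofReal)
    refine setLIntegral_mono' measurableSet_Icc fun t ht => ?_
    rw [eLpNorm_two_weightMeasure_sq]
    simp only [norm_gradient (fun y => ‖gradient (v t) y‖ ^ (q / 2))]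
    exact lintegral_mul_weight_le_liminf hq0 hψ hψc hψ0 hψlim
      (continuousOn_slice hjc (hsub ht)) fun x => by positivity
  have hsum : I + ENNReal.ofReal C * H ≤ (1 + ENNReal.ofReal C) * (H + I) := by
    rw [add_mul, one_mul, mul_add, add_comm H I]
    exact add_le_add le_self_add le_self_add
  calc _ ≤ ENNReal.ofReal E * (I + ENNReal.ofReal C * H)
        + ENNReal.ofReal E * (I + ENNReal.ofReal C * H)
        + ENNReal.ofReal (E' / c) * (I + ENNReal.ofReal C * H) :=
      add_le_add (add_le_add hv' hw') hdis
    _ = (ENNReal.ofReal E + ENNReal.ofReal E + ENNReal.ofReal (E' / c))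
        * (I + ENNReal.ofReal C * H) := by ring
    _ ≤ (ENNReal.ofReal E + ENNReal.ofReal E + ENNReal.ofReal (E' / c))
        * ((1 + ENNReal.ofReal C) * (H + I)) := by gcongr
    _ = _ := by
      rw [hI, ← add_assoc, ← mul_assoc]
      simp only [ENNReal.coe_mul, ENNReal.coe_add, ENNReal.coe_one, ENNReal.ofReal]
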